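/- Setting. Let $G=(V,E,\sigma)$ be a finite weighted multigraph without loops, with weights $\sigma(e)>0$, embedded in the plane (vertices are distinct points, edges are simple arcs between their end vertices, open edges contain no vertex and are pairwise disjoint). Let $\mathcal C$ be a Jordan curve such that $G$ lies on $\mathcal C$ or inside it, let $S_1,S_2$ be two disjoint (nondegenerate, closed) arcs of $\mathcal C$, and let $A=V\cap S_1$ and $B=V\cap S_2$ be nonempty. Assume that an edge meets $S_1$ (resp. $S_2$) only at its end vertices, unless both of its end vertices lie in $A$ (resp. $B$). Call $G=(V,E,\sigma,A,B)$ a plane network with boundary. A path from $A$ to $B$ is a sequence of consecutive directed edges through distinct vertices whose first vertex is in $A$ and whose last vertex is in $B$. Let $x_\gamma$ be the unit flow along $\gamma$. Let $F$ be the conformal map from the inside of $\mathcal C$ onto a rectangle $(0,L)\times(0,1)$, extended homeomorphically to the closures, that takes $S_1$ to $\{0\}\times[0,1]$ and $S_2$ to $\{L\}\times[0,1]$. For a path $\gamma$ from $A$ to $B$ let $U_\gamma$ be the connected component of $\{z: 0\le \mathrm{Re}\, z\le L\}\setminus F(\gamma)$ that contains $-i$. A path $\gamma$ from $A$ to $B$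 is the top path in a subgraph $H$ (the subgraph formed by a set of edges and their end vertices) if $\gamma$ lies in $H$, meets $A$ only in its first and $B$ only in its last vertex, and $F(H)\subset\overline{U_\gamma}$. Two paths are non-crossing if one of them is the top path in their union, and a family of paths is non-crossing if any two distinct members are. A density $\rho:E\to[0,\infty)$ is admissible if $\sum_{e\in\gamma}\rho(e)\ge1$ for every path $\gamma$ from $A$ to $B$, and the extremal density $\rho^*$ is the admissible density that minimizes $\sum_e\sigma(e)\rho(e)^2$. The non-crossing minimal subfamily algorithm starts with $r(e)=\sigma(e)\rho^*(e)$ and $\Gamma=\emptyset$ and iterates: remove all edges with $r(e)=0$; if the remaining graph has no top path, stop; otherwise add its top path $\gamma$ to $\Gamma$, set $m_\gamma=\min_{e\in\gamma}r(e)$, and replace $r(e)$ by $r(e)-m_\gamma$ for every $e\in\gamma$. Its output is the family $\Gamma$ with the weights $(m_\gamma)_{\gamma\in\Gamma}$. Let $h:V\to\mathbb R$ satisfy $h=0$ on $A$, $h=1$ on $B$, and be discrete harmonic (with respect to $\sigma$) on $V\setminus(A\cup B)$, and let $f(xy)=\sigma(xy)(h(y)-h(x))$, for each directed edge $xy$,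 be the current flow from $A$ to $B$. A path flow decomposition of $f$ is an identity $f=\sum_{\gamma\in\Gamma}a_\gamma x_\gamma$ with a finite family $\Gamma$ of paths from $A$ to $B$ and coefficients $a_\gamma>0$, such that no two paths of $\Gamma$ run through an edge in opposite directions. Proposition. The algorithm terminates with an output, and for its output $\Gamma$, $(m_\gamma)_{\gamma\in\Gamma}$ the following hold. The family $\Gamma$ is non-crossing, and $f=\sum_{\gamma\in\Gamma}m_\gamma x_\gamma$ is a path flow decomposition of $f$. Moreover, if $f=\sum_{\gamma\in\tilde\Gamma}a_\gamma x_\gamma$ is any path flow decomposition of $f$ whose family $\tilde\Gamma$ is non-crossing, then $\tilde\Gamma=\Gamma$ and $a_\gamma=m_\gamma$ for all $\gamma\in\Gamma$. -/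

import Mathlib

/-- A Jordan curve in the plane: a homeomorphic image of the circle. -/
def IsJordanCurve (C : Set ℂ) : Prop :=
  ∃ g : Circle → ℂ, Continuous g ∧ Function.Injective g ∧ Set.range g = C

/-- An arc in the plane: a homeomorphic image of the unit interval. -/
def IsPlaneArc (S : Set ℂ) : Prop :=
  ∃ g : unitInterval → ℂ, Continuous g ∧ Function.Injective g ∧ Set.range g = S

/-- The interior of a closed curve: the points off the curve whose component in the complement
of the curve is bounded. -/
def curveInterior (C : Set ℂ) : Set ℂ :=
  {z | z ∉ C ∧ Bornology.IsBounded (connectedComponentIn Cᶜ z)}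

/-- A plane network with boundary: a finite weighted multigraph without loops, embedded in the
plane, and surrounded by a Jordan curve that carries two disjoint arcs. The vertices on the two
arcs are the boundary vertices.

The orientation of an edge from `tail e` to `head e` is only the one in which its arc is
parametrized; the network is undirected. -/
structure PlaneNetwork (V E : Type*) [Fintype V] [Fintype E] where
  /-- the position of a vertex -/
  point : V → ℂ
  point_injective : Function.Injective point
  tail : E → V
  head : E → V
  tail_ne_head : ∀ e, tail e ≠ head e
  /-- the arc that represents an edge -/
  arc : ∀ e, Path (point (tail e)) (point (head e))
  arc_injective : ∀ e, Function.Injective (arc e)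
  /-- the open arc of an edge contains no vertex -/
  arc_ne_point : ∀ e (t : unitInterval), t ≠ 0 → t ≠ 1 → ∀ v, arc e t ≠ point v
  /-- the open arcs of distinct edges are disjoint -/
  arc_ne_arc : ∀ e e', e ≠ e' → ∀ s t : unitInterval, s ≠ 0 → s ≠ 1 → t ≠ 0 → t ≠ 1 →
    arc e s ≠ arc e' t
  /-- the edge weights -/
  weight : E → ℝ
  weight_pos : ∀ e, 0 < weight e
  /-- the surrounding Jordan curve -/
  curve : Set ℂ
  isJordanCurve_curve : IsJordanCurve curve
  /-- the two boundary arcs -/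
  S₁ : Set ℂ
  S₂ : Set ℂ
  isPlaneArc_S₁ : IsPlaneArc S₁
  isPlaneArc_S₂ : IsPlaneArc S₂
  S₁_subset : S₁ ⊆ curve
  S₂_subset : S₂ ⊆ curve
  disjoint_S₁_S₂ : Disjoint S₁ S₂
  /-- the network lies on the curve or inside it; equivalently, the curve encircles the network
  in the closed outer face -/
  point_mem : ∀ v, point v ∈ curve ∪ curveInterior curve
  arc_mem : ∀ e t, arc e t ∈ curve ∪ curveInterior curve
  /-- an edge meets `S₁` or `S₂` only at its ends, unless it joins two vertices of that arc -/
  arc_mem_S₁ : ∀ e (t : unitInterval), t ≠ 0 → t ≠ 1 → arc e t ∈ S₁ →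
    point (tail e) ∈ S₁ ∧ point (head e) ∈ S₁
  arc_mem_S₂ : ∀ e (t : unitInterval), t ≠ 0 → t ≠ 1 → arc e t ∈ S₂ →
    point (tail e) ∈ S₂ ∧ point (head e) ∈ S₂
  exists_mem_S₁ : ∃ v, point v ∈ S₁
  exists_mem_S₂ : ∃ v, point v ∈ S₂

namespace PlaneNetwork

variable {V E : Type*} [Fintype V] [Fintype E]

/-- The boundary vertices on the first arc. -/
def A (N : PlaneNetwork V E) : Set V := {v | N.point v ∈ N.S₁}

/-- The boundary vertices on the second arc. -/
def B (N : PlaneNetwork V E) : Set V := {v | N.point v ∈ N.S₂}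

/-- The initial vertex of a directed edge; `(e, true)` is `e` from `tail e` to `head e`, and
`(e, false)` is `e` from `head e` to `tail e`. -/
def src (N : PlaneNetwork V E) (d : E × Bool) : V := if d.2 then N.tail d.1 else N.head d.1

/-- The terminal vertex of a directed edge. -/
def tgt (N : PlaneNetwork V E) (d : E × Bool) : V := if d.2 then N.head d.1 else N.tail d.1

/-- The same edge, directed the other way. -/
def rev (d : E × Bool) : E × Bool := (d.1, !d.2)

/-- A path from `A` to `B`: a sequence of directed edges, each starting where the one before it
ends, that passes through distinct vertices, the first one in `A` and the last one in `B`. -/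
@[ext]
structure ABPath (N : PlaneNetwork V E) where
  darts : List (E × Bool)
  ne_nil : darts ≠ []
  chain : darts.IsChain (fun d d' => N.tgt d = N.src d')
  nodup : (N.src (darts.head ne_nil) :: darts.map N.tgt).Nodup
  start_mem : N.src (darts.head ne_nil) ∈ N.A
  end_mem : N.tgt (darts.getLast ne_nil) ∈ N.B

/-- The set of edges of a path. -/
def ABPath.edges {N : PlaneNetwork V E} (γ : N.ABPath) : Set E := {e | ∃ d ∈ γ.darts, d.1 = e}

/-! ### Modulus -/

open Classical in
/-- The length of a path with respect to a density. -/
noncomputable def pathLength (N : PlaneNetwork V E) (ρ : E → ℝ) (γ : N.ABPath) : ℝ :=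
  ∑ e, if e ∈ γ.edges then ρ e else 0

/-- Admissible densities for the family of all paths from `A` to `B`. -/
def Admissible (N : PlaneNetwork V E) (ρ : E → ℝ) : Prop :=
  (∀ e, 0 ≤ ρ e) ∧ ∀ γ : N.ABPath, 1 ≤ N.pathLength ρ γ

/-- The 2-modulus of the family of all paths from `A` to `B`. -/
noncomputable def modulus (N : PlaneNetwork V E) : ℝ :=
  sInf {x | ∃ ρ, N.Admissible ρ ∧ x = ∑ e, N.weight e * ρ e ^ 2}

/-- The extremal density for the family of all paths from `A` to `B`. -/
def IsExtremalDensity (N : PlaneNetwork V E) (ρ : E → ℝ) : Prop :=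
  N.Admissible ρ ∧ N.modulus = ∑ e, N.weight e * ρ e ^ 2

/-! ### Voltage, current and path flows -/

open Classical in
/-- A function on the vertices is discrete harmonic at `v`. -/
def HarmonicAt (N : PlaneNetwork V E) (h : V → ℝ) (v : V) : Prop :=
  h v * ∑ d with N.src d = v, N.weight d.1 = ∑ d with N.src d = v, h (N.tgt d) * N.weight d.1

/-- The unit voltage function: the solution of the discrete Dirichlet problem with values `0` on
`A` and `1` on `B`. -/
def IsUnitVoltage (N : PlaneNetwork V E) (h : V → ℝ) : Prop :=
  (∀ v ∈ N.A, h v = 0) ∧ (∀ v ∈ N.B, h v = 1) ∧ ∀ v, v ∉ N.A → v ∉ N.B → N.HarmonicAt h v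

/-- The current flow of a voltage function, on directed edges (Ohm's law). -/
def currentFlow (N : PlaneNetwork V E) (h : V → ℝ) (d : E × Bool) : ℝ :=
  N.weight d.1 * (h (N.tgt d) - h (N.src d))

open Classical in
/-- The unit flow along a path. -/
noncomputable def pathFlow (N : PlaneNetwork V E) (γ : N.ABPath) (d : E × Bool) : ℝ :=
  if d ∈ γ.darts then 1 else if rev d ∈ γ.darts then -1 else 0

/-- A path flow decomposition of `f`: it is the sum of the path flows of the paths in `Γ` with
positive coefficients `a`, and no two of these paths run through an edge in opposite directions. -/
def IsPathFlowDecomposition (N : PlaneNetwork V E) (f : E × Bool → ℝ)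
    (Γ : Finset N.ABPath) (a : N.ABPath → ℝ) : Prop :=
  (∀ γ ∈ Γ, 0 < a γ) ∧
  (∀ γ ∈ Γ, ∀ γ' ∈ Γ, ∀ d ∈ γ.darts, rev d ∉ γ'.darts) ∧
  ∀ d, f d = ∑ γ ∈ Γ, a γ * N.pathFlow γ d

/-! ### Top paths and non-crossing paths -/

/-- `F` is the conformal map of the interior of the curve onto the rectangle `(0, L) × (0, 1)`
that takes `S₁` to the left side and `S₂` to the right side, together with its homeomorphic
extension to the boundary. -/
def IsRectangleMap (N : PlaneNetwork V E) (L : ℝ) (F : ℂ → ℂ) : Prop :=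
  0 < L ∧
  DifferentiableOn ℂ F (curveInterior N.curve) ∧
  F '' curveInterior N.curve = Set.Ioo 0 L ×ℂ Set.Ioo 0 1 ∧
  ContinuousOn F (N.curve ∪ curveInterior N.curve) ∧
  Set.BijOn F (N.curve ∪ curveInterior N.curve) (Set.Icc 0 L ×ℂ Set.Icc 0 1) ∧
  F '' N.S₁ = {0} ×ℂ Set.Icc 0 1 ∧
  F '' N.S₂ = {L} ×ℂ Set.Icc 0 1

/-- The subset of the plane covered by a set of edges (with their ends). -/
def trace (N : PlaneNetwork V E) (H : Set E) : Set ℂ := ⋃ e ∈ H, Set.range (N.arc e)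

/-- The component of the slit vertical strip `{z | 0 ≤ Re z ≤ L} \ F(γ)` that contains `-i`. -/
def regionUnder (N : PlaneNetwork V E) (L : ℝ) (F : ℂ → ℂ) (γ : N.ABPath) : Set ℂ :=
  connectedComponentIn ({z : ℂ | z.re ∈ Set.Icc 0 L} \ F '' N.trace γ.edges) (-Complex.I)

/-- `γ` is the top path in the subgraph with edge set `H`: it is a path in `H` that meets `A` only
in its first vertex and `B` only in its last vertex (so that the slit strip has just two
components), and the image of `H` lies in the closure of the region under `γ`. -/
def IsTopPath (N : PlaneNetwork V E) (L : ℝ) (F : ℂ → ℂ) (H : Set E) (γ : N.ABPath) : Prop :=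
  γ.edges ⊆ H ∧ (∀ d ∈ γ.darts, N.tgt d ∉ N.A ∧ N.src d ∉ N.B) ∧
    F '' N.trace H ⊆ closure (N.regionUnder L F γ)

/-- Two paths are non-crossing when one of them is the top path in the union of the two. -/
def NonCrossing (N : PlaneNetwork V E) (L : ℝ) (F : ℂ → ℂ) (γ γ' : N.ABPath) : Prop :=
  N.IsTopPath L F (γ.edges ∪ γ'.edges) γ ∨ N.IsTopPath L F (γ.edges ∪ γ'.edges) γ'

/-- A family of pairwise non-crossing paths. -/
def NonCrossingFamily (N : PlaneNetwork V E) (L : ℝ) (F : ℂ → ℂ) (Γ : Finset N.ABPath) : Prop :=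
  ∀ γ ∈ Γ, ∀ γ' ∈ Γ, γ ≠ γ' → N.NonCrossing L F γ γ'

/-! ### The non-crossing minimal subfamily algorithm -/

open Classical in
/-- `AlgorithmRun L F r l`: started with the values `r` on the edges, the iteration terminates and
picks the paths with the weights listed in `l`, in this order. The edges with value zero are
removed. If the remaining graph has no top path, the iteration stops. Otherwise the top path `γ`
is picked, its weight `m` is the minimum of `r` over its edges, `m` is subtracted from `r` on each
of its edges, and the iteration continues. -/
inductive AlgorithmRun (N : PlaneNetwork V E) (L : ℝ) (F : ℂ → ℂ) :
    (E → ℝ) → List (N.ABPath × ℝ) → Prop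
  | done (r : E → ℝ) (h : ¬ ∃ γ, N.IsTopPath L F {e | r e ≠ 0} γ) : AlgorithmRun N L F r []
  | step (r : E → ℝ) (γ : N.ABPath) (m : ℝ) (l : List (N.ABPath × ℝ))
      (hγ : N.IsTopPath L F {e | r e ≠ 0} γ) (hm : IsLeast (r '' γ.edges) m)
      (hl : AlgorithmRun N L F (fun e => if e ∈ γ.edges then r e - m else r e) l) :
      AlgorithmRun N L F r ((γ, m) :: l)

/-- The algorithm, with the density `ρ` as input, outputs the family `Γ` with the weights `m`. -/
def IsAlgorithmOutput (N : PlaneNetwork V E) (L : ℝ) (F : ℂ → ℂ) (ρ : E → ℝ)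
    (Γ : Finset N.ABPath) (m : N.ABPath → ℝ) : Prop :=
  ∃ l : List (N.ABPath × ℝ), N.AlgorithmRun L F (fun e => N.weight e * ρ e) l ∧
    (∀ γ, γ ∈ Γ ↔ ∃ w, (γ, w) ∈ l) ∧ ∀ γ w, (γ, w) ∈ l → m γ = w

end PlaneNetwork

/-! The current is antisymmetric, runs towards larger values of the voltage `h` and obeys
Kirchhoff's law off `A ∪ B`; `IsIncreasingFlow` records exactly this. If the edge values of the
algorithm are `|θ|` for such a flow `θ`, then one iteration replaces `θ` by `θ - m x_γ`, again such
a flow. This rests on two facts about the support of `θ`. If `θ ≠ 0`, the support has a top path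
(`IsIncreasingFlow.exists_isTopPath`): among the paths along `θ`, take one with the fewest edges of
the support left outside the closed region under it; an edge still outside would lie on a path that
can replace it. Moreover every top path of the support runs along `θ` (`IsTopPath.pos_of_mem`), so
that subtraction lowers `|θ|` by `m` on its edges (`abs_sub_pathFlow`).

Each iteration removes an edge from the support, which gives termination, and the run can stop only
at `θ = 0`, which gives the decomposition. Later paths lie in the support of which an earlier path
is the top path, hence the family is non-crossing. For uniqueness, a non-crossing family that covers
the support has a top member, and this is the top path `γ` of the support (`IsTopPath.unique`). Its
coefficient cannot exceed `m`; if it were smaller, the family without `γ` would still cover the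
support and would again have to contain `γ`. Peeling off `γ` and induction finish the argument
(`AlgorithmRun.unique`).

The run on `|f|` yields a decomposition of `f`. Pairing it with densities shows that the gradient of
`h` is the extremal density, so that `σρ* = |f|` (`IsExtremalDensity.weight_mul`) and this run is
the one in question.

The planar input is that a path across the rectangle splits the strip into exactly two components,
each having the whole path in its closure. An exponential chart turns the strip into the closed
upper half-plane without the origin, and the path with its reflection into a closed curve. The index
of this curve separates the origin from far points. Eilenberg's criterion bounds the number of
components and shows that each point of the curve is on the boundary of both. The index is also a
sum over directed edges, which is what detects the direction of a top path. -/

/-! ### Continuous logarithms along curves -/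

section Logarithms

open Complex Set Topology Filter ComplexConjugate

/-- A nonvanishing continuous function on a simply connected space has a continuous logarithm. -/
theorem exists_continuous_exp_eq {X : Type*} [TopologicalSpace X] [SimplyConnectedSpace X]
    [LocallyPathConnectedSpace X] {f : X → ℂ} (hf : Continuous f) (h0 : ∀ x, f x ≠ 0) :
    ∃ g : X → ℂ, Continuous g ∧ ∀ x, exp (g x) = f x := by
  obtain ⟨x₀⟩ : Nonempty X := inferInstance
  obtain ⟨g, ⟨-, hg⟩, -⟩ := isCoveringMapOn_exp.existsUnique_continuousMap_lifts
    ⟨f, hf⟩ (a₀ := x₀) (exp_log (h0 x₀)) h0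
  exact ⟨g, g.continuous, fun x => congrFun hg x⟩

theorem exists_continuous_exp_eq_unitInterval {f : unitInterval → ℂ} (hf : Continuous f)
    (h0 : ∀ t, f t ≠ 0) : ∃ g : unitInterval → ℂ, Continuous g ∧ ∀ t, exp (g t) = f t := by
  obtain ⟨g, hg, hgf⟩ := exists_continuous_exp_eq (X := ℝ)
    (f := fun x => f (projIcc 0 1 zero_le_one x)) (hf.comp continuous_projIcc) fun x => h0 _
  exact ⟨fun t => g t, hg.comp continuous_subtype_val, fun t => by rw [hgf]; simp⟩

/-- Two continuous logarithms of the same function have a constant difference. -/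
theorem exists_int_sub_eq {X : Type*} [TopologicalSpace X] [PreconnectedSpace X] {f g : X → ℂ}
    (hf : Continuous f) (hg : Continuous g) (h : ∀ x, exp (f x) = exp (g x)) :
    ∃ n : ℤ, ∀ x, f x = g x + n * (2 * Real.pi * I) := by
  choose n hn using fun x => exp_eq_exp_iff_exists_int.1 (h x)
  -- The integer `n x` is the real part of a continuous quotient.
  have hc : IsLocallyConstant n := by
    have he : Topology.IsEmbedding ((↑) : ℤ → ℝ) := Isometry.isEmbedding fun _ _ => rfl
    rw [IsLocallyConstant.iff_continuous, he.isInducing.continuous_iff]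
    have : ((↑) : ℤ → ℝ) ∘ n = fun x => ((f x - g x) / (2 * Real.pi * I)).re := by
      funext x
      have h2 : (2 * Real.pi * I : ℂ) ≠ 0 := two_pi_I_ne_zero
      rw [hn x, add_sub_cancel_left, mul_div_cancel_right₀ _ h2]
      simp
    rw [this]
    exact continuous_re.comp ((hf.sub hg).div_const _)
  by_cases hX : Nonempty X
  · obtain ⟨x₀⟩ := hX
    exact ⟨n x₀, fun x => by rw [hn x, hc.apply_eq_of_preconnectedSpace x x₀]⟩
  · exact ⟨0, fun x => (hX ⟨x⟩).elim⟩

open Classical in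
/-- The increment of a continuous logarithm of `c - q` along the curve `c`. -/
noncomputable def logIncrement (c : unitInterval → ℂ) (q : ℂ) : ℂ :=
  if h : ∃ g : unitInterval → ℂ, Continuous g ∧ ∀ t, exp (g t) = c t - q then
    h.choose 1 - h.choose 0 else 0

theorem logIncrement_eq {c g : unitInterval → ℂ} {q : ℂ} (hg : Continuous g)
    (h : ∀ t, exp (g t) = c t - q) : logIncrement c q = g 1 - g 0 := by
  have hex : ∃ g : unitInterval → ℂ, Continuous g ∧ ∀ t, exp (g t) = c t - q := ⟨g, hg, h⟩
  rw [logIncrement, dif_pos hex]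
  obtain ⟨n, hn⟩ := exists_int_sub_eq hex.choose_spec.1 hg
    fun t => (hex.choose_spec.2 t).trans (h t).symm
  rw [hn, hn]
  ring

/-- A logarithm along the curve, read backwards, is one along the reversed curve. If there is none,
both sides are the default 0, so no condition on `q` is needed. -/
theorem logIncrement_symm (c : unitInterval → ℂ) (q : ℂ) :
    logIncrement (fun t => c (unitInterval.symm t)) q = -logIncrement c q := by
  by_cases hex : ∃ g : unitInterval → ℂ, Continuous g ∧ ∀ t, exp (g t) = c t - q
  · obtain ⟨g, hg, h⟩ := hex
    rw [logIncrement_eq hg h, logIncrement_eq (g := fun t => g (unitInterval.symm t))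
      (hg.comp unitInterval.continuous_symm) fun t => h _]
    simp
  · have hex' : ¬ ∃ g : unitInterval → ℂ, Continuous g ∧
        ∀ t, exp (g t) = c (unitInterval.symm t) - q := by
      rintro ⟨g, hg, h⟩
      exact hex ⟨fun t => g (unitInterval.symm t), hg.comp unitInterval.continuous_symm,
        fun t => by rw [h]; simp⟩
    rw [logIncrement, logIncrement, dif_neg hex, dif_neg hex', neg_zero]

theorem one_add_div_mem_slitPlane {w z : ℂ} (h : ‖w‖ < ‖z‖) : 1 + w / z ∈ slitPlane := by
  apply mem_slitPlane_of_norm_lt_one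
  rwa [norm_div, div_lt_one ((norm_nonneg w).trans_lt h)]

/-- Moving `q` off a curve by a small amount changes the increment of `log (c - q)` only by the
principal logarithms at the ends. -/
theorem logIncrement_of_near {c : unitInterval → ℂ} {q q' : ℂ} (hc : Continuous c)
    (h : ∀ t, ‖q - q'‖ < ‖c t - q‖) :
    logIncrement c q' = logIncrement c q +
      (log (1 + (q - q') / (c 1 - q)) - log (1 + (q - q') / (c 0 - q))) := by
  have hne : ∀ t, c t - q ≠ 0 := fun t => norm_pos_iff.1 ((norm_nonneg _).trans_lt (h t))
  obtain ⟨g, hg, hgc⟩ := exists_continuous_exp_eq_unitInterval (hc.sub continuous_const) hne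
  have hs : ∀ t, 1 + (q - q') / (c t - q) ∈ slitPlane := fun t => one_add_div_mem_slitPlane (h t)
  have hcont : Continuous fun t => log (1 + (q - q') / (c t - q)) :=
    (continuous_const.add (continuous_const.div (hc.sub continuous_const) hne)).clog hs
  have hgc' : ∀ t, exp (g t) = c t - q := hgc
  rw [logIncrement_eq hg hgc', logIncrement_eq
    (g := fun t => g t + log (1 + (q - q') / (c t - q))) (hg.add hcont) (q := q')]
  · ring
  · intro t
    rw [exp_add, hgc', exp_log (slitPlane_ne_zero (hs t))]
    have := hne t
    field_simp
    ring

theorem exists_forall_lt_norm_sub {c : unitInterval → ℂ} {q : ℂ} (hc : Continuous c)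
    (h : ∀ t, c t ≠ q) : ∃ ε > 0, ∀ t, ε ≤ ‖c t - q‖ := by
  obtain ⟨t₀, -, ht₀⟩ := isCompact_univ.exists_isMinOn (univ_nonempty (α := unitInterval))
    (hc.sub continuous_const).norm.continuousOn (f := fun t => ‖c t - q‖)
  exact ⟨_, norm_pos_iff.2 (sub_ne_zero.2 (h t₀)), fun t => ht₀ (mem_univ t)⟩

/-- For a curve that need not be closed, the increment varies with `q`, but off the curve it does so
continuously. This is what is available for single edges. -/
theorem continuousAt_logIncrement {c : unitInterval → ℂ} {q : ℂ} (hc : Continuous c)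
    (h : ∀ t, c t ≠ q) : ContinuousAt (logIncrement c) q := by
  obtain ⟨ε, hε, hεc⟩ := exists_forall_lt_norm_sub hc h
  have hev : ∀ᶠ q' in 𝓝 q, logIncrement c q + (log (1 + (q - q') / (c 1 - q)) -
      log (1 + (q - q') / (c 0 - q))) = logIncrement c q' := by
    filter_upwards [Metric.ball_mem_nhds q hε] with q' hq'
    refine (logIncrement_of_near hc fun t => lt_of_lt_of_le ?_ (hεc t)).symm
    rwa [← dist_eq_norm, dist_comm]
  refine ContinuousAt.congr ?_ hev
  have hlog : ∀ t, ContinuousAt (fun q' => log (1 + (q - q') / (c t - q))) q := fun t => by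
    refine ContinuousAt.clog ?_ (by simp [one_mem_slitPlane])
    have : c t - q ≠ 0 := sub_ne_zero.2 (h t)
    fun_prop
  exact continuousAt_const.add ((hlog 1).sub (hlog 0))

end Logarithms

/-! ### Eilenberg's criterion and plane topology -/

section PlaneSeparation

open Complex Set Topology Filter ComplexConjugate

/-- There is no continuous nonvanishing extension of `z - p` from a circle about `p`. -/
theorem false_of_eq_sub_on_sphere {Ψ : ℂ → ℂ} (hΨ : Continuous Ψ) (h0 : ∀ z, Ψ z ≠ 0) {p : ℂ}
    {R : ℝ} (hR : 0 < R) (h : ∀ z, ‖z - p‖ = R → Ψ z = z - p) : False := by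
  obtain ⟨g, hg, hgΨ⟩ := exists_continuous_exp_eq hΨ h0
  have hcirc : Continuous fun t : ℝ => p + R * exp (t * I) := by fun_prop
  -- Along the circle `g` can differ from `log R + t * I` only by a constant; but the latter gains
  -- `2πi` in one turn, while `g` returns to its value.
  obtain ⟨n, hn⟩ := exists_int_sub_eq (X := ℝ) (hg.comp hcirc)
    (g := fun t : ℝ => Real.log R + t * I) (by fun_prop) fun t => by
      rw [Function.comp_apply, hgΨ, h, exp_add, ← ofReal_exp, Real.exp_log hR]
      · ring
      · simp [norm_exp_ofReal_mul_I, abs_of_pos hR]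
  have h1 := hn 0
  have h2 := hn (2 * Real.pi)
  have h3 : exp (((2 * Real.pi : ℝ) : ℂ) * I) = exp (((0 : ℝ) : ℂ) * I) := by
    push_cast
    rw [exp_two_pi_mul_I, zero_mul, exp_zero]
  simp only [Function.comp_apply, h3] at h1 h2
  rw [h1] at h2
  have h4 : (2 * Real.pi * I : ℂ) = 0 := by
    push_cast at h2
    linear_combination -h2
  exact two_pi_I_ne_zero h4

/-- Components of the open set `Kᶜ` are open, so a frontier point off `K` would have a component
that meets, hence equals, that of `p`. -/
theorem frontier_connectedComponentIn_compl_subset {K : Set ℂ} (hK : IsClosed K) (p : ℂ) :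
    frontier (connectedComponentIn Kᶜ p) ⊆ K := by
  intro z hz
  by_contra hzK
  have hopen : IsOpen (connectedComponentIn Kᶜ p) := hK.isOpen_compl.connectedComponentIn
  rw [hopen.frontier_eq] at hz
  have hz' : IsOpen (connectedComponentIn Kᶜ z) := hK.isOpen_compl.connectedComponentIn
  obtain ⟨w, hw1, hw2⟩ := mem_closure_iff.1 hz.1 _ hz' (mem_connectedComponentIn hzK)
  apply hz.2
  rw [connectedComponentIn_eq hw2, ← connectedComponentIn_eq hw1]
  exact mem_connectedComponentIn hzK

/-- Eilenberg's criterion: if `z - p`, up to a factor that does not vanish on the component of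
`p`, has a continuous logarithm on `K`, then the component of `p` in the complement of `K` is
unbounded. -/
theorem not_isBounded_component_of_log {K : Set ℂ} (hK : IsClosed K) {p : ℂ} (hp : p ∉ K)
    {v g : ℂ → ℂ} (hv : ContinuousOn v (closure (connectedComponentIn Kᶜ p)))
    (hv0 : ∀ z ∈ closure (connectedComponentIn Kᶜ p), v z ≠ 0)
    (hg : ContinuousOn g K) (h : ∀ z ∈ K, exp (g z) * v z = z - p) :
    ¬ Bornology.IsBounded (connectedComponentIn Kᶜ p) := by
  classical
  intro hb
  set P := connectedComponentIn Kᶜ p with hP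
  have hfr : frontier P ⊆ K := frontier_connectedComponentIn_compl_subset hK p
  have hpP : p ∈ P := mem_connectedComponentIn hp
  have hopen : IsOpen P := hK.isOpen_compl.connectedComponentIn
  -- Tietze extends the logarithm to the plane. Were the component `P` bounded, gluing `exp G * v`
  -- on `P` to `z - p` outside would give a nonvanishing continuous function that equals `z - p` on
  -- a large circle.
  obtain ⟨G, hG⟩ := ContinuousMap.exists_restrict_eq hK ⟨K.domRestrict g,
    continuousOn_iff_continuous_domRestrict.1 hg⟩
  have hGg : ∀ z ∈ K, G z = g z := fun z hz => congrArg (fun k => k ⟨z, hz⟩) hG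
  set Ψ : ℂ → ℂ := P.piecewise (fun z => exp (G z) * v z) (fun z => z - p) with hΨ
  have hΨc : Continuous Ψ := by
    refine continuous_piecewise (fun z hz => ?_) ?_ (by fun_prop)
    · rw [hGg z (hfr hz), h z (hfr hz)]
    · exact (continuous_exp.comp G.continuous).continuousOn.mul hv
  have hΨ0 : ∀ z, Ψ z ≠ 0 := by
    intro z
    by_cases hz : z ∈ P
    · rw [hΨ, piecewise_eq_of_mem _ _ _ hz]
      exact mul_ne_zero (exp_ne_zero _) (hv0 z (subset_closure hz))
    · rw [hΨ, piecewise_eq_of_notMem _ _ _ hz, sub_ne_zero]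
      rintro rfl
      exact hz hpP
  obtain ⟨R, hR⟩ := hb.subset_ball p
  have hR0 : 0 < R := by
    have := hR hpP
    simpa using this
  refine false_of_eq_sub_on_sphere (p := p) hΨc hΨ0 hR0 fun z hz => ?_
  rw [hΨ, piecewise_eq_of_notMem]
  intro hzP
  have := hR hzP
  rw [Metric.mem_ball, dist_eq_norm, hz] at this
  exact lt_irrefl _ this

/-- A continuous function on the domain of a map from a compact space that is compatible with the
map descends to the range. -/
theorem exists_continuousOn_range_of_factors {X : Type*} [TopologicalSpace X] [CompactSpace X]
    {f g : X → ℂ} (hf : Continuous f) (hg : Continuous g) (h : ∀ x y, f x = f y → g x = g y) :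
    ∃ G : ℂ → ℂ, ContinuousOn G (range f) ∧ ∀ x, G (f x) = g x := by
  have hq : IsQuotientMap (rangeFactorization f) :=
    (hf.rangeFactorization.isClosedMap).isQuotientMap hf.rangeFactorization
      rangeFactorization_surjective
  choose s hs using fun y : range f => y.2
  classical
  refine ⟨fun z => if hz : z ∈ range f then g (s ⟨z, hz⟩) else 0, ?_, fun x => ?_⟩
  · rw [continuousOn_iff_continuous_domRestrict, hq.continuous_iff]
    convert hg using 1
    funext x
    simp only [Function.comp_apply, domRestrict_apply, rangeFactorization, mem_range_self,
      dite_true]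
    exact h _ _ (hs _)
  · simp only [mem_range_self, dite_true]
    exact h _ _ (hs _)

/-- For `M > 0` this is the image of a half-plane under `exp`. -/
theorem isPreconnected_lt_norm (M : ℝ) : IsPreconnected {z : ℂ | M < ‖z‖} := by
  rcases lt_or_ge M 0 with hM | hM
  · convert (convex_univ (𝕜 := ℝ) (E := ℂ)).isPreconnected using 1
    exact eq_univ_of_forall fun z => hM.trans_le (norm_nonneg z)
  rcases hM.eq_or_lt with rfl | hM
  · convert (isConnected_compl_singleton_of_one_lt_rank (by simp) (0 : ℂ)).isPreconnected using 1
    ext z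
    simp
  convert (convex_halfSpace_re_gt (Real.log M)).isPreconnected.image exp continuous_exp.continuousOn
    using 1
  ext z
  constructor
  · intro hz
    have hz0 : z ≠ 0 := norm_pos_iff.1 (hM.trans hz)
    exact ⟨log z, by rw [mem_ofPred_eq, log_re]; exact Real.log_lt_log hM hz, exp_log hz0⟩
  · rintro ⟨w, hw, rfl⟩
    rw [mem_ofPred_eq, norm_exp, ← Real.exp_log hM]
    exact Real.exp_lt_exp.2 hw

/-- The principal logarithm is continuous up to its cut from above. -/
theorem continuousOn_log_im_nonneg : ContinuousOn log {z : ℂ | 0 ≤ z.im ∧ z ≠ 0} := by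
  rintro z ⟨hz, hz0⟩
  by_cases hs : z ∈ slitPlane
  · exact (continuousAt_clog hs).continuousWithinAt
  · rw [mem_slitPlane_iff, not_or, not_not, not_lt] at hs
    have hre : z.re < 0 := lt_of_le_of_ne hs.1 fun h => hz0 (Complex.ext h hs.2)
    exact (continuousWithinAt_log_of_re_neg_of_im_zero hre hs.2).mono fun w hw => hw.1

end PlaneSeparation

/-! ### Separation of the plane by an arc in the half-plane and its reflection -/

section HalfPlaneArcs

open Complex Set Topology Filter ComplexConjugate

/-- An injective curve in the closed upper half-plane from the positive to the negative real
axis that meets the real axis only at its ends. -/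
structure IsHalfPlaneArc (τ : unitInterval → ℂ) : Prop where
  continuous : Continuous τ
  injective : Function.Injective τ
  im_nonneg : ∀ t, 0 ≤ (τ t).im
  eq_zero_or_one : ∀ t, (τ t).im = 0 → t = 0 ∨ t = 1
  im_zero : (τ 0).im = 0
  im_one : (τ 1).im = 0
  re_zero : 0 < (τ 0).re
  re_one : (τ 1).re < 0

/-- The union of a plane set with its reflection in the real axis. -/
def mirrorDouble (T : Set ℂ) : Set ℂ := T ∪ conj ⁻¹' T

theorem conj_mem_mirrorDouble {T : Set ℂ} {z : ℂ} :
    conj z ∈ mirrorDouble T ↔ z ∈ mirrorDouble T := by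
  simp [mirrorDouble, or_comm]

theorem IsClosed.mirrorDouble {T : Set ℂ} (hT : IsClosed T) : IsClosed (mirrorDouble T) :=
  hT.union (hT.preimage continuous_conj)

/-- The index about `q` of a curve followed by its reversed reflection in the real axis, times
`2 * π * I`. -/
noncomputable def mirrorIndex (τ : unitInterval → ℂ) (q : ℂ) : ℂ :=
  logIncrement τ q - logIncrement (fun t => conj (τ t)) q

namespace IsHalfPlaneArc

variable {τ : unitInterval → ℂ}

theorem isClosed_range (hτ : IsHalfPlaneArc τ) : IsClosed (range τ) :=
  (isCompact_range hτ.continuous).isClosed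

theorem isClosed_double (hτ : IsHalfPlaneArc τ) : IsClosed (mirrorDouble (range τ)) :=
  hτ.isClosed_range.mirrorDouble

theorem conj_zero (hτ : IsHalfPlaneArc τ) : conj (τ 0) = τ 0 := conj_eq_iff_im.2 hτ.im_zero

theorem conj_one (hτ : IsHalfPlaneArc τ) : conj (τ 1) = τ 1 := conj_eq_iff_im.2 hτ.im_one

theorem ne_zero (hτ : IsHalfPlaneArc τ) (t : unitInterval) : τ t ≠ 0 := by
  intro h
  rcases hτ.eq_zero_or_one t (by simp [h]) with rfl | rfl
  · exact hτ.re_zero.ne' (by simp [h])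
  · exact hτ.re_one.ne (by simp [h])

theorem zero_notMem_double (hτ : IsHalfPlaneArc τ) : (0 : ℂ) ∉ mirrorDouble (range τ) := by
  rintro (⟨t, ht⟩ | ⟨t, ht⟩)
  · exact hτ.ne_zero t ht
  · exact hτ.ne_zero t (by rw [ht, map_zero])

theorem continuous_conj_comp (hτ : IsHalfPlaneArc τ) : Continuous fun t => conj (τ t) :=
  continuous_conj.comp hτ.continuous

theorem ne_of_notMem_double {q : ℂ} (hq : q ∉ mirrorDouble (range τ)) :
    (∀ t, τ t ≠ q) ∧ ∀ t, conj (τ t) ≠ q :=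
  ⟨fun t h => hq (Or.inl ⟨t, h⟩), fun t h => hq (Or.inr ⟨t, by rw [← h, conj_conj]⟩)⟩

/-- Imaginary parts of the arc and of its reflection have opposite signs, so common points are real.
Together with injectivity this makes the doubled arc a simple closed curve. -/
theorem eq_of_apply_eq_conj (hτ : IsHalfPlaneArc τ) {s t : unitInterval}
    (h : τ s = conj (τ t)) : s = t := by
  have h3 := hτ.im_nonneg s
  have h4 := hτ.im_nonneg t
  have h5 : (τ s).im = -(τ t).im := by rw [h, conj_im]
  have him : (τ s).im = 0 := by linarith
  apply hτ.injective
  rw [← conj_eq_iff_im.2 him, h, conj_conj]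

theorem continuous_log (hτ : IsHalfPlaneArc τ) : Continuous fun t => log (τ t) :=
  continuousOn_log_im_nonneg.comp_continuous hτ.continuous fun t => ⟨hτ.im_nonneg t, hτ.ne_zero t⟩

theorem conj_log_zero (hτ : IsHalfPlaneArc τ) : conj (log (τ 0)) = log (τ 0) := by
  rw [conj_eq_iff_im, log_im, arg_eq_zero_iff]
  exact ⟨hτ.re_zero.le, hτ.im_zero⟩

theorem log_one_sub_conj (hτ : IsHalfPlaneArc τ) :
    log (τ 1) - conj (log (τ 1)) = 2 * Real.pi * I := by
  rw [sub_conj, log_im, arg_eq_pi_iff.2 ⟨hτ.re_one, hτ.im_one⟩]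
  push_cast
  ring

/-- The argument runs from 0 to `π` along the arc and from 0 to `-π` along its reflection. -/
theorem mirrorIndex_zero (hτ : IsHalfPlaneArc τ) : mirrorIndex τ 0 = 2 * Real.pi * I := by
  rw [mirrorIndex, logIncrement_eq hτ.continuous_log fun t => by
      rw [exp_log (hτ.ne_zero t), sub_zero],
    logIncrement_eq (g := fun t => conj (log (τ t))) (continuous_conj.comp hτ.continuous_log)
      fun t => by rw [exp_conj, exp_log (hτ.ne_zero t), sub_zero],
    hτ.conj_log_zero, ← hτ.log_one_sub_conj]
  ring

/-- The arc and its reflection have the same ends, so the end corrections in `logIncrement_of_near`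
cancel. -/
theorem mirrorIndex_eventually_eq (hτ : IsHalfPlaneArc τ) {q : ℂ}
    (hq : q ∉ mirrorDouble (range τ)) :
    ∀ᶠ q' in 𝓝 q, mirrorIndex τ q' = mirrorIndex τ q := by
  obtain ⟨h1, h2⟩ := ne_of_notMem_double hq
  obtain ⟨ε₁, hε₁, he₁⟩ := exists_forall_lt_norm_sub hτ.continuous h1
  obtain ⟨ε₂, hε₂, he₂⟩ := exists_forall_lt_norm_sub hτ.continuous_conj_comp h2
  filter_upwards [Metric.ball_mem_nhds q hε₁, Metric.ball_mem_nhds q hε₂] with q' hq1 hq2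
  rw [Metric.mem_ball, dist_comm, dist_eq_norm] at hq1 hq2
  rw [mirrorIndex, mirrorIndex,
    logIncrement_of_near hτ.continuous fun t => hq1.trans_le (he₁ t),
    logIncrement_of_near hτ.continuous_conj_comp fun t => hq2.trans_le (he₂ t),
    hτ.conj_zero, hτ.conj_one]
  ring

theorem mirrorIndex_eq_of_isPreconnected (hτ : IsHalfPlaneArc τ) {S : Set ℂ}
    (hS : IsPreconnected S)
    (hd : S ⊆ (mirrorDouble (range τ))ᶜ) {x y : ℂ} (hx : x ∈ S) (hy : y ∈ S) :
    mirrorIndex τ x = mirrorIndex τ y := by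
  have := Subtype.preconnectedSpace hS
  have hc : IsLocallyConstant fun z : S => mirrorIndex τ z := by
    rw [IsLocallyConstant.iff_eventually_eq]
    rintro ⟨z, hz⟩
    rw [nhds_subtype_eq_comap]
    exact (hτ.mirrorIndex_eventually_eq (hd hz)).comap _
  exact hc.apply_eq_of_preconnectedSpace ⟨x, hx⟩ ⟨y, hy⟩

theorem exists_norm_lt (hτ : IsHalfPlaneArc τ) : ∃ M : ℝ, ∀ t, ‖τ t‖ < M := by
  obtain ⟨M, hM⟩ := (isCompact_range hτ.continuous).isBounded.exists_norm_le
  exact ⟨M + 1, fun t => (hM _ ⟨t, rfl⟩).trans_lt (lt_add_one M)⟩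

theorem exists_norm_le_of_forall (hτ : IsHalfPlaneArc τ) {q : ℂ} (hq : ∀ t, ‖τ t‖ < ‖q‖) :
    ∃ M : ℝ, (∀ t, ‖τ t‖ ≤ M) ∧ M < ‖q‖ := by
  obtain ⟨t₀, -, ht₀⟩ := isCompact_univ.exists_isMaxOn (univ_nonempty (α := unitInterval))
    hτ.continuous.norm.continuousOn
  exact ⟨_, fun t => ht₀ (mem_univ t), hq t₀⟩

theorem lt_norm_subset_compl_double {M : ℝ} (hM : ∀ t, ‖τ t‖ ≤ M) :
    {z : ℂ | M < ‖z‖} ⊆ (mirrorDouble (range τ))ᶜ := by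
  rintro z hz (⟨t, rfl⟩ | ⟨t, ht⟩)
  · exact hz.not_ge (hM t)
  · rw [mem_ofPred_eq, ← norm_conj, ← ht] at hz
    exact hz.not_ge (hM t)

/-- Outside a disk around both curves, `q` may be moved to the positive real number `r = ‖q‖`. There
`log (r - z)` serves both curves, and the common ends make the two increments equal. -/
theorem mirrorIndex_of_far (hτ : IsHalfPlaneArc τ) {q : ℂ} (hq : ∀ t, ‖τ t‖ < ‖q‖) :
    mirrorIndex τ q = 0 := by
  obtain ⟨M, hM, hMq⟩ := hτ.exists_norm_le_of_forall hq
  have hq' : M < ‖((‖q‖ : ℝ) : ℂ)‖ := by simpa using hMq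
  rw [hτ.mirrorIndex_eq_of_isPreconnected (isPreconnected_lt_norm M)
    (lt_norm_subset_compl_double hM) hMq hq']
  set r := ‖q‖
  have hs : ∀ z : ℂ, ‖z‖ < r → (r : ℂ) - z ∈ slitPlane := fun z hz => by
    left
    rw [sub_re, ofReal_re, sub_pos]
    exact (re_le_norm z).trans_lt hz
  have hexp : ∀ z : ℂ, ‖z‖ < r → exp (log (r - z) + Real.pi * I) = z - r := fun z hz => by
    rw [exp_add, exp_log (slitPlane_ne_zero (hs z hz)), exp_pi_mul_I]
    ring
  have hc : ∀ t, ‖conj (τ t)‖ < r := fun t => by rw [norm_conj]; exact hq t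
  rw [mirrorIndex, logIncrement_eq (g := fun t => log (r - τ t) + Real.pi * I)
      (((continuous_const.sub hτ.continuous).clog fun t => hs _ (hq t)).add continuous_const)
      fun t => hexp _ (hq t),
    logIncrement_eq (g := fun t => log (r - conj (τ t)) + Real.pi * I)
      (((continuous_const.sub hτ.continuous_conj_comp).clog fun t => hs _ (hc t)).add
        continuous_const) fun t => hexp _ (hc t), hτ.conj_zero, hτ.conj_one]
  ring

/-- A point whose component is unbounded shares it with every point far away. -/
theorem mem_component_of_not_isBounded (hτ : IsHalfPlaneArc τ) {K : Set ℂ}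
    (hK : K ⊆ mirrorDouble (range τ)) {p q : ℂ}
    (hp : ¬ Bornology.IsBounded (connectedComponentIn Kᶜ p)) (hq : ∀ t, ‖τ t‖ < ‖q‖) :
    q ∈ connectedComponentIn Kᶜ p := by
  obtain ⟨M, hM, hMq⟩ := hτ.exists_norm_le_of_forall hq
  obtain ⟨w, hw, hwM⟩ : ∃ w ∈ connectedComponentIn Kᶜ p, M < ‖w‖ := by
    by_contra! hcon
    exact hp (isBounded_iff_forall_norm_le.2 ⟨M, hcon⟩)
  rw [connectedComponentIn_eq hw]
  exact (isPreconnected_lt_norm M).subset_connectedComponentIn hwM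
    ((lt_norm_subset_compl_double hM).trans (compl_subset_compl.2 hK)) hMq

/-- The complement of the doubled arc has at most two components. -/
theorem mem_component_zero_or_far (hτ : IsHalfPlaneArc τ) {p : ℂ}
    (hp : p ∉ mirrorDouble (range τ)) :
    p ∈ connectedComponentIn (mirrorDouble (range τ))ᶜ 0 ∨
      ∀ q : ℂ, (∀ t, ‖τ t‖ < ‖q‖) → p ∈ connectedComponentIn (mirrorDouble (range τ))ᶜ q := by
  rw [or_iff_not_imp_left]
  intro hp0 q hq
  set J := mirrorDouble (range τ) with hJ
  have hpc : p ∈ connectedComponentIn Jᶜ p := mem_connectedComponentIn hp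
  have hP0 : (0 : ℂ) ∉ connectedComponentIn Jᶜ p := fun h => by
    rw [← connectedComponentIn_eq h] at hp0
    exact hp0 hpc
  suffices h : ¬ Bornology.IsBounded (connectedComponentIn Jᶜ p) by
    rw [← connectedComponentIn_eq (hτ.mem_component_of_not_isBounded subset_rfl h hq)]
    exact hpc
  obtain ⟨h1, h2⟩ := ne_of_notMem_double hp
  obtain ⟨g₁, hg₁, he₁⟩ := exists_continuous_exp_eq_unitInterval
    (f := fun t => τ t - p) (by have := hτ.continuous; fun_prop) fun t => sub_ne_zero.2 (h1 t)
  obtain ⟨g₂, hg₂, he₂⟩ := exists_continuous_exp_eq_unitInterval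
    (f := fun t => conj (τ t) - p) (by have := hτ.continuous_conj_comp; fun_prop)
    fun t => sub_ne_zero.2 (h2 t)
  -- The integer `k` makes the two logarithms agree at the start; `n` is their mismatch at the end.
  -- The logarithm of `z` has mismatch one, so dividing by `z ^ n` removes it: on `J`, `z - p` is an
  -- exponential times `z ^ n`. Since the closure of the component of `p` avoids 0, Eilenberg's
  -- criterion applies with the factor `z ^ n`.
  obtain ⟨k, hk⟩ : ∃ k : ℤ, g₁ 0 = g₂ 0 + k * (2 * Real.pi * I) :=
    exp_eq_exp_iff_exists_int.1 (by rw [he₁, he₂, hτ.conj_zero])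
  obtain ⟨n, hn⟩ : ∃ n : ℤ, g₁ 1 = g₂ 1 + k * (2 * Real.pi * I) + n * (2 * Real.pi * I) := by
    apply exp_eq_exp_iff_exists_int.1
    rw [exp_add, exp_int_mul_two_pi_mul_I, mul_one, he₁, he₂, hτ.conj_one]
  obtain ⟨G, hGc, hG⟩ := exists_continuousOn_range_of_factors
    (f := Sum.elim τ fun t => conj (τ t))
    (g := Sum.elim (fun t => g₁ t - n * log (τ t))
      fun t => g₂ t + k * (2 * Real.pi * I) - n * conj (log (τ t)))
    (hτ.continuous.sumElim hτ.continuous_conj_comp)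
    ((hg₁.sub (continuous_const.mul hτ.continuous_log)).sumElim
      ((hg₂.add continuous_const).sub
        (continuous_const.mul (continuous_conj.comp hτ.continuous_log)))) (by
      have key : ∀ s t, τ s = conj (τ t) → g₁ s - n * log (τ s) =
          g₂ t + k * (2 * Real.pi * I) - n * conj (log (τ t)) := by
        intro s t hst
        obtain rfl := hτ.eq_of_apply_eq_conj hst
        rcases hτ.eq_zero_or_one s (conj_eq_iff_im.1 hst.symm) with rfl | rfl
        · rw [hk, hτ.conj_log_zero]
        · linear_combination hn - n * hτ.log_one_sub_conj
      rintro (s | s) (t | t) hst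
      · simp only [Sum.elim_inl] at hst
        rw [hτ.injective hst]
      · exact key s t hst
      · exact (key t s hst.symm).symm
      · simp only [Sum.elim_inr] at hst
        rw [hτ.injective ((starRingEnd ℂ).injective hst)])
  have hrange : range (Sum.elim τ fun t => conj (τ t)) = J := by
    rw [Sum.elim_range, hJ, mirrorDouble]
    congr 1
    ext z
    constructor
    · rintro ⟨t, rfl⟩
      exact ⟨t, (conj_conj _).symm⟩
    · rintro ⟨t, ht⟩
      exact ⟨t, by simp only [ht, conj_conj]⟩
  rw [hrange] at hGc
  have hcl : (0 : ℂ) ∉ closure (connectedComponentIn Jᶜ p) := by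
    intro h
    rw [← (hτ.isClosed_double.isOpen_compl.connectedComponentIn).interior_eq] at hP0
    exact hτ.zero_notMem_double (frontier_connectedComponentIn_compl_subset hτ.isClosed_double p
      ⟨h, hP0⟩)
  refine not_isBounded_component_of_log (v := fun z => z ^ n) hτ.isClosed_double hp ?_ ?_ hGc ?_
  · exact fun z hz => (continuousAt_zpow₀ z n
      (Or.inl fun h => hcl (h ▸ hz))).continuousWithinAt
  · exact fun z hz => zpow_ne_zero n fun h => hcl (h ▸ hz)
  · intro z hz
    obtain ⟨x | x, rfl⟩ : z ∈ range (Sum.elim τ fun t => conj (τ t)) := hrange ▸ hz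
    · have h0 := hτ.ne_zero x
      rw [hG, Sum.elim_inl, Sum.elim_inl, exp_sub, he₁, exp_int_mul, exp_log h0]
      field_simp
    · have h0 : conj (τ x) ≠ 0 := by simpa using hτ.ne_zero x
      rw [hG, Sum.elim_inr, Sum.elim_inr, exp_sub, exp_add, exp_int_mul_two_pi_mul_I, he₂,
        exp_int_mul, exp_conj, exp_log (hτ.ne_zero x)]
      field_simp

theorem mem_slitPlane_of_ne_one (hτ : IsHalfPlaneArc τ) {t : unitInterval} (ht : t ≠ 1) :
    τ t ∈ slitPlane := by
  rw [mem_slitPlane_iff, or_iff_not_imp_right, not_not]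
  intro him
  obtain rfl := (hτ.eq_zero_or_one t him).resolve_right ht
  exact hτ.re_zero

theorem neg_mem_slitPlane_of_ne_zero (hτ : IsHalfPlaneArc τ) {t : unitInterval} (ht : t ≠ 0) :
    -τ t ∈ slitPlane := by
  rw [mem_slitPlane_iff, or_iff_not_imp_right, not_not, neg_im, neg_eq_zero]
  intro him
  obtain rfl := (hτ.eq_zero_or_one t him).resolve_left ht
  simpa using hτ.re_one

/-- Once a neighbourhood of an inner point and its reflection are removed from the doubled arc,
the identity has a continuous logarithm on what remains. -/
theorem exists_log_double_diff (hτ : IsHalfPlaneArc τ) {s : unitInterval} (h0 : s ≠ 0)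
    (h1 : s ≠ 1) {O : Set ℂ} (hO : IsOpen O) (hs : τ s ∈ O) (hs' : conj (τ s) ∈ O) :
    ∃ g : ℂ → ℂ, ContinuousOn g (mirrorDouble (range τ) \ O) ∧
      ∀ z ∈ mirrorDouble (range τ) \ O, exp (g z) = z := by
  classical
  have hcl : ∀ S : Set unitInterval, IsClosed S → IsClosed (mirrorDouble (τ '' S) \ O) :=
    fun S hS => ((hS.isCompact.image hτ.continuous).isClosed.mirrorDouble).sdiff hO
  -- What remains consists of a part that avoids the negative real axis and a part that avoids the
  -- positive one. They could meet only in `τ s` and its reflection, which lie in `O`, so separate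
  -- branches of the logarithm can be used on them.
  set Kl := mirrorDouble (τ '' Iic s) \ O with hKl
  set Kr := mirrorDouble (τ '' Ici s) \ O with hKr
  have hlc : IsClosed Kl := hcl _ isClosed_Iic
  have hrc : IsClosed Kr := hcl _ isClosed_Ici
  have hl : ∀ z ∈ Kl, z ∈ slitPlane := by
    rintro z ⟨⟨t, ht, rfl⟩ | ⟨t, ht, htz⟩, -⟩
    · exact hτ.mem_slitPlane_of_ne_one fun h => h1 (le_antisymm unitInterval.le_one' (h ▸ ht))
    · have := hτ.mem_slitPlane_of_ne_one fun h => h1 (le_antisymm unitInterval.le_one' (h ▸ ht))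
      rw [htz, mem_slitPlane_iff] at this
      simpa [mem_slitPlane_iff] using this
  have hr : ∀ z ∈ Kr, -z ∈ slitPlane := by
    rintro z ⟨⟨t, ht, rfl⟩ | ⟨t, ht, htz⟩, -⟩
    · exact hτ.neg_mem_slitPlane_of_ne_zero fun h =>
        h0 (le_antisymm (h ▸ ht) unitInterval.nonneg')
    · have := hτ.neg_mem_slitPlane_of_ne_zero fun h =>
        h0 (le_antisymm (h ▸ ht) unitInterval.nonneg')
      rw [htz, mem_slitPlane_iff] at this
      simpa [mem_slitPlane_iff] using this
  have hd : ∀ z ∈ Kl, z ∉ Kr := by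
    rintro z ⟨hzl, hzO⟩ ⟨hzr, -⟩
    apply hzO
    have key : ∀ t ≤ s, ∀ t' ≥ s, t = t' → t = s := by
      rintro t ht t' ht' rfl
      exact le_antisymm ht ht'
    rcases hzl with ⟨t, ht, rfl⟩ | ⟨t, ht, htz⟩ <;>
      rcases hzr with ⟨t', ht', htz'⟩ | ⟨t', ht', htz'⟩
    · rwa [key t ht t' ht' (hτ.injective htz'.symm)]
    · rwa [key t ht t' ht' (hτ.eq_of_apply_eq_conj (by rw [htz', conj_conj]))]
    · rw [← htz'] at htz
      have he := hτ.eq_of_apply_eq_conj htz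
      rwa [← htz', ← he, key t ht t' ht' he]
    · rw [← htz'] at htz
      rwa [← conj_conj z, ← htz', ← hτ.injective htz, key t ht t' ht' (hτ.injective htz)]
  have hK : mirrorDouble (range τ) \ O = Kl ∪ Kr := by
    have hu : (Iic s ∪ Ici s : Set unitInterval) = univ := Iic_union_Ici
    rw [hKl, hKr, ← union_sdiff_distrib, ← image_univ, ← hu, image_union]
    congr 1
    simp only [mirrorDouble, preimage_union]
    ac_rfl
  rw [hK]
  refine ⟨fun z => if z ∈ Kr then log (-z) + Real.pi * I else log z, ?_, ?_⟩
  · refine ContinuousOn.union_of_isClosed ?_ ?_ hlc hrc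
    · exact (continuousOn_id.clog hl).congr fun z hz => if_neg (hd z hz)
    · exact ((continuousOn_neg.clog hr).add continuousOn_const).congr fun z hz => if_pos hz
  · rintro z (hz | hz)
    · simp only [if_neg (hd z hz)]
      rw [exp_log (slitPlane_ne_zero (hl z hz))]
    · simp only [if_pos hz]
      rw [exp_add, exp_log (slitPlane_ne_zero (hr z hz)), exp_pi_mul_I]
      ring

theorem conj_mem_component {x z : ℂ} (hx : conj x = x)
    (hz : z ∈ connectedComponentIn (mirrorDouble (range τ))ᶜ x) :
    conj z ∈ connectedComponentIn (mirrorDouble (range τ))ᶜ x := by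
  have hxm : x ∈ (mirrorDouble (range τ))ᶜ := by
    by_contra h
    rw [connectedComponentIn_eq_empty h] at hz
    exact hz
  refine (isPreconnected_connectedComponentIn.image conj
    continuous_conj.continuousOn).subset_connectedComponentIn
    ⟨x, mem_connectedComponentIn hxm, hx⟩ ?_ ⟨z, hz, rfl⟩
  rintro _ ⟨w, hw, rfl⟩
  rw [mem_compl_iff, conj_mem_mirrorDouble]
  exact connectedComponentIn_subset _ _ hw

theorem far_notMem_double (hτ : IsHalfPlaneArc τ) {q : ℂ} (hq : ∀ t, ‖τ t‖ < ‖q‖) :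
    q ∉ mirrorDouble (range τ) := by
  obtain ⟨M, hM, hMq⟩ := hτ.exists_norm_le_of_forall hq
  exact lt_norm_subset_compl_double hM hMq

/-- Every point of the arc is in the closure of the inner component and of the outer one. -/
theorem mem_closure_component (hτ : IsHalfPlaneArc τ) {x : ℂ} (hx : conj x = x)
    (hx' : x = 0 ∨ ∀ t, ‖τ t‖ < ‖x‖) (s : unitInterval) :
    τ s ∈ closure (connectedComponentIn (mirrorDouble (range τ))ᶜ x) := by
  set J := mirrorDouble (range τ) with hJ
  set C := connectedComponentIn Jᶜ x with hC
  -- The ends of the arc follow by taking the closure of the open parameter interval.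
  suffices h : Ioo (0 : unitInterval) 1 ⊆ τ ⁻¹' closure C by
    have h2 := closure_minimal h (isClosed_closure.preimage hτ.continuous)
    rw [closure_Ioo zero_ne_one] at h2
    exact h2 ⟨unitInterval.nonneg', unitInterval.le_one'⟩
  rintro s ⟨hs0, hs1⟩
  by_contra hcon
  -- Otherwise a symmetric neighbourhood `O` misses `C`, and erasing `O` from the curve does not
  -- enlarge the component of `x` beyond `C`. But `J \ O` carries a logarithm of `z`, so its
  -- complement joins 0 to far points. Both would lie in `C`, where the index is constant.
  obtain ⟨ε, hε, hball⟩ : ∃ ε > 0, Metric.ball (τ s) ε ⊆ Cᶜ := by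
    rw [mem_preimage, ← mem_compl_iff, ← interior_compl, mem_interior_iff_mem_nhds,
      Metric.mem_nhds_iff] at hcon
    exact hcon
  set O := Metric.ball (τ s) ε ∪ conj ⁻¹' Metric.ball (τ s) ε with hO
  have hOo : IsOpen O := Metric.isOpen_ball.union (Metric.isOpen_ball.preimage continuous_conj)
  have hOC : O ⊆ Cᶜ := by
    rintro z (hz | hz) hzC
    · exact hball hz hzC
    · exact hball hz (conj_mem_component hx hzC)
  have hsO : τ s ∈ O := Or.inl (Metric.mem_ball_self hε)
  have hsO' : conj (τ s) ∈ O := Or.inr (by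
    rw [mem_preimage, conj_conj]
    exact Metric.mem_ball_self hε)
  have hxJ : x ∉ J := by
    rcases hx' with rfl | hx'
    · exact hτ.zero_notMem_double
    · exact hτ.far_notMem_double hx'
  obtain ⟨g, hg, hge⟩ := hτ.exists_log_double_diff hs0.ne' hs1.ne hOo hsO hsO'
  have hKJ : J \ O ⊆ J := sdiff_subset
  -- Leaving `C` means passing a frontier point of `C`. It lies on `J`, hence in the erased set `O`;
  -- but `O` is open and misses `C`, so it contains no limit of `C`.
  have hsub : connectedComponentIn (J \ O)ᶜ x ⊆ C := by
    refine isPreconnected_connectedComponentIn.subset_of_closure_inter_subset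
      hτ.isClosed_double.isOpen_compl.connectedComponentIn
      ⟨x, mem_connectedComponentIn fun h => hxJ (hKJ h), mem_connectedComponentIn hxJ⟩ ?_
    rintro z ⟨hz, hzK⟩
    by_contra hzC
    have hzJ : z ∈ J := by
      apply frontier_connectedComponentIn_compl_subset hτ.isClosed_double x
      rw [(hτ.isClosed_double.isOpen_compl.connectedComponentIn).frontier_eq]
      exact ⟨hz, hzC⟩
    have hzO : z ∈ O := by
      by_contra hzO
      exact connectedComponentIn_subset _ _ hzK ⟨hzJ, hzO⟩
    exact closure_minimal (subset_compl_comm.1 hOC) hOo.isClosed_compl hz hzO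
  have hunb : ¬ Bornology.IsBounded (connectedComponentIn (J \ O)ᶜ 0) :=
    not_isBounded_component_of_log (v := 1) (hτ.isClosed_double.sdiff hOo)
      (fun h => hτ.zero_notMem_double (hKJ h)) continuousOn_const (fun _ _ => one_ne_zero) hg
      fun z hz => by simp [hge z hz]
  have h0 : (0 : ℂ) ∈ connectedComponentIn (J \ O)ᶜ 0 :=
    mem_connectedComponentIn fun h => hτ.zero_notMem_double (hKJ h)
  obtain ⟨q, hq, h0C, hqC⟩ : ∃ q : ℂ, (∀ t, ‖τ t‖ < ‖q‖) ∧ 0 ∈ C ∧ q ∈ C := by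
    rcases hx' with rfl | hx'
    · obtain ⟨M, hM⟩ := hτ.exists_norm_lt
      have hM' : ∀ t, ‖τ t‖ < ‖(M : ℂ)‖ := fun t => by
        rw [norm_real]
        exact (hM t).trans_le (le_abs_self M)
      exact ⟨M, hM', hsub h0, hsub (hτ.mem_component_of_not_isBounded hKJ hunb hM')⟩
    · have hxm := hτ.mem_component_of_not_isBounded hKJ hunb hx'
      rw [connectedComponentIn_eq hxm] at h0
      exact ⟨x, hx', hsub h0, mem_connectedComponentIn hxJ⟩
  have := hτ.mirrorIndex_eq_of_isPreconnected isPreconnected_connectedComponentIn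
    (connectedComponentIn_subset _ _) h0C hqC
  rw [hτ.mirrorIndex_zero, hτ.mirrorIndex_of_far hq] at this
  exact two_pi_I_ne_zero this

end IsHalfPlaneArc

end HalfPlaneArcs

/-! ### Separation of the vertical strip by an arc across the rectangle -/

section StripArcs

open Complex Set Topology Filter ComplexConjugate

/-- The closed vertical strip of width `L`. -/
def verticalStrip (L : ℝ) : Set ℂ := {z | z.re ∈ Icc 0 L}

/-- The homeomorphism of a vertical strip onto the closed upper half-plane without the origin. -/
noncomputable def stripChart (L : ℝ) (z : ℂ) : ℂ :=
  exp (((Real.pi / L * z.im : ℝ) : ℂ) + ((Real.pi / L * z.re : ℝ) : ℂ) * I)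

/-- The reflection of the lower half-plane to the upper one. -/
def foldUp (w : ℂ) : ℂ := ⟨w.re, |w.im|⟩

/-- The inverse of `stripChart`, extended to the lower half-plane by reflection. -/
noncomputable def stripChartInv (L : ℝ) (w : ℂ) : ℂ :=
  ⟨L / Real.pi * (log (foldUp w)).im, L / Real.pi * (log (foldUp w)).re⟩

theorem foldUp_eq (w : ℂ) : foldUp w = w ∨ foldUp w = conj w := by
  rcases abs_choice w.im with h | h
  · left
    apply Complex.ext <;> simp [foldUp, h]
  · right
    apply Complex.ext <;> simp [foldUp, h]

theorem norm_foldUp (w : ℂ) : ‖foldUp w‖ = ‖w‖ := by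
  rcases foldUp_eq w with h | h <;> simp [h]

theorem foldUp_ne_zero {w : ℂ} (hw : w ≠ 0) : foldUp w ≠ 0 := by
  rwa [← norm_ne_zero_iff, norm_foldUp, norm_ne_zero_iff]

theorem foldUp_of_im_nonneg {w : ℂ} (hw : 0 ≤ w.im) : foldUp w = w := by
  apply Complex.ext <;> simp [foldUp, abs_of_nonneg hw]

theorem continuous_foldUp : Continuous foldUp := by
  have : foldUp = fun w => ((w.re : ℝ) : ℂ) + ((|w.im| : ℝ) : ℂ) * I := by
    funext w
    apply Complex.ext <;> simp [foldUp]
  rw [this]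
  fun_prop

variable {L : ℝ}

theorem continuous_stripChart : Continuous (stripChart L) := by
  unfold stripChart
  fun_prop

theorem stripChart_ne_zero (z : ℂ) : stripChart L z ≠ 0 := exp_ne_zero _

theorem norm_stripChart (z : ℂ) : ‖stripChart L z‖ = Real.exp (Real.pi / L * z.im) := by
  rw [stripChart, norm_exp]
  simp

theorem stripChart_re (z : ℂ) : (stripChart L z).re =
    Real.exp (Real.pi / L * z.im) * Real.cos (Real.pi / L * z.re) := by
  rw [stripChart, exp_re]
  simp

theorem stripChart_im (z : ℂ) : (stripChart L z).im =
    Real.exp (Real.pi / L * z.im) * Real.sin (Real.pi / L * z.re) := by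
  rw [stripChart, exp_im]
  simp

theorem angle_mem_Icc (hL : 0 < L) {z : ℂ} (hz : z ∈ verticalStrip L) :
    Real.pi / L * z.re ∈ Icc 0 Real.pi := by
  have hπ := Real.pi_pos
  refine ⟨mul_nonneg (by positivity) hz.1, ?_⟩
  rw [div_mul_eq_mul_div, div_le_iff₀ hL]
  exact mul_le_mul_of_nonneg_left hz.2 hπ.le

theorem stripChart_im_nonneg (hL : 0 < L) {z : ℂ} (hz : z ∈ verticalStrip L) :
    0 ≤ (stripChart L z).im := by
  rw [stripChart_im]
  exact mul_nonneg (Real.exp_pos _).le (Real.sin_nonneg_of_mem_Icc (angle_mem_Icc hL hz))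

theorem stripChart_im_eq_zero (hL : 0 < L) {z : ℂ} (hz : z ∈ verticalStrip L)
    (h : (stripChart L z).im = 0) : z.re = 0 ∨ z.re = L := by
  have hπ := Real.pi_pos
  by_contra! hcon
  have h0 : 0 < z.re := lt_of_le_of_ne hz.1 hcon.1.symm
  have h1 : z.re < L := lt_of_le_of_ne hz.2 hcon.2
  rw [stripChart_im] at h
  refine (mul_pos (Real.exp_pos _) (Real.sin_pos_of_pos_of_lt_pi (by positivity) ?_)).ne' h
  rw [div_mul_eq_mul_div, div_lt_iff₀ hL]
  exact mul_lt_mul_of_pos_left h1 hπ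

theorem stripChartInv_stripChart (hL : 0 < L) {z : ℂ} (hz : z ∈ verticalStrip L) :
    stripChartInv L (stripChart L z) = z := by
  have hπ := Real.pi_pos
  have h := angle_mem_Icc hL hz
  rw [stripChartInv, foldUp_of_im_nonneg (stripChart_im_nonneg hL hz), stripChart, log_exp]
  · apply Complex.ext <;> simp <;> field_simp
  · simpa using (neg_lt_zero.2 hπ).trans_le h.1
  · simpa using h.2

theorem stripChartInv_mem (hL : 0 < L) (w : ℂ) : stripChartInv L w ∈ verticalStrip L := by
  have hπ := Real.pi_pos
  have h1 : 0 ≤ (log (foldUp w)).im := by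
    rw [log_im, arg_nonneg_iff]
    exact abs_nonneg w.im
  have h2 : (log (foldUp w)).im ≤ Real.pi := log_im_le_pi _
  refine ⟨mul_nonneg (by positivity) h1, ?_⟩
  change L / Real.pi * (log (foldUp w)).im ≤ L
  rw [div_mul_eq_mul_div, div_le_iff₀ hπ]
  exact mul_le_mul_of_nonneg_left h2 hL.le

theorem stripChart_stripChartInv (hL : 0 < L) {w : ℂ} (hw : w ≠ 0) :
    stripChart L (stripChartInv L w) = foldUp w := by
  have hπ := Real.pi_pos
  have h : ∀ a : ℝ, Real.pi / L * (L / Real.pi * a) = a := fun a => by field_simp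
  rw [stripChart, stripChartInv, h, h, re_add_im, exp_log (foldUp_ne_zero hw)]

/-- Folding keeps the argument of `log` in the closed upper half-plane, so the cut does no harm. -/
theorem continuousOn_stripChartInv : ContinuousOn (stripChartInv L) {0}ᶜ := by
  have hlog : ContinuousOn (fun w => log (foldUp w)) {0}ᶜ :=
    continuousOn_log_im_nonneg.comp continuous_foldUp.continuousOn
      fun w hw => ⟨abs_nonneg w.im, foldUp_ne_zero hw⟩
  have : stripChartInv L = fun w => ((L / Real.pi * (log (foldUp w)).im : ℝ) : ℂ) +
      ((L / Real.pi * (log (foldUp w)).re : ℝ) : ℂ) * I := by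
    funext w
    apply Complex.ext <;> simp [stripChartInv]
  rw [this]
  have h1 := continuous_re.comp_continuousOn hlog
  have h2 := continuous_im.comp_continuousOn hlog
  exact (continuous_ofReal.comp_continuousOn (continuousOn_const.mul h2)).add
    ((continuous_ofReal.comp_continuousOn (continuousOn_const.mul h1)).mul continuousOn_const)

theorem stripChartInv_im (w : ℂ) : (stripChartInv L w).im = L / Real.pi * Real.log ‖w‖ := by
  rw [stripChartInv, log_re, norm_foldUp]

/-- Near a point of the strip off a closed set, membership in a given component of the complement
of that set in the strip does not change. -/
theorem eventually_mem_component_iff {T : Set ℂ} (hT : IsClosed T) {x z : ℂ}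
    (hz : z ∈ verticalStrip L) (hzT : z ∉ T) :
    ∀ᶠ z' in 𝓝[verticalStrip L] z, z' ∈ connectedComponentIn (verticalStrip L \ T) x ↔
      z ∈ connectedComponentIn (verticalStrip L \ T) x := by
  obtain ⟨ε, hε, hball⟩ := Metric.isOpen_iff.1 hT.isOpen_compl z hzT
  rw [eventually_nhdsWithin_iff]
  filter_upwards [Metric.ball_mem_nhds z hε] with z' hz' hzs'
  have hconv : Convex ℝ (verticalStrip L) := by
    have : verticalStrip L = {z : ℂ | 0 ≤ z.re} ∩ {z : ℂ | z.re ≤ L} := rfl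
    rw [this]
    exact (convex_halfSpace_re_ge 0).inter (convex_halfSpace_re_le L)
  have hpre : IsPreconnected (verticalStrip L ∩ Metric.ball z ε) :=
    (hconv.inter (convex_ball z ε)).isPreconnected
  have hsub : verticalStrip L ∩ Metric.ball z ε ⊆ verticalStrip L \ T :=
    fun w hw => ⟨hw.1, hball hw.2⟩
  have hm := hpre.subset_connectedComponentIn ⟨hz, Metric.mem_ball_self hε⟩ hsub ⟨hzs', hz'⟩
  constructor
  · intro h
    rw [connectedComponentIn_eq h, ← connectedComponentIn_eq hm]
    exact mem_connectedComponentIn ⟨hz, hzT⟩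
  · intro h
    rwa [connectedComponentIn_eq h]

/-- An injective curve in the rectangle of width `L` and height `1` from its left to its right
side that meets these two sides only at its ends. -/
structure IsStripArc (L : ℝ) (σ : unitInterval → ℂ) : Prop where
  pos : 0 < L
  continuous : Continuous σ
  injective : Function.Injective σ
  mem : ∀ t, σ t ∈ verticalStrip L
  im_mem : ∀ t, (σ t).im ∈ Icc (0 : ℝ) 1
  re_eq_zero : ∀ t, (σ t).re = 0 ↔ t = 0
  re_eq_width : ∀ t, (σ t).re = L ↔ t = 1

namespace IsStripArc

variable {σ : unitInterval → ℂ}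

/-- The chart takes the left side of the strip to the positive real axis and the right side to the
negative one. -/
theorem isHalfPlaneArc (hσ : IsStripArc L σ) :
    IsHalfPlaneArc fun t => stripChart L (σ t) where
  continuous := continuous_stripChart.comp hσ.continuous
  injective s t h := hσ.injective (by
    have h' : stripChart L (σ s) = stripChart L (σ t) := h
    rw [← stripChartInv_stripChart hσ.pos (hσ.mem s), h',
      stripChartInv_stripChart hσ.pos (hσ.mem t)])
  im_nonneg t := stripChart_im_nonneg hσ.pos (hσ.mem t)
  eq_zero_or_one t h := (stripChart_im_eq_zero hσ.pos (hσ.mem t) h).imp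
    (hσ.re_eq_zero t).1 (hσ.re_eq_width t).1
  im_zero := by rw [stripChart_im, (hσ.re_eq_zero 0).2 rfl]; simp
  im_one := by
    rw [stripChart_im, (hσ.re_eq_width 1).2 rfl, div_mul_cancel₀ _ hσ.pos.ne']
    simp
  re_zero := by
    rw [stripChart_re, (hσ.re_eq_zero 0).2 rfl]
    simp [Real.exp_pos]
  re_one := by
    rw [stripChart_re, (hσ.re_eq_width 1).2 rfl, div_mul_cancel₀ _ hσ.pos.ne']
    simp [Real.exp_pos]

/-- The component of the slit strip below the arc. -/
def lower (L : ℝ) (σ : unitInterval → ℂ) : Set ℂ :=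
  connectedComponentIn (verticalStrip L \ range σ) (-I)

/-- The component of the slit strip above the arc. -/
def upper (L : ℝ) (σ : unitInterval → ℂ) : Set ℂ :=
  connectedComponentIn (verticalStrip L \ range σ) (2 * I)

theorem isClosed_range (hσ : IsStripArc L σ) : IsClosed (range σ) :=
  (isCompact_range hσ.continuous).isClosed

theorem convex_low (L : ℝ) : Convex ℝ {z : ℂ | z ∈ verticalStrip L ∧ z.im < 0} := by
  have : {z : ℂ | z ∈ verticalStrip L ∧ z.im < 0} =
    ({z : ℂ | 0 ≤ z.re} ∩ {z : ℂ | z.re ≤ L}) ∩ {z : ℂ | z.im < 0} := rfl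
  rw [this]
  exact ((convex_halfSpace_re_ge 0).inter (convex_halfSpace_re_le L)).inter
    (convex_halfSpace_im_lt 0)

theorem mem_lower_of_im_neg (hσ : IsStripArc L σ) {z : ℂ} (hz : z ∈ verticalStrip L)
    (h : z.im < 0) : z ∈ lower L σ := by
  refine (convex_low L).isPreconnected.subset_connectedComponentIn
    ⟨⟨by simp, by simpa using hσ.pos.le⟩, by simp⟩ ?_ ⟨hz, h⟩
  rintro w ⟨hw, hwim⟩
  refine ⟨hw, ?_⟩
  rintro ⟨t, rfl⟩
  exact hwim.not_ge (hσ.im_mem t).1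

theorem stripChart_notMem_double (hσ : IsStripArc L σ) {z : ℂ}
    (hz : z ∈ verticalStrip L \ range σ) :
    stripChart L z ∉ mirrorDouble (range fun t => stripChart L (σ t)) := by
  rintro (⟨t, ht⟩ | ⟨t, ht⟩)
  · apply hz.2
    refine ⟨t, ?_⟩
    rw [← stripChartInv_stripChart hσ.pos (hσ.mem t), ← stripChartInv_stripChart hσ.pos hz.1]
    exact congrArg _ ht
  · apply hz.2
    refine ⟨t, ?_⟩
    have him : (stripChart L z).im = 0 := by
      have h1 := stripChart_im_nonneg hσ.pos hz.1
      have h2 : 0 ≤ ((fun t => stripChart L (σ t)) t).im := stripChart_im_nonneg hσ.pos (hσ.mem t)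
      rw [ht, conj_im] at h2
      linarith
    rw [conj_eq_iff_im.2 him] at ht
    rw [← stripChartInv_stripChart hσ.pos (hσ.mem t), ← stripChartInv_stripChart hσ.pos hz.1]
    exact congrArg _ ht

theorem stripChartInv_notMem (hσ : IsStripArc L σ) {w : ℂ} (hw0 : w ≠ 0)
    (hw : w ∉ mirrorDouble (range fun t => stripChart L (σ t))) :
    stripChartInv L w ∈ verticalStrip L \ range σ := by
  refine ⟨stripChartInv_mem hσ.pos w, ?_⟩
  rintro ⟨t, ht⟩
  have h := stripChart_stripChartInv hσ.pos hw0
  rw [← ht] at h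
  apply hw
  rcases foldUp_eq w with hf | hf
  · exact Or.inl ⟨t, h.trans hf⟩
  · exact Or.inr ⟨t, h.trans hf⟩

theorem stripChart_mem_component (hσ : IsStripArc L σ) {x z : ℂ}
    (hz : z ∈ connectedComponentIn (verticalStrip L \ range σ) x) :
    stripChart L z ∈ connectedComponentIn
      (mirrorDouble (range fun t => stripChart L (σ t)))ᶜ (stripChart L x) := by
  have hx : x ∈ verticalStrip L \ range σ := by
    by_contra h
    rw [connectedComponentIn_eq_empty h] at hz
    exact hz
  refine (isPreconnected_connectedComponentIn.image _
    continuous_stripChart.continuousOn).subset_connectedComponentIn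
    ⟨x, mem_connectedComponentIn hx, rfl⟩ ?_ ⟨z, hz, rfl⟩
  rintro _ ⟨w, hw, rfl⟩
  exact hσ.stripChart_notMem_double (connectedComponentIn_subset _ _ hw)

theorem norm_lt_one_subset (hσ : IsStripArc L σ) : Metric.ball (0 : ℂ) 1 ⊆
    (mirrorDouble (range fun t => stripChart L (σ t)))ᶜ := by
  have hπ := Real.pi_pos
  have hL := hσ.pos
  have key : ∀ t, 1 ≤ ‖stripChart L (σ t)‖ := fun t => by
    rw [norm_stripChart, Real.one_le_exp_iff]
    exact mul_nonneg (by positivity) (hσ.im_mem t).1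
  intro w hw hwJ
  rw [mem_ball_zero_iff] at hw
  rcases hwJ with ⟨t, ht⟩ | ⟨t, ht⟩
  · exact (key t).not_gt (by rwa [← ht] at hw)
  · rw [← norm_conj, ← ht] at hw
    exact (key t).not_gt hw

/-- The origin is the lower end of the strip: `-I` goes into the open unit disk, which the doubled
arc avoids, and this disk connects its image with 0. -/
theorem stripChart_mem_component_zero (hσ : IsStripArc L σ) {z : ℂ} (hz : z ∈ lower L σ) :
    stripChart L z ∈ connectedComponentIn
      (mirrorDouble (range fun t => stripChart L (σ t)))ᶜ 0 := by
  have hπ := Real.pi_pos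
  have hL := hσ.pos
  have h1 : stripChart L (-I) ∈ Metric.ball (0 : ℂ) 1 := by
    rw [mem_ball_zero_iff, norm_stripChart, Real.exp_lt_one_iff]
    simp only [neg_im, I_im]
    have : 0 < Real.pi / L := by positivity
    linarith
  rw [connectedComponentIn_eq ((convex_ball (0 : ℂ) 1).isPreconnected.subset_connectedComponentIn
    (Metric.mem_ball_self one_pos) hσ.norm_lt_one_subset h1)]
  exact hσ.stripChart_mem_component hz

/-- The component contains 0, where the inverse chart cannot be used, so it is not simply mapped
back. Instead the property of being 0 or landing in `lower` is locally constant on it: near 0,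
points of the punctured unit disk land below the real axis. -/
theorem stripChartInv_mem_lower (hσ : IsStripArc L σ) {w : ℂ} (hw0 : w ≠ 0)
    (hw : w ∈ connectedComponentIn (mirrorDouble (range fun t => stripChart L (σ t)))ᶜ 0) :
    stripChartInv L w ∈ lower L σ := by
  have hπ := Real.pi_pos
  have hL := hσ.pos
  set J := mirrorDouble (range fun t => stripChart L (σ t)) with hJ
  have hlow : ∀ w : ℂ, w ≠ 0 → ‖w‖ < 1 → stripChartInv L w ∈ lower L σ := fun w hw hw1 => by
    refine hσ.mem_lower_of_im_neg (stripChartInv_mem hL w) ?_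
    rw [stripChartInv_im]
    exact mul_neg_of_pos_of_neg (by positivity) (Real.log_neg (norm_pos_iff.2 hw) hw1)
  have hzero : (0 : ℂ) ∈ connectedComponentIn Jᶜ 0 :=
    mem_connectedComponentIn hσ.isHalfPlaneArc.zero_notMem_double
  have hconn : PreconnectedSpace (connectedComponentIn Jᶜ 0) :=
    Subtype.preconnectedSpace isPreconnected_connectedComponentIn
  have hc : IsLocallyConstant fun w : connectedComponentIn Jᶜ 0 =>
      (w : ℂ) = 0 ∨ stripChartInv L w ∈ lower L σ := by
    rw [IsLocallyConstant.iff_eventually_eq]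
    rintro ⟨w, hwC⟩
    rw [nhds_subtype_eq_comap]
    refine Eventually.comap (p := fun v => (v = 0 ∨ stripChartInv L v ∈ lower L σ) =
      (w = 0 ∨ stripChartInv L w ∈ lower L σ)) ?_ _
    by_cases h0 : w = 0
    · subst h0
      filter_upwards [Metric.ball_mem_nhds (0 : ℂ) one_pos] with w hw
      rw [mem_ball_zero_iff] at hw
      simp only [true_or, eq_iff_iff, iff_true]
      by_cases hw0 : w = 0
      · exact Or.inl hw0
      · exact Or.inr (hlow w hw0 hw)
    · have hnot := hσ.stripChartInv_notMem h0 (connectedComponentIn_subset _ _ hwC)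
      have hcont : ContinuousAt (stripChartInv L) w :=
        continuousOn_stripChartInv.continuousAt (isOpen_compl_singleton.mem_nhds h0)
      have htend : Tendsto (stripChartInv L) (𝓝 w) (𝓝[verticalStrip L] (stripChartInv L w)) :=
        tendsto_nhdsWithin_iff.2 ⟨hcont, Eventually.of_forall fun v => stripChartInv_mem hL v⟩
      filter_upwards [htend.eventually
        (eventually_mem_component_iff (x := -I) hσ.isClosed_range hnot.1 hnot.2),
        isOpen_compl_singleton.mem_nhds h0] with v hv hv0
      rw [mem_compl_iff, mem_singleton_iff] at hv0
      simp only [h0, hv0, false_or, eq_iff_iff]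
      exact hv
  have := hc.apply_eq_of_preconnectedSpace ⟨w, hw⟩ ⟨0, hzero⟩
  simpa [hw0] using this

theorem two_I_mem (hσ : IsStripArc L σ) : 2 * I ∈ verticalStrip L \ range σ := by
  refine ⟨⟨by simp, by simpa using hσ.pos.le⟩, ?_⟩
  rintro ⟨t, ht⟩
  have := (hσ.im_mem t).2
  rw [ht] at this
  norm_num at this

theorem neg_I_mem (hσ : IsStripArc L σ) : -I ∈ verticalStrip L \ range σ := by
  refine ⟨⟨by simp, by simpa using hσ.pos.le⟩, ?_⟩
  rintro ⟨t, ht⟩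
  have := (hσ.im_mem t).1
  rw [ht] at this
  norm_num at this

theorem two_I_far (hσ : IsStripArc L σ) (t : unitInterval) :
    ‖stripChart L (σ t)‖ < ‖stripChart L (2 * I)‖ := by
  have hπ := Real.pi_pos
  have hL := hσ.pos
  rw [norm_stripChart, norm_stripChart, Real.exp_lt_exp]
  refine mul_lt_mul_of_pos_left ((hσ.im_mem t).2.trans_lt ?_) (by positivity)
  norm_num

theorem conj_stripChart_two_I : conj (stripChart L (2 * I)) = stripChart L (2 * I) := by
  rw [conj_eq_iff_im, stripChart_im]
  simp

theorem mirrorIndex_of_mem_lower (hσ : IsStripArc L σ) {z : ℂ} (hz : z ∈ lower L σ) :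
    mirrorIndex (fun t => stripChart L (σ t)) (stripChart L z) = 2 * Real.pi * I := by
  rw [← hσ.isHalfPlaneArc.mirrorIndex_zero]
  exact hσ.isHalfPlaneArc.mirrorIndex_eq_of_isPreconnected isPreconnected_connectedComponentIn
    (connectedComponentIn_subset _ _) (hσ.stripChart_mem_component_zero hz)
    (mem_connectedComponentIn hσ.isHalfPlaneArc.zero_notMem_double)

theorem mirrorIndex_of_mem_upper (hσ : IsStripArc L σ) {z : ℂ} (hz : z ∈ upper L σ) :
    mirrorIndex (fun t => stripChart L (σ t)) (stripChart L z) = 0 := by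
  rw [← hσ.isHalfPlaneArc.mirrorIndex_of_far hσ.two_I_far]
  exact hσ.isHalfPlaneArc.mirrorIndex_eq_of_isPreconnected isPreconnected_connectedComponentIn
    (connectedComponentIn_subset _ _) (hσ.stripChart_mem_component hz)
    (mem_connectedComponentIn (hσ.isHalfPlaneArc.far_notMem_double hσ.two_I_far))

theorem disjoint_lower_upper (hσ : IsStripArc L σ) : Disjoint (lower L σ) (upper L σ) := by
  rw [Set.disjoint_left]
  intro z hl hu
  have h := hσ.mirrorIndex_of_mem_lower hl
  rw [hσ.mirrorIndex_of_mem_upper hu] at h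
  exact two_pi_I_ne_zero h.symm

/-- Here the index excludes 0 from the component, so its image under the inverse chart is connected.
-/
theorem stripChartInv_mem_upper (hσ : IsStripArc L σ) {w : ℂ}
    (hw : w ∈ connectedComponentIn (mirrorDouble (range fun t => stripChart L (σ t)))ᶜ
      (stripChart L (2 * I))) : w ≠ 0 ∧ stripChartInv L w ∈ upper L σ := by
  have harc := hσ.isHalfPlaneArc
  have hfar := harc.far_notMem_double hσ.two_I_far
  have h0 : ∀ v ∈ connectedComponentIn (mirrorDouble (range fun t => stripChart L (σ t)))ᶜ
      (stripChart L (2 * I)), v ≠ 0 := by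
    rintro _ hv rfl
    have h := harc.mirrorIndex_eq_of_isPreconnected isPreconnected_connectedComponentIn
      (connectedComponentIn_subset _ _) hv (mem_connectedComponentIn hfar)
    rw [harc.mirrorIndex_zero, harc.mirrorIndex_of_far hσ.two_I_far] at h
    exact two_pi_I_ne_zero h
  refine ⟨h0 w hw, (isPreconnected_connectedComponentIn.image _
    (continuousOn_stripChartInv.mono h0)).subset_connectedComponentIn
    ⟨_, mem_connectedComponentIn hfar, stripChartInv_stripChart hσ.pos hσ.two_I_mem.1⟩ ?_
    ⟨w, hw, rfl⟩⟩
  rintro _ ⟨v, hv, rfl⟩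
  exact hσ.stripChartInv_notMem (h0 v hv) (connectedComponentIn_subset _ _ hv)

theorem mem_lower_or_upper (hσ : IsStripArc L σ) {z : ℂ} (hz : z ∈ verticalStrip L \ range σ) :
    z ∈ lower L σ ∨ z ∈ upper L σ := by
  have hinv := stripChartInv_stripChart hσ.pos hz.1
  rcases hσ.isHalfPlaneArc.mem_component_zero_or_far (hσ.stripChart_notMem_double hz) with h | h
  · left
    rw [← hinv]
    exact hσ.stripChartInv_mem_lower (stripChart_ne_zero z) h
  · right
    rw [← hinv]
    exact (hσ.stripChartInv_mem_upper (h _ hσ.two_I_far)).2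

theorem range_subset_closure_lower (hσ : IsStripArc L σ) : range σ ⊆ closure (lower L σ) := by
  rintro _ ⟨t, rfl⟩
  have h := hσ.isHalfPlaneArc.mem_closure_component (map_zero _) (Or.inl rfl) t
  have hne : stripChart L (σ t) ∈ ({0}ᶜ : Set ℂ) := stripChart_ne_zero _
  have h' := isOpen_compl_singleton.inter_closure ⟨hne, h⟩
  rw [← stripChartInv_stripChart hσ.pos (hσ.mem t)]
  exact (continuousOn_stripChartInv.continuousAt
    (isOpen_compl_singleton.mem_nhds hne)).continuousWithinAt.mem_closure h'
    fun w hw => hσ.stripChartInv_mem_lower hw.1 hw.2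

theorem range_subset_closure_upper (hσ : IsStripArc L σ) : range σ ⊆ closure (upper L σ) := by
  rintro _ ⟨t, rfl⟩
  have h := hσ.isHalfPlaneArc.mem_closure_component conj_stripChart_two_I
    (Or.inr hσ.two_I_far) t
  rw [← stripChartInv_stripChart hσ.pos (hσ.mem t)]
  exact (continuousOn_stripChartInv.continuousAt
    (isOpen_compl_singleton.mem_nhds (stripChart_ne_zero _))).continuousWithinAt.mem_closure h
    fun w hw => (hσ.stripChartInv_mem_upper hw).2

end IsStripArc

end StripArcs

/-! ### Concatenation of simple paths -/

section Concatenation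

open Set

/-- The first half of the unit interval, parametrized by the unit interval. -/
noncomputable def firstHalf (t : unitInterval) : unitInterval :=
  ⟨t / 2, by constructor <;> linarith [t.2.1, t.2.2]⟩

/-- The second half of the unit interval, parametrized by the unit interval. -/
noncomputable def secondHalf (t : unitInterval) : unitInterval :=
  ⟨(t + 1) / 2, by constructor <;> linarith [t.2.1, t.2.2]⟩

theorem continuous_firstHalf : Continuous firstHalf := by
  unfold firstHalf
  fun_prop

theorem continuous_secondHalf : Continuous secondHalf := by
  unfold secondHalf
  fun_prop

theorem eq_firstHalf_or_secondHalf (s : unitInterval) :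
    ∃ t, s = firstHalf t ∨ s = secondHalf t := by
  rcases le_total (s : ℝ) (1 / 2) with h | h
  · exact ⟨⟨2 * s, by constructor <;> linarith [s.2.1]⟩, Or.inl (Subtype.ext (by simp [firstHalf]))⟩
  · exact ⟨⟨2 * s - 1, by constructor <;> linarith [s.2.2]⟩,
      Or.inr (Subtype.ext (by simp [secondHalf]))⟩

theorem firstHalf_zero : firstHalf 0 = 0 := Subtype.ext (by simp [firstHalf])

theorem secondHalf_one : secondHalf 1 = 1 := Subtype.ext (by simp [secondHalf])

theorem firstHalf_one : firstHalf 1 = secondHalf 0 :=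
  Subtype.ext (by simp [firstHalf, secondHalf])

theorem Path.trans_firstHalf {X : Type*} [TopologicalSpace X] {x y z : X} (p : Path x y)
    (q : Path y z) (t : unitInterval) : p.trans q (firstHalf t) = p t := by
  rw [Path.trans_apply, dif_pos (by simp only [firstHalf]; linarith [t.2.2])]
  congr 1
  exact Subtype.ext (mul_div_cancel₀ (t : ℝ) two_ne_zero)

theorem Path.trans_secondHalf {X : Type*} [TopologicalSpace X] {x y z : X} (p : Path x y)
    (q : Path y z) (t : unitInterval) : p.trans q (secondHalf t) = q t := by
  rw [Path.trans_apply]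
  split_ifs with h
  · have h0 : t = 0 := Subtype.ext (by
      simp only [secondHalf] at h
      refine le_antisymm ?_ t.2.1
      change (t : ℝ) ≤ 0
      linarith)
    subst h0
    simp [secondHalf]
  · congr 1
    refine Subtype.ext ?_
    change 2 * (((t : ℝ) + 1) / 2) - 1 = t
    ring

theorem Path.trans_injective {X : Type*} [TopologicalSpace X] {x y z : X} {p : Path x y}
    {q : Path y z} (hp : Function.Injective p) (hq : Function.Injective q)
    (h : ∀ s t, p s = q t → p s = y) : Function.Injective (p.trans q) := by
  have key : ∀ s t, p s = q t → firstHalf s = secondHalf t := by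
    intro s t hst
    have h1 := h s t hst
    have hs : s = 1 := hp (h1.trans p.target.symm)
    have ht : t = 0 := hq ((hst.symm.trans h1).trans q.source.symm)
    rw [hs, ht, firstHalf_one]
  intro a b hab
  obtain ⟨s, rfl | rfl⟩ := eq_firstHalf_or_secondHalf a <;>
    obtain ⟨t, rfl | rfl⟩ := eq_firstHalf_or_secondHalf b <;>
    simp only [Path.trans_firstHalf, Path.trans_secondHalf] at hab
  · rw [hp hab]
  · exact key s t hab
  · exact (key t s hab.symm).symm
  · rw [hq hab]

/-- The map `φ` stands for the half-plane chart and for its conjugate, the two terms of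
`mirrorIndex`. -/
theorem logIncrement_trans {x y z : ℂ} (p : Path x y) (q : Path y z) {φ : ℂ → ℂ}
    (hφ : Continuous φ) {w : ℂ} (hw : ∀ t, φ (p.trans q t) ≠ w) :
    logIncrement (fun t => φ (p.trans q t)) w =
      logIncrement (fun t => φ (p t)) w + logIncrement (fun t => φ (q t)) w := by
  obtain ⟨g, hg, he⟩ := exists_continuous_exp_eq_unitInterval
    (f := fun t => φ (p.trans q t) - w)
    ((hφ.comp (p.trans q).continuous).sub continuous_const) fun t => sub_ne_zero.2 (hw t)
  rw [logIncrement_eq hg he,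
    logIncrement_eq (g := fun t => g (firstHalf t)) (hg.comp continuous_firstHalf) fun t => by
      rw [he, Path.trans_firstHalf],
    logIncrement_eq (g := fun t => g (secondHalf t)) (hg.comp continuous_secondHalf) fun t => by
      rw [he, Path.trans_secondHalf], firstHalf_zero, firstHalf_one, secondHalf_one]
  ring

end Concatenation

/-! ### Images of edges and paths in the rectangle -/

namespace PlaneNetwork

open Set Complex ComplexConjugate

variable {V E : Type*} [Fintype V] [Fintype E] {N : PlaneNetwork V E} {L : ℝ} {F : ℂ → ℂ}

namespace IsRectangleMap

theorem mem_rectangle (hF : N.IsRectangleMap L F) {z : ℂ}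
    (hz : z ∈ N.curve ∪ curveInterior N.curve) :
    (F z).re ∈ Icc 0 L ∧ (F z).im ∈ Icc (0 : ℝ) 1 :=
  mem_reProdIm.1 (hF.2.2.2.2.1.mapsTo hz)

theorem re_eq_zero_iff (hF : N.IsRectangleMap L F) {z : ℂ}
    (hz : z ∈ N.curve ∪ curveInterior N.curve) : (F z).re = 0 ↔ z ∈ N.S₁ := by
  obtain ⟨-, -, -, -, hbij, h1, -⟩ := hF
  constructor
  · intro h
    have hm : F z ∈ F '' N.S₁ := by
      rw [h1]
      exact mem_reProdIm.2 ⟨h, (mem_reProdIm.1 (hbij.mapsTo hz)).2⟩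
    obtain ⟨w, hw, hwz⟩ := hm
    rwa [← hbij.injOn (Or.inl (N.S₁_subset hw)) hz hwz]
  · intro h
    have hm : F z ∈ F '' N.S₁ := ⟨z, h, rfl⟩
    rw [h1] at hm
    exact (mem_reProdIm.1 hm).1

theorem re_eq_width_iff (hF : N.IsRectangleMap L F) {z : ℂ}
    (hz : z ∈ N.curve ∪ curveInterior N.curve) : (F z).re = L ↔ z ∈ N.S₂ := by
  obtain ⟨-, -, -, -, hbij, -, h2⟩ := hF
  constructor
  · intro h
    have hm : F z ∈ F '' N.S₂ := by
      rw [h2]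
      exact mem_reProdIm.2 ⟨h, (mem_reProdIm.1 (hbij.mapsTo hz)).2⟩
    obtain ⟨w, hw, hwz⟩ := hm
    rwa [← hbij.injOn (Or.inl (N.S₂_subset hw)) hz hwz]
  · intro h
    have hm : F z ∈ F '' N.S₂ := ⟨z, h, rfl⟩
    rw [h2] at hm
    exact (mem_reProdIm.1 hm).1

end IsRectangleMap

theorem src_rev (N : PlaneNetwork V E) (d : E × Bool) : N.src (rev d) = N.tgt d := by
  obtain ⟨e, b⟩ := d
  cases b <;> rfl

theorem tgt_rev (N : PlaneNetwork V E) (d : E × Bool) : N.tgt (rev d) = N.src d := by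
  obtain ⟨e, b⟩ := d
  cases b <;> rfl

theorem eq_or_eq_rev {E : Type*} {d d' : E × Bool} (h : d.1 = d'.1) : d = d' ∨ d = rev d' := by
  obtain ⟨e, b⟩ := d
  obtain ⟨e', b'⟩ := d'
  obtain rfl : e = e' := h
  cases b <;> cases b' <;> simp [rev]

/-- The image of a directed edge, as a path. -/
noncomputable def dartPath (hF : N.IsRectangleMap L F) (d : E × Bool) :
    Path (F (N.point (N.src d))) (F (N.point (N.tgt d))) where
  toFun t := F (N.arc d.1 (if d.2 then t else unitInterval.symm t))
  continuous_toFun := by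
    refine hF.2.2.2.1.comp_continuous ((N.arc d.1).continuous.comp ?_) fun t => N.arc_mem _ _
    cases d.2
    · exact unitInterval.continuous_symm
    · exact continuous_id
  source' := by obtain ⟨e, b⟩ := d; cases b <;> simp [src]
  target' := by obtain ⟨e, b⟩ := d; cases b <;> simp [tgt]

theorem dartPath_apply (hF : N.IsRectangleMap L F) (d : E × Bool) (t : unitInterval) :
    dartPath hF d t = F (N.arc d.1 (if d.2 then t else unitInterval.symm t)) := rfl

theorem dartPath_rev (hF : N.IsRectangleMap L F) (d : E × Bool) (t : unitInterval) :
    dartPath hF (rev d) t = dartPath hF d (unitInterval.symm t) := by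
  obtain ⟨e, b⟩ := d
  rw [dartPath_apply, dartPath_apply]
  cases b <;> simp [rev] <;> rfl

theorem range_dartPath (hF : N.IsRectangleMap L F) (d : E × Bool) :
    range (dartPath hF d) = F '' range (N.arc d.1) := by
  obtain ⟨e, b⟩ := d
  rw [← range_comp]
  cases b
  · exact unitInterval.symm_bijective.surjective.range_comp (F ∘ N.arc e)
  · rfl

theorem dartPath_injective (hF : N.IsRectangleMap L F) (d : E × Bool) :
    Function.Injective (dartPath hF d) := by
  intro s t hst
  have h := N.arc_injective _ (hF.2.2.2.2.1.injOn (N.arc_mem _ _) (N.arc_mem _ _) hst)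
  obtain ⟨e, b⟩ := d
  cases b
  · exact unitInterval.symm_bijective.injective h
  · exact h

theorem dartPath_eq_point (hF : N.IsRectangleMap L F) {d : E × Bool} {t : unitInterval} {v : V}
    (h : dartPath hF d t = F (N.point v)) : t = 0 ∧ v = N.src d ∨ t = 1 ∧ v = N.tgt d := by
  have h' := hF.2.2.2.2.1.injOn (N.arc_mem _ _) (N.point_mem v) h
  have h01 : t = 0 ∨ t = 1 := by
    by_contra! hcon
    refine N.arc_ne_point d.1 _ ?_ ?_ v h'
    · obtain ⟨e, b⟩ := d
      cases b <;> simp [hcon.1, hcon.2]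
    · obtain ⟨e, b⟩ := d
      cases b <;> simp [hcon.1, hcon.2]
  have hinj : ∀ u, F (N.point u) = F (N.point v) → v = u := fun u hu =>
    (N.point_injective (hF.2.2.2.2.1.injOn (N.point_mem u) (N.point_mem v) hu)).symm
  rcases h01 with rfl | rfl
  · exact Or.inl ⟨rfl, hinj _ (by rw [← h, Path.source])⟩
  · exact Or.inr ⟨rfl, hinj _ (by rw [← h, Path.target])⟩

/-- Two distinct edges meet only in common end vertices. -/
theorem dartPath_eq_dartPath (hF : N.IsRectangleMap L F) {d d' : E × Bool} (hd : d.1 ≠ d'.1)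
    {s t : unitInterval} (h : dartPath hF d s = dartPath hF d' t) :
    (s = 0 ∨ s = 1) ∧ (t = 0 ∨ t = 1) := by
  have hpt : ∀ (d : E × Bool) (s : unitInterval), s = 0 ∨ s = 1 →
      ∃ v, dartPath hF d s = F (N.point v) := by
    rintro d s (rfl | rfl)
    · exact ⟨_, Path.source _⟩
    · exact ⟨_, Path.target _⟩
  have hback : ∀ {d : E × Bool} {t : unitInterval} {v : V}, dartPath hF d t = F (N.point v) →
      t = 0 ∨ t = 1 := fun h => (dartPath_eq_point hF h).imp And.left And.left
  by_cases hs : s = 0 ∨ s = 1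
  · obtain ⟨v, hv⟩ := hpt d s hs
    exact ⟨hs, hback (h.symm.trans hv)⟩
  by_cases ht : t = 0 ∨ t = 1
  · obtain ⟨v, hv⟩ := hpt d' t ht
    exact absurd (hback (h.trans hv)) hs
  push Not at hs ht
  have h' := hF.2.2.2.2.1.injOn (N.arc_mem _ _) (N.arc_mem _ _) h
  refine absurd h' (N.arc_ne_arc _ _ hd _ _ ?_ ?_ ?_ ?_)
  · cases d.2 <;> simp [hs.1, hs.2]
  · cases d.2 <;> simp [hs.1, hs.2]
  · cases d'.2 <;> simp [ht.1, ht.2]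
  · cases d'.2 <;> simp [ht.1, ht.2]

theorem edges_eq (γ : N.ABPath) : γ.edges = {e | ∃ d ∈ γ.darts, d.1 = e} := rfl

theorem image_trace_edges (hF : N.IsRectangleMap L F) (γ : N.ABPath) :
    F '' N.trace γ.edges = ⋃ d ∈ γ.darts, range (dartPath hF d) := by
  ext z
  simp only [trace, image_iUnion, mem_iUnion, edges_eq, mem_ofPred_eq, range_dartPath]
  constructor
  · rintro ⟨e, ⟨d, hd, rfl⟩, h⟩
    exact ⟨d, hd, h⟩
  · rintro ⟨d, hd, h⟩
    exact ⟨d.1, ⟨d, hd, rfl⟩, h⟩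


/-- The list `l` of directed edges leads from `u` to `v`. -/
def IsWalk (N : PlaneNetwork V E) : V → List (E × Bool) → V → Prop
  | u, [], v => u = v
  | u, d :: l, v => N.src d = u ∧ N.IsWalk (N.tgt d) l v

theorem isWalk_of_isChain : ∀ (l : List (E × Bool)) (hl : l ≠ []),
    l.IsChain (fun d d' => N.tgt d = N.src d') →
      N.IsWalk (N.src (l.head hl)) l (N.tgt (l.getLast hl))
  | [], hl, _ => absurd rfl hl
  | [d], _, _ => ⟨rfl, rfl⟩
  | d :: d' :: l, _, hc => by
    rw [List.isChain_cons_cons] at hc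
    refine ⟨rfl, ?_⟩
    rw [hc.1]
    exact isWalk_of_isChain (d' :: l) (by simp) hc.2

theorem IsWalk.isChain : ∀ {l : List (E × Bool)} {u v : V}, N.IsWalk u l v →
    l.IsChain (fun d d' => N.tgt d = N.src d')
  | [], _, _, _ => List.isChain_nil
  | [_], _, _, _ => List.isChain_singleton _
  | _ :: _ :: _, _, _, h => List.isChain_cons_cons.2 ⟨h.2.1.symm, h.2.isChain⟩

theorem IsWalk.src_head {l : List (E × Bool)} (hl : l ≠ []) {u v : V} (h : N.IsWalk u l v) :
    N.src (l.head hl) = u := by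
  cases l with
  | nil => exact absurd rfl hl
  | cons d l => exact h.1

theorem IsWalk.tgt_getLast : ∀ {l : List (E × Bool)} (hl : l ≠ []) {u v : V}, N.IsWalk u l v →
    N.tgt (l.getLast hl) = v
  | [], hl, _, _, _ => absurd rfl hl
  | [_], _, _, _, h => h.2
  | _ :: _ :: _, _, _, _, h => h.2.tgt_getLast (by simp)

theorem IsWalk.src_eq_or {l : List (E × Bool)} {u v : V} (h : N.IsWalk u l v) {d : E × Bool}
    (hd : d ∈ l) : N.src d = u ∨ ∃ d' ∈ l, N.tgt d' = N.src d := by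
  induction l generalizing u with
  | nil => simp at hd
  | cons b l ih =>
    rcases List.mem_cons.1 hd with rfl | hd
    · exact Or.inl h.1
    · rcases ih h.2 hd with h' | ⟨d', hd', h'⟩
      · exact Or.inr ⟨b, by simp, h'.symm⟩
      · exact Or.inr ⟨d', List.mem_cons_of_mem _ hd', h'⟩

theorem IsWalk.tgt_eq_or {l : List (E × Bool)} {u v : V} (h : N.IsWalk u l v) {d : E × Bool}
    (hd : d ∈ l) : N.tgt d = v ∨ ∃ d' ∈ l, N.src d' = N.tgt d := by
  induction l generalizing u with
  | nil => simp at hd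
  | cons b l ih =>
    rcases List.mem_cons.1 hd with rfl | hd
    · cases l with
      | nil => exact Or.inl h.2
      | cons c l => exact Or.inr ⟨c, by simp, h.2.1⟩
    · rcases ih h.2 hd with h' | ⟨d', hd', h'⟩
      · exact Or.inl h'
      · exact Or.inr ⟨d', List.mem_cons_of_mem _ hd', h'⟩

/-- In a walk through distinct vertices that leaves its first vertex by `d`, the part after `d`
does not use the edge of `d`, and meets it only at the end of `d`. -/
theorem IsWalk.notMem_of_nodup {l : List (E × Bool)} {d b : E × Bool} {v : V}
    (h : N.IsWalk (N.tgt d) l v) (hn : (N.src d :: (d :: l).map N.tgt).Nodup) (hb : b ∈ l) :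
    d.1 ≠ b.1 ∧ N.src d ≠ N.src b ∧ N.src d ≠ N.tgt b := by
  simp only [List.map_cons, List.nodup_cons, List.mem_cons, not_or, List.mem_map, not_exists,
    not_and] at hn
  have h1 : N.src d ≠ N.tgt b := fun h => hn.1.2 b hb h.symm
  refine ⟨fun he => ?_, fun hs => ?_, h1⟩
  · rcases eq_or_eq_rev he with rfl | rfl
    · exact hn.2.1 _ hb rfl
    · exact h1 (N.src_rev b)
  · rcases h.src_eq_or hb with h' | ⟨c, hc, h'⟩
    · exact hn.1.1 (hs.trans h')
    · exact hn.1.2 c hc (h'.trans hs.symm)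

/-- The images of consecutive directed edges through distinct vertices form a simple path. -/
theorem IsWalk.exists_path (hF : N.IsRectangleMap L F) {l : List (E × Bool)} (hl : l ≠ [])
    {u v : V} (h : N.IsWalk u l v) (hn : (u :: l.map N.tgt).Nodup) :
    ∃ τ : Path (F (N.point u)) (F (N.point v)),
      Function.Injective τ ∧ range τ = ⋃ d ∈ l, range (dartPath hF d) ∧
      ∀ (φ : ℂ → ℂ), Continuous φ → ∀ w, (∀ t, φ (τ t) ≠ w) →
        logIncrement (fun t => φ (τ t)) w =
          (l.map fun d => logIncrement (fun t => φ (dartPath hF d t)) w).sum := by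
  induction l generalizing u with
  | nil => exact absurd rfl hl
  | cons d l ih =>
    obtain ⟨rfl, h⟩ := h
    rcases eq_or_ne l [] with rfl | hl'
    · obtain rfl : N.tgt d = v := h
      refine ⟨dartPath hF d, dartPath_injective hF d, ?_, fun φ _ w _ => ?_⟩
      · simp only [List.mem_singleton, iUnion_iUnion_eq_left]
      · simp only [List.map_cons, List.map_nil, List.sum_singleton]
    · obtain ⟨τ, hinj, hrange, hlog⟩ := ih hl' h (List.nodup_cons.1 hn).2
      refine ⟨(dartPath hF d).trans τ, Path.trans_injective (dartPath_injective hF d) hinj ?_,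
        ?_, ?_⟩
      · intro s t hst
        have hmem : dartPath hF d s ∈ range τ := ⟨t, hst.symm⟩
        rw [hrange] at hmem
        simp only [mem_iUnion] at hmem
        obtain ⟨b, hb, r, hr⟩ := hmem
        obtain ⟨he, h1, h2⟩ := h.notMem_of_nodup hn hb
        obtain ⟨rfl | rfl, -⟩ := dartPath_eq_dartPath hF he hr.symm
        · rw [Path.source] at hr
          rcases dartPath_eq_point hF hr with ⟨-, h3⟩ | ⟨-, h3⟩
          · exact absurd h3 h1
          · exact absurd h3 h2
        · exact Path.target _
      · rw [Path.trans_range, hrange]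
        simp
      · intro φ hφ w hw
        rw [logIncrement_trans _ _ hφ hw, List.map_cons, List.sum_cons, ← hlog φ hφ w]
        intro t ht
        refine hw (secondHalf t) ?_
        rw [Path.trans_secondHalf]
        exact ht

/-- A path that meets `A` only in its first and `B` only in its last vertex. -/
def IsCrossing (N : PlaneNetwork V E) (γ : N.ABPath) : Prop :=
  ∀ d ∈ γ.darts, N.tgt d ∉ N.A ∧ N.src d ∉ N.B

/-- The index of a directed edge about a point, in the half-plane chart. -/
noncomputable def dartIndex (hF : N.IsRectangleMap L F) (d : E × Bool) (q : ℂ) : ℂ :=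
  mirrorIndex (fun t => stripChart L (dartPath hF d t)) q

theorem dartIndex_rev (hF : N.IsRectangleMap L F) (d : E × Bool) (q : ℂ) :
    dartIndex hF (rev d) q = -dartIndex hF d q := by
  simp only [dartIndex, mirrorIndex, dartPath_rev]
  rw [logIncrement_symm (fun t => stripChart L (dartPath hF d t)),
    logIncrement_symm (fun t => conj (stripChart L (dartPath hF d t)))]
  ring

/-- An inner point of an edge on the left side forces both ends into `A`. Hence a crossing path
touches this side only at its start. -/
theorem mem_S₁_of_dartPath (hF : N.IsRectangleMap L F) {d : E × Bool} {t : unitInterval}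
    (h : (dartPath hF d t).re = 0) : t = 0 ∧ N.src d ∈ N.A ∨ N.tgt d ∈ N.A := by
  rw [dartPath_apply, hF.re_eq_zero_iff (N.arc_mem _ _)] at h
  obtain ⟨e, b⟩ := d
  by_cases h0 : t = 0
  · subst h0
    left
    cases b <;> simpa [A, src] using h
  by_cases h1 : t = 1
  · subst h1
    right
    cases b <;> simpa [A, tgt] using h
  right
  have := N.arc_mem_S₁ e _ (by cases b <;> simp [h0, h1]) (by cases b <;> simp [h0, h1]) h
  cases b
  · exact this.1
  · exact this.2

theorem mem_S₂_of_dartPath (hF : N.IsRectangleMap L F) {d : E × Bool} {t : unitInterval}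
    (h : (dartPath hF d t).re = L) : t = 1 ∧ N.tgt d ∈ N.B ∨ N.src d ∈ N.B := by
  rw [dartPath_apply, hF.re_eq_width_iff (N.arc_mem _ _)] at h
  obtain ⟨e, b⟩ := d
  by_cases h0 : t = 0
  · subst h0
    right
    cases b <;> simpa [B, src] using h
  by_cases h1 : t = 1
  · subst h1
    left
    cases b <;> simpa [B, tgt] using h
  right
  have := N.arc_mem_S₂ e _ (by cases b <;> simp [h0, h1]) (by cases b <;> simp [h0, h1]) h
  cases b
  · exact this.2
  · exact this.1

/-- The image of a crossing path is an arc across the rectangle. -/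
theorem IsCrossing.exists_isStripArc (hF : N.IsRectangleMap L F) {γ : N.ABPath}
    (hγ : N.IsCrossing γ) : ∃ τ : unitInterval → ℂ, IsStripArc L τ ∧
      range τ = F '' N.trace γ.edges ∧
      ∀ q ∉ mirrorDouble (range fun t => stripChart L (τ t)),
        mirrorIndex (fun t => stripChart L (τ t)) q =
          (γ.darts.map fun d => dartIndex hF d q).sum := by
  have hwalk := isWalk_of_isChain γ.darts γ.ne_nil γ.chain
  obtain ⟨τ, hinj, hrange, hlog⟩ := hwalk.exists_path hF γ.ne_nil γ.nodup
  have hpt : ∀ t, ∃ d ∈ γ.darts, ∃ s, dartPath hF d s = τ t := by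
    intro t
    have : τ t ∈ range τ := ⟨t, rfl⟩
    rw [hrange] at this
    simpa only [mem_iUnion, exists_prop, mem_range] using this
  have hrect : ∀ t, (τ t).re ∈ Icc 0 L ∧ (τ t).im ∈ Icc (0 : ℝ) 1 := by
    intro t
    obtain ⟨d, -, s, hs⟩ := hpt t
    rw [← hs]
    exact hF.mem_rectangle (N.arc_mem _ _)
  refine ⟨τ, ⟨hF.1, τ.continuous, hinj, fun t => (hrect t).1, fun t => (hrect t).2, fun t => ?_,
    fun t => ?_⟩, by rw [hrange, image_trace_edges hF], fun q hq => ?_⟩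
  · constructor
    · intro ht
      obtain ⟨d, hd, s, hs⟩ := hpt t
      rw [← hs] at ht
      rcases mem_S₁_of_dartPath hF ht with ⟨rfl, h⟩ | h
      · rcases hwalk.src_eq_or hd with h' | ⟨d', hd', h'⟩
        · rw [Path.source, h'] at hs
          exact (hinj (τ.source.trans hs)).symm
        · exact absurd (h' ▸ h) (hγ d' hd').1
      · exact absurd h (hγ d hd).1
    · rintro rfl
      rw [τ.source, hF.re_eq_zero_iff (N.point_mem _)]
      exact γ.start_mem
  · constructor
    · intro ht
      obtain ⟨d, hd, s, hs⟩ := hpt t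
      rw [← hs] at ht
      rcases mem_S₂_of_dartPath hF ht with ⟨rfl, h⟩ | h
      · rcases hwalk.tgt_eq_or hd with h' | ⟨d', hd', h'⟩
        · rw [Path.target, h'] at hs
          exact (hinj (τ.target.trans hs)).symm
        · exact absurd (h' ▸ h) (hγ d' hd').2
      · exact absurd h (hγ d hd).2
    · rintro rfl
      rw [τ.target, hF.re_eq_width_iff (N.point_mem _)]
      exact γ.end_mem
  · obtain ⟨h1, h2⟩ := IsHalfPlaneArc.ne_of_notMem_double hq
    simp only [dartIndex, mirrorIndex]
    rw [hlog _ continuous_stripChart q h1,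
      hlog (fun z => conj (stripChart L z)) (continuous_conj.comp continuous_stripChart) q h2]
    induction γ.darts with
    | nil => simp
    | cons d l ih =>
      simp only [List.map_cons, List.sum_cons, ← ih]
      ring

end PlaneNetwork

/-! ### The regions under and above a crossing path -/

namespace PlaneNetwork

open Set Complex Topology

variable {V E : Type*} [Fintype V] [Fintype E] {N : PlaneNetwork V E} {L : ℝ} {F : ℂ → ℂ}

/-- The component of the slit vertical strip that contains `2 * I`. -/
def regionAbove (N : PlaneNetwork V E) (L : ℝ) (F : ℂ → ℂ) (γ : N.ABPath) : Set ℂ :=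
  connectedComponentIn (verticalStrip L \ F '' N.trace γ.edges) (2 * I)

theorem regionUnder_eq (γ : N.ABPath) : N.regionUnder L F γ =
    connectedComponentIn (verticalStrip L \ F '' N.trace γ.edges) (-I) := rfl

theorem mem_verticalStrip_of_trace (hF : N.IsRectangleMap L F) {H : Set E} {z : ℂ}
    (hz : z ∈ F '' N.trace H) : z ∈ verticalStrip L := by
  obtain ⟨w, hw, rfl⟩ := hz
  simp only [trace, mem_iUnion] at hw
  obtain ⟨e, -, t, rfl⟩ := hw
  exact (hF.mem_rectangle (N.arc_mem e t)).1

namespace IsCrossing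

variable {γ γ' : N.ABPath}

theorem isClosed_trace (hF : N.IsRectangleMap L F) (hγ : N.IsCrossing γ) :
    IsClosed (F '' N.trace γ.edges) := by
  obtain ⟨τ, hτ, hr, -⟩ := hγ.exists_isStripArc hF
  rw [← hr]
  exact hτ.isClosed_range

theorem disjoint_under_above (hF : N.IsRectangleMap L F) (hγ : N.IsCrossing γ) :
    Disjoint (N.regionUnder L F γ) (N.regionAbove L F γ) := by
  obtain ⟨τ, hτ, hr, -⟩ := hγ.exists_isStripArc hF
  rw [regionUnder_eq, regionAbove, ← hr]
  exact hτ.disjoint_lower_upper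

theorem mem_under_or_above (hF : N.IsRectangleMap L F) (hγ : N.IsCrossing γ) {z : ℂ}
    (hz : z ∈ verticalStrip L) (hzγ : z ∉ F '' N.trace γ.edges) :
    z ∈ N.regionUnder L F γ ∨ z ∈ N.regionAbove L F γ := by
  obtain ⟨τ, hτ, hr, -⟩ := hγ.exists_isStripArc hF
  rw [← hr] at hzγ
  rw [regionUnder_eq, regionAbove, ← hr]
  exact hτ.mem_lower_or_upper ⟨hz, hzγ⟩

theorem trace_subset_closure_under (hF : N.IsRectangleMap L F) (hγ : N.IsCrossing γ) :
    F '' N.trace γ.edges ⊆ closure (N.regionUnder L F γ) := by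
  obtain ⟨τ, hτ, hr, -⟩ := hγ.exists_isStripArc hF
  rw [regionUnder_eq, ← hr]
  exact hτ.range_subset_closure_lower

theorem trace_subset_closure_above (hF : N.IsRectangleMap L F) (hγ : N.IsCrossing γ) :
    F '' N.trace γ.edges ⊆ closure (N.regionAbove L F γ) := by
  obtain ⟨τ, hτ, hr, -⟩ := hγ.exists_isStripArc hF
  rw [regionAbove, ← hr]
  exact hτ.range_subset_closure_upper

theorem sum_dartIndex_of_mem_under (hF : N.IsRectangleMap L F) (hγ : N.IsCrossing γ) {z : ℂ}
    (hz : z ∈ N.regionUnder L F γ) :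
    (γ.darts.map fun d => dartIndex hF d (stripChart L z)).sum = 2 * Real.pi * I := by
  obtain ⟨τ, hτ, hr, hi⟩ := hγ.exists_isStripArc hF
  rw [regionUnder_eq, ← hr] at hz
  rw [← hi _ (hτ.stripChart_notMem_double (connectedComponentIn_subset _ _ hz))]
  exact hτ.mirrorIndex_of_mem_lower hz

theorem sum_dartIndex_of_mem_above (hF : N.IsRectangleMap L F) (hγ : N.IsCrossing γ) {z : ℂ}
    (hz : z ∈ N.regionAbove L F γ) :
    (γ.darts.map fun d => dartIndex hF d (stripChart L z)).sum = 0 := by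
  obtain ⟨τ, hτ, hr, hi⟩ := hγ.exists_isStripArc hF
  rw [regionAbove, ← hr] at hz
  rw [← hi _ (hτ.stripChart_notMem_double (connectedComponentIn_subset _ _ hz))]
  exact hτ.mirrorIndex_of_mem_upper hz

theorem neg_I_mem (hF : N.IsRectangleMap L F) (hγ : N.IsCrossing γ) :
    -I ∈ verticalStrip L \ F '' N.trace γ.edges := by
  obtain ⟨τ, hτ, hr, -⟩ := hγ.exists_isStripArc hF
  rw [← hr]
  exact hτ.neg_I_mem

theorem two_I_mem (hF : N.IsRectangleMap L F) (hγ : N.IsCrossing γ) :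
    2 * I ∈ verticalStrip L \ F '' N.trace γ.edges := by
  obtain ⟨τ, hτ, hr, -⟩ := hγ.exists_isStripArc hF
  rw [← hr]
  exact hτ.two_I_mem

/-- A component of the slit strip that meets the closure of a subset of the strip meets the
subset. -/
theorem exists_mem_component_of_mem_closure (hF : N.IsRectangleMap L F) (hγ : N.IsCrossing γ)
    {x z : ℂ} (hz : z ∈ connectedComponentIn (verticalStrip L \ F '' N.trace γ.edges) x)
    {S : Set ℂ} (hS : S ⊆ verticalStrip L) (hzS : z ∈ closure S) :
    ∃ w ∈ S, w ∈ connectedComponentIn (verticalStrip L \ F '' N.trace γ.edges) x := by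
  have hz' := connectedComponentIn_subset _ _ hz
  have hev := eventually_mem_component_iff (x := x) (hγ.isClosed_trace hF) hz'.1 hz'.2
  have hev' := hev.filter_mono (nhdsWithin_mono z hS)
  have := mem_closure_iff_nhdsWithin_neBot.1 hzS
  obtain ⟨w, hw, hwS⟩ := (hev'.and self_mem_nhdsWithin).exists
  exact ⟨w, hwS, hw.2 hz⟩

/-- The two regions and the path exhaust the strip, the path lies in the closure of the lower
region, and the upper region is relatively open. The condition on top paths thereby becomes
disjointness from `regionAbove`. -/
theorem mem_closure_under_iff (hF : N.IsRectangleMap L F) (hγ : N.IsCrossing γ) {z : ℂ}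
    (hz : z ∈ verticalStrip L) :
    z ∈ closure (N.regionUnder L F γ) ↔ z ∉ N.regionAbove L F γ := by
  constructor
  · intro h ha
    obtain ⟨w, hw, hwa⟩ := hγ.exists_mem_component_of_mem_closure hF ha
      (fun w hw => (connectedComponentIn_subset _ _ hw).1) h
    exact Set.disjoint_left.1 (hγ.disjoint_under_above hF) hw hwa
  · intro h
    by_cases hzγ : z ∈ F '' N.trace γ.edges
    · exact hγ.trace_subset_closure_under hF hzγ
    · exact subset_closure ((hγ.mem_under_or_above hF hz hzγ).resolve_right h)

theorem subset_closure_under_iff (hF : N.IsRectangleMap L F) (hγ : N.IsCrossing γ) {H : Set E} :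
    F '' N.trace H ⊆ closure (N.regionUnder L F γ) ↔
      Disjoint (F '' N.trace H) (N.regionAbove L F γ) := by
  rw [Set.disjoint_left]
  exact forall₂_congr fun z hz => hγ.mem_closure_under_iff hF (mem_verticalStrip_of_trace hF hz)

/-- The region above `γ` is connected, contains `2 * I` and avoids `γ'`. -/
theorem regionAbove_subset (hF : N.IsRectangleMap L F) (hγ : N.IsCrossing γ)
    (h : Disjoint (F '' N.trace γ'.edges) (N.regionAbove L F γ)) :
    N.regionAbove L F γ ⊆ N.regionAbove L F γ' :=
  isPreconnected_connectedComponentIn.subset_connectedComponentIn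
    (mem_connectedComponentIn (hγ.two_I_mem hF)) fun _ hz =>
      ⟨(connectedComponentIn_subset _ _ hz).1, fun hz' => Set.disjoint_left.1 h hz' hz⟩

theorem regionUnder_subset (hF : N.IsRectangleMap L F) (hγ : N.IsCrossing γ)
    (h : Disjoint (F '' N.trace γ'.edges) (N.regionUnder L F γ)) :
    N.regionUnder L F γ ⊆ N.regionUnder L F γ' :=
  isPreconnected_connectedComponentIn.subset_connectedComponentIn
    (mem_connectedComponentIn (hγ.neg_I_mem hF)) fun _ hz =>
      ⟨(connectedComponentIn_subset _ _ hz).1, fun hz' => Set.disjoint_left.1 h hz' hz⟩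

theorem closure_under_subset (hF : N.IsRectangleMap L F) (hγ : N.IsCrossing γ)
    (hγ' : N.IsCrossing γ')
    (h : F '' N.trace γ'.edges ⊆ closure (N.regionUnder L F γ)) :
    closure (N.regionUnder L F γ') ⊆ closure (N.regionUnder L F γ) := by
  refine closure_minimal (fun z hz => ?_) isClosed_closure
  have hzs := (connectedComponentIn_subset _ _ hz).1
  rw [hγ.mem_closure_under_iff hF hzs]
  intro hza
  exact Set.disjoint_left.1 (hγ'.disjoint_under_above hF) hz
    (hγ.regionAbove_subset hF ((hγ.subset_closure_under_iff hF).1 h) hza)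

theorem dartPath_notMem_trace (hF : N.IsRectangleMap L F) {d : E × Bool} (hd : d.1 ∉ γ.edges)
    {t : unitInterval} (h0 : t ≠ 0) (h1 : t ≠ 1) :
    dartPath hF d t ∉ F '' N.trace γ.edges := by
  rw [image_trace_edges hF]
  simp only [mem_iUnion, not_exists]
  rintro b hb ⟨s, hs⟩
  have hne : d.1 ≠ b.1 := fun h => hd ⟨b, hb, h.symm⟩
  exact (dartPath_eq_dartPath hF hne hs.symm).1.elim h0 h1

/-- An edge off a crossing path that meets the region under the path lies in its closure. -/
theorem range_subset_closure_under (hF : N.IsRectangleMap L F) (hγ : N.IsCrossing γ)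
    {d : E × Bool} (hd : d.1 ∉ γ.edges) {t : unitInterval}
    (ht : dartPath hF d t ∈ N.regionUnder L F γ) :
    range (dartPath hF d) ⊆ closure (N.regionUnder L F γ) := by
  set S := dartPath hF d '' Ioo 0 1 with hS
  have hrange : range (dartPath hF d) ⊆ closure S := by
    rintro _ ⟨s, rfl⟩
    have hs : s ∈ closure (Ioo (0 : unitInterval) 1) := by
      rw [closure_Ioo zero_ne_one]
      exact ⟨unitInterval.nonneg', unitInterval.le_one'⟩
    exact image_closure_subset_closure_image (dartPath hF d).continuous ⟨s, hs, rfl⟩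
  have hstrip : S ⊆ verticalStrip L := by
    rintro _ ⟨s, -, rfl⟩
    exact (hF.mem_rectangle (N.arc_mem _ _)).1
  have hST : S ⊆ verticalStrip L \ F '' N.trace γ.edges := by
    rintro _ ⟨s, hs, rfl⟩
    exact ⟨hstrip ⟨s, hs, rfl⟩, dartPath_notMem_trace hF hd hs.1.ne' hs.2.ne⟩
  -- The given point may be an end of the edge; a nearby point of the open edge, which is connected
  -- and avoids the path, is in the same component.
  obtain ⟨w, hwS, hw⟩ := hγ.exists_mem_component_of_mem_closure hF ht hstrip (hrange ⟨t, rfl⟩)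
  have hpre : IsPreconnected S :=
    isPreconnected_Ioo.image _ (dartPath hF d).continuous.continuousOn
  refine hrange.trans (closure_mono ?_)
  rw [regionUnder_eq, connectedComponentIn_eq hw]
  exact hpre.subset_connectedComponentIn hwS hST

end IsCrossing

end PlaneNetwork

/-! ### Increasing paths and flows -/

namespace PlaneNetwork

open Set

variable {V E : Type*} [Fintype V] [Fintype E] {N : PlaneNetwork V E}

theorem IsWalk.append {l l' : List (E × Bool)} {u v w : V} (h : N.IsWalk u l v)
    (h' : N.IsWalk v l' w) : N.IsWalk u (l ++ l') w := by
  induction l generalizing u with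
  | nil =>
    obtain rfl : u = v := h
    exact h'
  | cons d l ih => exact ⟨h.1, ih h.2⟩

theorem IsWalk.lt_of_mem {l : List (E × Bool)} {u v : V} (hw : N.IsWalk u l v) {h : V → ℝ}
    (hh : ∀ d ∈ l, h (N.src d) < h (N.tgt d)) {d : E × Bool} (hd : d ∈ l) :
    h u ≤ h (N.src d) ∧ h (N.tgt d) ≤ h v := by
  induction l generalizing u d with
  | nil => simp at hd
  | cons b l ih =>
    obtain ⟨rfl, hw⟩ := hw
    have hb := hh b (by simp)
    have hl : ∀ d ∈ l, h (N.src d) < h (N.tgt d) := fun d hd => hh d (List.mem_cons_of_mem _ hd)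
    rcases List.mem_cons.1 hd with rfl | hd
    · refine ⟨le_rfl, ?_⟩
      cases l with
      | nil => exact (congrArg h hw).le
      | cons c l =>
        have := ih hw hl (List.mem_cons_self)
        have := hl c List.mem_cons_self
        linarith
    · have := ih hw hl hd
      exact ⟨hb.le.trans this.1, this.2⟩

theorem IsWalk.pairwise_lt {l : List (E × Bool)} {u v : V} (hw : N.IsWalk u l v) {h : V → ℝ}
    (hh : ∀ d ∈ l, h (N.src d) < h (N.tgt d)) :
    (u :: l.map N.tgt).Pairwise (fun x y => h x < h y) := by
  induction l generalizing u with
  | nil => simp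
  | cons b l ih =>
    have hl : ∀ d ∈ l, h (N.src d) < h (N.tgt d) := fun d hd => hh d (List.mem_cons_of_mem _ hd)
    rw [List.pairwise_cons]
    refine ⟨fun x hx => ?_, ih hw.2 hl⟩
    obtain ⟨d, hd, rfl⟩ := List.mem_map.1 hx
    exact (hw.lt_of_mem hh hd).1.trans_lt (hh d hd)

/-- A potential that vanishes on `A` and is one on `B`. -/
def IsBoundaryPotential (N : PlaneNetwork V E) (h : V → ℝ) : Prop :=
  (∀ v ∈ N.A, h v = 0) ∧ ∀ v ∈ N.B, h v = 1

/-- A path along which `h` strictly increases. -/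
def ABPath.Increasing (γ : N.ABPath) (h : V → ℝ) : Prop :=
  ∀ d ∈ γ.darts, h (N.src d) < h (N.tgt d)

theorem ABPath.isWalk (γ : N.ABPath) : N.IsWalk (N.src (γ.darts.head γ.ne_nil)) γ.darts
    (N.tgt (γ.darts.getLast γ.ne_nil)) :=
  isWalk_of_isChain γ.darts γ.ne_nil γ.chain

/-- Each directed edge of the path ends at a positive value of `h` and starts at a value below one.
-/
theorem ABPath.Increasing.isCrossing {γ : N.ABPath} {h : V → ℝ} (hγ : γ.Increasing h)
    (hh : N.IsBoundaryPotential h) : N.IsCrossing γ := by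
  intro d hd
  have hw := γ.isWalk.lt_of_mem hγ hd
  rw [hh.1 _ γ.start_mem, hh.2 _ γ.end_mem] at hw
  have hlt := hγ d hd
  refine ⟨fun hA => ?_, fun hB => ?_⟩
  · have := hh.1 _ hA
    linarith
  · have := hh.2 _ hB
    linarith

/-- If directed edges with increasing potential can be prolonged, within a given set, in both
directions until the boundary is reached, then each of them lies on a path in this set. -/
theorem exists_path_through {h : V → ℝ} (hh : N.IsBoundaryPotential h) {D : Set (E × Bool)}
    (hlt : ∀ d ∈ D, h (N.src d) < h (N.tgt d))
    (hout : ∀ d ∈ D, N.tgt d ∉ N.A → N.tgt d ∉ N.B → ∃ d' ∈ D, N.src d' = N.tgt d)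
    (hin : ∀ d ∈ D, N.src d ∉ N.A → N.src d ∉ N.B → ∃ d' ∈ D, N.tgt d' = N.src d)
    {d : E × Bool} (hd : d ∈ D) :
    ∃ γ : N.ABPath, d ∈ γ.darts ∧ ∀ d' ∈ γ.darts, d' ∈ D := by
  classical
  -- The potential rises along every prolongation, so the number of vertices above the current one
  -- drops and the process ends at the boundary.
  have hfwd : ∀ n : ℕ, ∀ d ∈ D, (Finset.univ.filter fun v => h (N.tgt d) < h v).card = n →
      ∃ l v, N.IsWalk (N.tgt d) l v ∧ (∀ d' ∈ l, d' ∈ D) ∧ (v ∈ N.A ∨ v ∈ N.B) := by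
    intro n
    induction n using Nat.strong_induction_on with
    | _ n ih =>
      intro d hd hn
      by_cases hbd : N.tgt d ∈ N.A ∨ N.tgt d ∈ N.B
      · exact ⟨[], _, rfl, by simp, hbd⟩
      · rw [not_or] at hbd
        obtain ⟨d', hd', he⟩ := hout d hd hbd.1 hbd.2
        have hl := hlt d' hd'
        rw [he] at hl
        have hlt' : (Finset.univ.filter fun v => h (N.tgt d') < h v).card < n := by
          rw [← hn]
          refine Finset.card_lt_card ⟨fun v => ?_, fun hsub => ?_⟩
          · simp only [Finset.mem_filter, Finset.mem_univ, true_and]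
            exact hl.trans
          · have := hsub (Finset.mem_filter.2 ⟨Finset.mem_univ (N.tgt d'), hl⟩)
            simp at this
        obtain ⟨l, v, hw, hlD, hv⟩ := ih _ hlt' d' hd' rfl
        exact ⟨d' :: l, v, ⟨he, hw⟩, List.forall_mem_cons.2 ⟨hd', hlD⟩, hv⟩
  have hbwd : ∀ n : ℕ, ∀ d ∈ D, (Finset.univ.filter fun v => h v < h (N.src d)).card = n →
      ∃ l u, N.IsWalk u l (N.src d) ∧ (∀ d' ∈ l, d' ∈ D) ∧ (u ∈ N.A ∨ u ∈ N.B) := by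
    intro n
    induction n using Nat.strong_induction_on with
    | _ n ih =>
      intro d hd hn
      by_cases hbd : N.src d ∈ N.A ∨ N.src d ∈ N.B
      · exact ⟨[], _, rfl, by simp, hbd⟩
      · rw [not_or] at hbd
        obtain ⟨d', hd', he⟩ := hin d hd hbd.1 hbd.2
        have hl := hlt d' hd'
        rw [he] at hl
        have hlt' : (Finset.univ.filter fun v => h v < h (N.src d')).card < n := by
          rw [← hn]
          refine Finset.card_lt_card ⟨fun v => ?_, fun hsub => ?_⟩
          · simp only [Finset.mem_filter, Finset.mem_univ, true_and]
            exact fun hv => hv.trans hl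
          · have := hsub (Finset.mem_filter.2 ⟨Finset.mem_univ (N.src d'), hl⟩)
            simp at this
        obtain ⟨l, u, hw, hlD, hu⟩ := ih _ hlt' d' hd' rfl
        refine ⟨l ++ [d'], u, hw.append ⟨rfl, he⟩, ?_, hu⟩
        intro b hb
        rcases List.mem_append.1 hb with hb | hb
        · exact hlD b hb
        · rwa [List.mem_singleton.1 hb]
  obtain ⟨l₁, v, hw₁, hD₁, hv⟩ := hfwd _ d hd rfl
  obtain ⟨l₂, u, hw₂, hD₂, hu⟩ := hbwd _ d hd rfl
  have hw : N.IsWalk u (l₂ ++ d :: l₁) v := hw₂.append ⟨rfl, hw₁⟩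
  have hD : ∀ b ∈ l₂ ++ d :: l₁, b ∈ D := by
    intro b hb
    rcases List.mem_append.1 hb with hb | hb
    · exact hD₂ b hb
    · rcases List.mem_cons.1 hb with rfl | hb
      · exact hd
      · exact hD₁ b hb
  have hinc : ∀ b ∈ l₂ ++ d :: l₁, h (N.src b) < h (N.tgt b) := fun b hb => hlt b (hD b hb)
  have hdm : d ∈ l₂ ++ d :: l₁ := by simp
  have huv : h u < h v := by
    have := hw.lt_of_mem hinc hdm
    linarith [hinc d hdm]
  have hval : ∀ x, x ∈ N.A ∨ x ∈ N.B → (x ∈ N.A ∧ h x = 0) ∨ (x ∈ N.B ∧ h x = 1) :=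
    fun x hx => hx.imp (fun h => ⟨h, hh.1 x h⟩) fun h => ⟨h, hh.2 x h⟩
  -- Both ends are boundary vertices, and `h u < h v` leaves only this assignment.
  obtain ⟨huA, hvB⟩ : u ∈ N.A ∧ v ∈ N.B := by
    rcases hval u hu with ⟨h1, h2⟩ | ⟨h1, h2⟩ <;> rcases hval v hv with ⟨h3, h4⟩ | ⟨h3, h4⟩
    · linarith
    · exact ⟨h1, h3⟩
    · linarith
    · linarith
  have hne : l₂ ++ d :: l₁ ≠ [] := by simp
  refine ⟨⟨l₂ ++ d :: l₁, hne, hw.isChain, ?_, ?_, ?_⟩, hdm, hD⟩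
  · rw [hw.src_head hne]
    exact (hw.pairwise_lt hinc).imp fun h => by
      rintro rfl
      exact lt_irrefl _ h
  · rwa [hw.src_head hne]
  · rwa [hw.tgt_getLast hne]

/-- A flow from `A` to `B` along increasing values of `h`. -/
structure IsIncreasingFlow (N : PlaneNetwork V E) (h : V → ℝ) (θ : E × Bool → ℝ) : Prop where
  rev : ∀ d, θ (rev d) = -θ d
  lt : ∀ d, 0 < θ d → h (N.src d) < h (N.tgt d)
  sum_eq_zero : ∀ v, v ∉ N.A → v ∉ N.B → ∀ s : Finset (E × Bool),
    (∀ d, d ∈ s ↔ N.src d = v) → ∑ d ∈ s, θ d = 0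

namespace IsIncreasingFlow

variable {h : V → ℝ} {θ : E × Bool → ℝ}

/-- A vanishing sum with a nonzero term has a positive term; for incoming edges, `exists_in` applies
this to the negated sum. -/
theorem exists_out (hθ : N.IsIncreasingFlow h θ) {v : V} (hA : v ∉ N.A) (hB : v ∉ N.B)
    {d : E × Bool} (hd : θ d ≠ 0) (hv : N.src d = v) : ∃ d', 0 < θ d' ∧ N.src d' = v := by
  classical
  have hs := hθ.sum_eq_zero v hA hB (Finset.univ.filter fun d => N.src d = v) (by simp)
  obtain ⟨d', hd', hpos⟩ := Finset.exists_pos_of_sum_zero_of_exists_nonzero _ hs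
    ⟨d, by simpa using hv, hd⟩
  exact ⟨d', hpos, by simpa using hd'⟩

theorem exists_in (hθ : N.IsIncreasingFlow h θ) {v : V} (hA : v ∉ N.A) (hB : v ∉ N.B)
    {d : E × Bool} (hd : θ d ≠ 0) (hv : N.src d = v) : ∃ d', 0 < θ d' ∧ N.tgt d' = v := by
  classical
  have hs := hθ.sum_eq_zero v hA hB (Finset.univ.filter fun d => N.src d = v) (by simp)
  have hs' : ∑ d ∈ Finset.univ.filter fun d => N.src d = v, -θ d = 0 := by
    rw [Finset.sum_neg_distrib, hs, neg_zero]
  obtain ⟨d', hd', hpos⟩ := Finset.exists_pos_of_sum_zero_of_exists_nonzero _ hs'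
    ⟨d, by simpa using hv, neg_ne_zero.2 hd⟩
  refine ⟨PlaneNetwork.rev d', by rwa [hθ.rev], ?_⟩
  rw [tgt_rev]
  simpa using hd'

theorem ne_zero_iff (hθ : N.IsIncreasingFlow h θ) (d : E × Bool) :
    θ d ≠ 0 ↔ θ (d.1, true) ≠ 0 := by
  obtain ⟨e, b⟩ := d
  cases b
  · have := hθ.rev (e, true)
    simp only [PlaneNetwork.rev, Bool.not_true] at this
    rw [this, neg_ne_zero]
  · rfl

theorem exists_pos (hθ : N.IsIncreasingFlow h θ) {e : E} (he : θ (e, true) ≠ 0) :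
    ∃ d : E × Bool, d.1 = e ∧ 0 < θ d := by
  rcases lt_or_gt_of_ne he with hlt | hgt
  · exact ⟨PlaneNetwork.rev (e, true), rfl, by rw [hθ.rev]; linarith⟩
  · exact ⟨_, rfl, hgt⟩

/-- Every edge with a positive flow lies on a path with positive flow. -/
theorem exists_path (hθ : N.IsIncreasingFlow h θ) (hh : N.IsBoundaryPotential h)
    {d : E × Bool} (hd : 0 < θ d) :
    ∃ γ : N.ABPath, d ∈ γ.darts ∧ ∀ d' ∈ γ.darts, 0 < θ d' :=
  exists_path_through hh (D := {d | 0 < θ d}) hθ.lt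
    (fun d hd hA hB => hθ.exists_out hA hB (d := PlaneNetwork.rev d)
      (by rw [hθ.rev]; exact neg_ne_zero.2 (ne_of_gt hd)) (N.src_rev d))
    (fun _ hd hA hB => hθ.exists_in hA hB (ne_of_gt hd) rfl) hd

end IsIncreasingFlow

end PlaneNetwork

/-! ### Existence, direction and uniqueness of top paths -/

namespace PlaneNetwork

open Set Complex Topology ComplexConjugate

variable {V E : Type*} [Fintype V] [Fintype E] {N : PlaneNetwork V E} {L : ℝ} {F : ℂ → ℂ}

theorem image_trace_subset_iff {H : Set E} {S : Set ℂ} :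
    F '' N.trace H ⊆ S ↔ ∀ e ∈ H, F '' range (N.arc e) ⊆ S := by
  simp only [trace, image_iUnion, iUnion_subset_iff]

theorem disjoint_image_trace_iff {H : Set E} {S : Set ℂ} :
    Disjoint (F '' N.trace H) S ↔ ∀ e ∈ H, Disjoint (F '' range (N.arc e)) S := by
  simp only [trace, image_iUnion, disjoint_iUnion_left]

theorem trace_mono {H H' : Set E} (h : H ⊆ H') : N.trace H ⊆ N.trace H' :=
  biUnion_subset_biUnion_left h

theorem range_dartPath_subset (hF : N.IsRectangleMap L F) {d : E × Bool} {H : Set E}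
    (hd : d.1 ∈ H) : range (dartPath hF d) ⊆ F '' N.trace H := by
  rw [range_dartPath]
  exact image_mono (subset_biUnion_of_mem (u := fun e => range (N.arc e)) hd)

theorem ABPath.mem_edges {γ : N.ABPath} {d : E × Bool} (hd : d ∈ γ.darts) : d.1 ∈ γ.edges :=
  ⟨d, hd, rfl⟩

theorem IsTopPath.isCrossing {H : Set E} {γ : N.ABPath} (h : N.IsTopPath L F H γ) :
    N.IsCrossing γ := h.2.1

theorem IsTopPath.mono {H H' : Set E} {γ : N.ABPath} (h : N.IsTopPath L F H γ) (hH : H' ⊆ H)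
    (hγ : γ.edges ⊆ H') : N.IsTopPath L F H' γ :=
  ⟨hγ, h.2.1, (image_mono (trace_mono hH)).trans h.2.2⟩

theorem exists_mem_darts_of_point_mem (hF : N.IsRectangleMap L F) {γ : N.ABPath} {v : V}
    (h : F (N.point v) ∈ F '' N.trace γ.edges) :
    ∃ d ∈ γ.darts, v = N.src d ∨ v = N.tgt d := by
  rw [image_trace_edges hF] at h
  simp only [mem_iUnion] at h
  obtain ⟨d, hd, t, ht⟩ := h
  exact ⟨d, hd, (dartPath_eq_point hF ht).imp And.right And.right⟩

/-- An edge with an end that is neither on a crossing path nor in the region under it does not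
meet this region. -/
theorem IsCrossing.disjoint_range_under (hF : N.IsRectangleMap L F) {γ : N.ABPath}
    (hγ : N.IsCrossing γ) {d : E × Bool} {v : V} (hv : F (N.point v) ∈ range (dartPath hF d))
    (h₁ : F (N.point v) ∉ F '' N.trace γ.edges) (h₂ : F (N.point v) ∉ N.regionUnder L F γ) :
    Disjoint (range (dartPath hF d)) (N.regionUnder L F γ) := by
  rw [Set.disjoint_left]
  rintro _ ⟨t, rfl⟩ ht
  have hd : d.1 ∉ γ.edges := fun hd => h₁ (range_dartPath_subset hF hd hv)
  have hvc := hγ.range_subset_closure_under hF hd ht hv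
  have hvs := (hF.mem_rectangle (N.point_mem v)).1
  exact ((hγ.mem_closure_under_iff hF hvs).1 hvc)
    ((hγ.mem_under_or_above hF hvs h₁).resolve_left h₂)

/-- The support of a nonzero flow has a top path with positive flow. -/
theorem IsIncreasingFlow.exists_isTopPath (hF : N.IsRectangleMap L F) {h : V → ℝ}
    (hh : N.IsBoundaryPotential h) {θ : E × Bool → ℝ} (hθ : N.IsIncreasingFlow h θ) {e : E}
    (he : θ (e, true) ≠ 0) :
    ∃ γ : N.ABPath, N.IsTopPath L F {e | θ (e, true) ≠ 0} γ ∧ ∀ d ∈ γ.darts, 0 < θ d := by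
  classical
  set bad : N.ABPath → Finset E := fun γ => Finset.univ.filter fun e =>
    θ (e, true) ≠ 0 ∧ ¬ F '' range (N.arc e) ⊆ closure (N.regionUnder L F γ) with hbad
  obtain ⟨d₀, -, hd₀⟩ := hθ.exists_pos he
  obtain ⟨γ₀, -, hγ₀⟩ := hθ.exists_path hh hd₀
  -- A path along the flow with the fewest edges of the support outside the closed region under it.
  -- A remaining bad edge `d` would lie on a path with fewer bad edges.
  obtain ⟨γ, hγ, hmin⟩ := (measure fun γ => (bad γ).card).wf.has_min
    {γ : N.ABPath | ∀ d ∈ γ.darts, 0 < θ d} ⟨γ₀, hγ₀⟩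
  have hcr : N.IsCrossing γ :=
    ABPath.Increasing.isCrossing (h := h) (fun d hd => hθ.lt d (hγ d hd)) hh
  refine ⟨γ, ⟨?_, hcr, ?_⟩, hγ⟩
  · rintro e ⟨d, hd, rfl⟩
    exact (hθ.ne_zero_iff d).1 (hγ d hd).ne'
  rw [image_trace_subset_iff]
  intro e he
  by_contra hcon
  obtain ⟨d, rfl, hd⟩ := hθ.exists_pos he
  have hdγ : d.1 ∉ γ.edges := fun hdγ => hcon (by
    rw [← range_dartPath hF]
    exact (range_dartPath_subset hF hdγ).trans (hcr.trace_subset_closure_under hF))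
  -- Paths inside `D` avoid the region under `γ`, so this region is contained in the one under such
  -- a path and no new bad edges arise.
  set D : Set (E × Bool) :=
    {d | 0 < θ d ∧ Disjoint (range (dartPath hF d)) (N.regionUnder L F γ)} with hD
  have hdD : d ∈ D := by
    refine ⟨hd, Set.disjoint_left.2 ?_⟩
    rintro _ ⟨t, rfl⟩ ht
    exact hcon (by
      rw [← range_dartPath hF]
      exact hcr.range_subset_closure_under hF hdγ ht)
  have hγD : ∀ d ∈ γ.darts, d ∈ D := fun d hd => by
    refine ⟨hγ d hd, Set.disjoint_left.2 fun z hz hz' => ?_⟩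
    exact (connectedComponentIn_subset _ _ hz').2
      (range_dartPath_subset hF (ABPath.mem_edges hd) hz)
  -- At a vertex of `γ` the prolongation follows `γ`. At any other vertex it follows the flow; that
  -- vertex is not under `γ`, so the new edge stays out of the region.
  obtain ⟨γ', hdγ', hγ'⟩ := exists_path_through hh (D := D) (fun d hd => hθ.lt d hd.1)
    (fun d hd hA hB => by
      by_cases hv : F (N.point (N.tgt d)) ∈ F '' N.trace γ.edges
      · obtain ⟨b, hb, hvb | hvb⟩ := exists_mem_darts_of_point_mem hF hv
        · exact ⟨b, hγD b hb, hvb.symm⟩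
        · rcases γ.isWalk.tgt_eq_or hb with h' | ⟨c, hc, h'⟩
          · exact absurd γ.end_mem (by rwa [← h', ← hvb])
          · exact ⟨c, hγD c hc, h'.trans hvb.symm⟩
      · obtain ⟨b, hb, hvb⟩ := hθ.exists_out hA hB (d := PlaneNetwork.rev d)
          (by rw [hθ.rev]; exact neg_ne_zero.2 (ne_of_gt hd.1)) (N.src_rev d)
        refine ⟨b, ⟨hb, hcr.disjoint_range_under hF (v := N.tgt d) ⟨0, ?_⟩ hv fun hu => ?_⟩, hvb⟩
        · rw [Path.source, hvb]
        · exact Set.disjoint_left.1 hd.2 ⟨1, Path.target _⟩ hu)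
    (fun d hd hA hB => by
      by_cases hv : F (N.point (N.src d)) ∈ F '' N.trace γ.edges
      · obtain ⟨b, hb, hvb | hvb⟩ := exists_mem_darts_of_point_mem hF hv
        · rcases γ.isWalk.src_eq_or hb with h' | ⟨c, hc, h'⟩
          · exact absurd γ.start_mem (by rwa [← h', ← hvb])
          · exact ⟨c, hγD c hc, h'.trans hvb.symm⟩
        · exact ⟨b, hγD b hb, hvb.symm⟩
      · obtain ⟨b, hb, hvb⟩ := hθ.exists_in hA hB (ne_of_gt hd.1) rfl
        refine ⟨b, ⟨hb, hcr.disjoint_range_under hF (v := N.src d) ⟨1, ?_⟩ hv fun hu => ?_⟩, hvb⟩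
        · rw [Path.target, hvb]
        · exact Set.disjoint_left.1 hd.2 ⟨0, Path.source _⟩ hu) hdD
  have hcr' : N.IsCrossing γ' :=
    ABPath.Increasing.isCrossing (h := h) (fun d hd => hθ.lt d (hγ' d hd).1) hh
  have hdisj : Disjoint (F '' N.trace γ'.edges) (N.regionUnder L F γ) := by
    rw [disjoint_image_trace_iff]
    rintro _ ⟨b, hb, rfl⟩
    rw [← range_dartPath hF]
    exact (hγ' b hb).2
  have hsub := closure_mono (hcr.regionUnder_subset hF hdisj)
  refine hmin γ' (fun b hb => (hγ' b hb).1) (Finset.card_lt_card ⟨fun e => ?_, fun hss => ?_⟩)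
  · simp only [hbad, Finset.mem_filter, Finset.mem_univ, true_and]
    exact fun h => ⟨h.1, fun h' => h.2 (h'.trans hsub)⟩
  · have : d.1 ∈ bad γ' := hss (Finset.mem_filter.2 ⟨Finset.mem_univ _, he, hcon⟩)
    refine (Finset.mem_filter.1 this).2.2 ?_
    rw [← range_dartPath hF]
    exact (range_dartPath_subset hF (ABPath.mem_edges hdγ')).trans
      (hcr'.trace_subset_closure_under hF)

theorem IsWalk.rev_notMem {l : List (E × Bool)} {u v : V} (hw : N.IsWalk u l v)
    (hn : (u :: l.map N.tgt).Nodup) {d : E × Bool} (hd : d ∈ l) : rev d ∉ l := by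
  induction l generalizing u d with
  | nil => simp at hd
  | cons c l ih =>
    obtain ⟨rfl, hw⟩ := hw
    have hrev : ∀ d : E × Bool, rev d ≠ d := by
      rintro ⟨e, b⟩
      simp [rev]
    have hn' := (List.nodup_cons.1 hn).2
    intro hr
    rcases List.mem_cons.1 hd with rfl | hd
    · rcases List.mem_cons.1 hr with hr | hr
      · exact hrev _ hr
      · exact (hw.notMem_of_nodup hn hr).1 rfl
    · rcases List.mem_cons.1 hr with hr | hr
      · rw [← hr] at hw hn
        exact (hw.notMem_of_nodup hn hd).1 rfl
      · exact ih hw hn' hd hr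

theorem ABPath.nodup_darts (γ : N.ABPath) : γ.darts.Nodup :=
  List.Nodup.of_map _ (List.nodup_cons.1 γ.nodup).2

theorem ABPath.rev_notMem (γ : N.ABPath) {d : E × Bool} (hd : d ∈ γ.darts) : rev d ∉ γ.darts :=
  γ.isWalk.rev_notMem γ.nodup hd

theorem ABPath.fst_ne_of_ne (γ : N.ABPath) {d b : E × Bool} (hd : d ∈ γ.darts)
    (hb : b ∈ γ.darts) (h : b ≠ d) : b.1 ≠ d.1 := fun he =>
  (eq_or_eq_rev he).elim h fun h' => γ.rev_notMem hd (h' ▸ hb)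

/-- Isolates the term of `d` in sums along the path. -/
theorem ABPath.exists_darts_perm (γ : N.ABPath) {d : E × Bool} (hd : d ∈ γ.darts) :
    ∃ l : List (E × Bool), γ.darts.Perm (d :: l) ∧ ∀ b ∈ l, b ∈ γ.darts ∧ b.1 ≠ d.1 := by
  obtain ⟨s, t, hst⟩ := List.append_of_mem hd
  have hperm : γ.darts.Perm (d :: (s ++ t)) := hst ▸ List.perm_middle
  have hnd := List.nodup_cons.1 (hperm.nodup_iff.1 γ.nodup_darts)
  refine ⟨s ++ t, hperm, fun b hb => ?_⟩
  have hbγ := hperm.mem_iff.2 (List.mem_cons_of_mem d hb)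
  exact ⟨hbγ, γ.fst_ne_of_ne hd hbγ fun h => hnd.1 (h ▸ hb)⟩

/-- The middle parameter of an edge. -/
noncomputable def midParameter : unitInterval := ⟨1 / 2, by norm_num, by norm_num⟩

theorem midParameter_ne_zero : midParameter ≠ 0 := fun h => by
  have := congrArg Subtype.val h
  norm_num [midParameter] at this

theorem midParameter_ne_one : midParameter ≠ 1 := fun h => by
  have := congrArg Subtype.val h
  norm_num [midParameter] at this

theorem dartPath_ne_mid (hF : N.IsRectangleMap L F) {b d : E × Bool} (h : b.1 ≠ d.1)
    (t : unitInterval) : dartPath hF b t ≠ dartPath hF d midParameter := fun he =>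
  (dartPath_eq_dartPath hF h he).2.elim midParameter_ne_zero midParameter_ne_one

/-- The conditions on `d` keep its middle point off the vertical sides. In the chart it then lies
strictly above the real axis, so neither the image of `b` nor its reflection passes through it. -/
theorem continuousAt_dartIndex_mid (hF : N.IsRectangleMap L F) {b d : E × Bool} (h : b.1 ≠ d.1)
    (hA : N.tgt d ∉ N.A) (hB : N.src d ∉ N.B) :
    ContinuousAt (fun z => dartIndex hF b (stripChart L z)) (dartPath hF d midParameter) := by
  set z₀ := dartPath hF d midParameter with hz₀
  have hL := hF.1
  have hstrip : ∀ b t, dartPath hF b t ∈ verticalStrip L := fun b t =>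
    (hF.mem_rectangle (N.arc_mem _ _)).1
  have him : 0 < (stripChart L z₀).im := by
    refine lt_of_le_of_ne (stripChart_im_nonneg hL (hstrip _ _)) fun h0 => ?_
    rcases stripChart_im_eq_zero hL (hstrip _ _) h0.symm with h' | h'
    · exact (mem_S₁_of_dartPath hF h').elim (fun h => midParameter_ne_zero h.1) hA
    · exact (mem_S₂_of_dartPath hF h').elim (fun h => midParameter_ne_one h.1) hB
  have hc : Continuous fun t => stripChart L (dartPath hF b t) :=
    continuous_stripChart.comp (dartPath hF b).continuous
  have h1 : ∀ t, stripChart L (dartPath hF b t) ≠ stripChart L z₀ := fun t ht => by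
    apply dartPath_ne_mid hF h t
    rw [← stripChartInv_stripChart hL (hstrip b t), ht, stripChartInv_stripChart hL (hstrip _ _)]
  have h2 : ∀ t, conj (stripChart L (dartPath hF b t)) ≠ stripChart L z₀ := fun t ht => by
    have h3 := stripChart_im_nonneg hL (hstrip b t)
    rw [← ht, conj_im] at him
    linarith
  exact ContinuousAt.comp (g := dartIndex hF b)
    ((continuousAt_logIncrement hc h1).sub (continuousAt_logIncrement (continuous_conj.comp hc) h2))
    continuous_stripChart.continuousAt

theorem continuousAt_list_sum {X ι : Type*} [TopologicalSpace X] {f : ι → X → ℂ} {x : X}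
    (l : List ι) (h : ∀ i ∈ l, ContinuousAt (f i) x) :
    ContinuousAt (fun y => (l.map fun i => f i y).sum) x := by
  induction l with
  | nil => simpa using continuousAt_const
  | cons i l ih =>
    simp only [List.map_cons, List.sum_cons]
    exact (h i (by simp)).add (ih fun j hj => h j (List.mem_cons_of_mem _ hj))

/-- A top path in the support of a flow runs in the direction of the flow. -/
theorem IsTopPath.pos_of_mem (hF : N.IsRectangleMap L F) {h : V → ℝ}
    (hh : N.IsBoundaryPotential h) {θ : E × Bool → ℝ} (hθ : N.IsIncreasingFlow h θ)
    {γ : N.ABPath} (hγ : N.IsTopPath L F {e | θ (e, true) ≠ 0} γ) {d : E × Bool}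
    (hd : d ∈ γ.darts) : 0 < θ d := by
  classical
  by_contra hneg
  have hne : θ d ≠ 0 := (hθ.ne_zero_iff d).2 (hγ.1 (ABPath.mem_edges hd))
  have hpos : 0 < θ (rev d) := by
    rw [hθ.rev]
    exact neg_pos.2 (lt_of_le_of_ne (not_lt.1 hneg) hne)
  -- If `γ` traverses `d` against the flow, some path `δ` along the flow traverses the same edge the
  -- other way. The sum of the two indices is then studied near the middle of this edge.
  obtain ⟨δ, hdδ, hδ⟩ := hθ.exists_path hh hpos
  have hcr := hγ.isCrossing
  have hcrδ : N.IsCrossing δ :=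
    ABPath.Increasing.isCrossing (h := h) (fun b hb => hθ.lt b (hδ b hb)) hh
  have hδH : δ.edges ⊆ {e | θ (e, true) ≠ 0} := by
    rintro _ ⟨b, hb, rfl⟩
    exact (hθ.ne_zero_iff b).1 (hδ b hb).ne'
  have habove : N.regionAbove L F γ ⊆ N.regionAbove L F δ := hcr.regionAbove_subset hF
    ((hcr.subset_closure_under_iff hF).1 ((image_mono (trace_mono hδH)).trans hγ.2.2))
  set z₀ := dartPath hF d midParameter with hz₀
  have hz₀γ : z₀ ∈ F '' N.trace γ.edges :=
    range_dartPath_subset hF (ABPath.mem_edges hd) ⟨_, rfl⟩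
  obtain ⟨l₁, hp₁, hl₁⟩ := γ.exists_darts_perm hd
  obtain ⟨l₂, hp₂, hl₂⟩ := δ.exists_darts_perm hdδ
  have hδne : ∀ b ∈ l₂, b.1 ≠ d.1 := fun b hb => (hl₂ b hb).2
  -- In the sum of the indices of `γ` and `δ` the terms of `d` and `rev d` cancel, so `R` is
  -- continuous at the middle of the edge.
  set R : ℂ → ℂ := fun z => (l₁.map fun b => dartIndex hF b (stripChart L z)).sum +
    (l₂.map fun b => dartIndex hF b (stripChart L z)).sum with hR
  have hR' : ∀ z, R z = (γ.darts.map fun b => dartIndex hF b (stripChart L z)).sum +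
      (δ.darts.map fun b => dartIndex hF b (stripChart L z)).sum := fun z => by
    rw [(hp₁.map _).sum_eq, (hp₂.map _).sum_eq, List.map_cons, List.map_cons, List.sum_cons,
      List.sum_cons, dartIndex_rev]
    simp only [hR]
    ring
  have hcont : ContinuousAt R z₀ := by
    refine (continuousAt_list_sum _ fun b hb => ?_).add (continuousAt_list_sum _ fun b hb => ?_)
    · exact continuousAt_dartIndex_mid hF (hl₁ b hb).2 (hcr d hd).1 (hcr d hd).2
    · exact continuousAt_dartIndex_mid hF (hδne b hb) (hcr d hd).1 (hcr d hd).2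
  -- Approach from above `γ`: such points are also above `δ`, so both indices vanish.
  have hzero : R z₀ = 0 := by
    have := hcont.continuousWithinAt.mem_closure (hcr.trace_subset_closure_above hF hz₀γ)
      (t := {0}) fun z hz => by
        rw [mem_singleton_iff, hR', hcr.sum_dartIndex_of_mem_above hF hz,
          hcrδ.sum_dartIndex_of_mem_above hF (habove hz), add_zero]
    simpa using this
  -- In `O`, a point off `γ` is also off `δ`, so `δ` has a definite index there.
  set O : Set ℂ := (⋃ b ∈ {b | b ∈ l₂}, range (dartPath hF b))ᶜ with hO
  have hOo : IsOpen O := (Set.Finite.isClosed_biUnion (List.finite_toSet _) fun b _ =>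
    (isCompact_range (dartPath hF b).continuous).isClosed).isOpen_compl
  have hz₀O : z₀ ∈ O := by
    simp only [hO, mem_compl_iff, mem_iUnion, not_exists]
    rintro b hb ⟨t, ht⟩
    exact dartPath_ne_mid hF (hδne b hb) t ht
  have hz₀c := hOo.inter_closure ⟨hz₀O, hcr.trace_subset_closure_under hF hz₀γ⟩
  -- Approach from under `γ`: its index is `2πi` and that of `δ` is `2πi` or 0, so `R` cannot tend
  -- to 0.
  have htwo := hcont.continuousWithinAt.mem_closure hz₀c
    (t := {2 * Real.pi * I + 2 * Real.pi * I, 2 * Real.pi * I + 0}) fun z hz => by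
      have hzs := connectedComponentIn_subset _ _ hz.2
      have hzδ : z ∉ F '' N.trace δ.edges := by
        rw [image_trace_edges hF]
        simp only [mem_iUnion, not_exists]
        intro b hb hzb
        rcases List.mem_cons.1 (hp₂.mem_iff.1 hb) with rfl | hbl
        · have hmem : d.1 ∈ γ.edges := ABPath.mem_edges hd
          exact hzs.2 (range_dartPath_subset hF (d := rev d) hmem hzb)
        · refine hz.1 ?_
          simp only [mem_iUnion]
          exact ⟨b, hbl, hzb⟩
      rw [hR', hcr.sum_dartIndex_of_mem_under hF hz.2]
      rcases hcrδ.mem_under_or_above hF hzs.1 hzδ with h' | h'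
      · left
        rw [hcrδ.sum_dartIndex_of_mem_under hF h']
      · right
        rw [hcrδ.sum_dartIndex_of_mem_above hF h']
        rfl
  rw [(toFinite _).isClosed.closure_eq, hzero] at htwo
  rcases htwo with h' | h'
  · refine two_pi_I_ne_zero ?_
    linear_combination -(1 / 2 : ℂ) * h'
  · refine two_pi_I_ne_zero ?_
    rw [mem_singleton_iff, add_zero] at h'
    exact h'.symm

/-- The middle of an edge of `γ` that is not in `γ'` would lie under `γ'`, because `γ'` is a top
path. It is also a limit of points above `γ`, and these are above `γ'` because `γ` is a top path. -/
theorem IsTopPath.edges_subset (hF : N.IsRectangleMap L F) {H : Set E} {γ γ' : N.ABPath}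
    (hγ : N.IsTopPath L F H γ) (hγ' : N.IsTopPath L F H γ') : γ.edges ⊆ γ'.edges := by
  rintro _ ⟨d, hd, rfl⟩
  by_contra hdγ'
  set z₀ := dartPath hF d midParameter with hz₀
  have hz₀γ : z₀ ∈ F '' N.trace γ.edges :=
    range_dartPath_subset hF (ABPath.mem_edges hd) ⟨_, rfl⟩
  have hz₀γ' : z₀ ∉ F '' N.trace γ'.edges :=
    IsCrossing.dartPath_notMem_trace hF hdγ' midParameter_ne_zero midParameter_ne_one
  have hz₀s := mem_verticalStrip_of_trace hF hz₀γ
  have habove : N.regionAbove L F γ ⊆ N.regionAbove L F γ' := hγ.isCrossing.regionAbove_subset hF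
    ((hγ.isCrossing.subset_closure_under_iff hF).1
      ((image_mono (trace_mono hγ'.1)).trans hγ.2.2))
  have hcl := closure_mono habove (hγ.isCrossing.trace_subset_closure_above hF hz₀γ)
  have hnot : z₀ ∉ N.regionAbove L F γ' := (hγ'.isCrossing.mem_closure_under_iff hF hz₀s).1
    (hγ'.2.2 (image_mono (trace_mono hγ.1) hz₀γ))
  have hu := (hγ'.isCrossing.mem_under_or_above hF hz₀s hz₀γ').resolve_right hnot
  obtain ⟨w, hw, hwu⟩ := hγ'.isCrossing.exists_mem_component_of_mem_closure hF hu
    (fun w hw => (connectedComponentIn_subset _ _ hw).1) hcl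
  exact Set.disjoint_left.1 (hγ'.isCrossing.disjoint_under_above hF) hwu hw

/-- An increasing path is determined by its edges. -/
theorem ABPath.Increasing.eq_of_edges_eq {h : V → ℝ} {γ γ' : N.ABPath} (hγ : γ.Increasing h)
    (hγ' : γ'.Increasing h) (he : γ.edges = γ'.edges) : γ = γ' := by
  have key : ∀ {γ γ' : N.ABPath}, γ.Increasing h → γ'.Increasing h → γ.edges = γ'.edges →
      ∀ d ∈ γ.darts, d ∈ γ'.darts := by
    intro γ γ' hγ hγ' he d hd
    obtain ⟨b, hb, hbd⟩ : d.1 ∈ γ'.edges := he ▸ ABPath.mem_edges hd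
    rcases eq_or_eq_rev hbd with rfl | rfl
    · exact hb
    · have h1 := hγ d hd
      have h2 := hγ' _ hb
      rw [src_rev, tgt_rev] at h2
      exact absurd h1 h2.not_gt
  have hpw : ∀ {γ : N.ABPath}, γ.Increasing h →
      γ.darts.Pairwise fun a b => h (N.tgt a) < h (N.tgt b) := fun {γ} hγ =>
    (List.pairwise_map (R := fun x y => h x < h y)).1 (List.pairwise_cons.1 (γ.isWalk.pairwise_lt hγ)).2
  have hperm : γ.darts.Perm γ'.darts := by
    rw [List.perm_ext_iff_of_nodup γ.nodup_darts γ'.nodup_darts]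
    exact fun d => ⟨key hγ hγ' he d, key hγ' hγ he.symm d⟩
  exact ABPath.ext (hperm.eq_of_pairwise
    (fun a b _ _ h1 h2 => absurd h1 h2.not_gt) (hpw hγ) (hpw hγ'))

theorem IsTopPath.unique (hF : N.IsRectangleMap L F) {h : V → ℝ} {H : Set E} {γ γ' : N.ABPath}
    (hγ : N.IsTopPath L F H γ) (hγ' : N.IsTopPath L F H γ') (hi : γ.Increasing h)
    (hi' : γ'.Increasing h) : γ = γ' :=
  hi.eq_of_edges_eq hi' ((hγ.edges_subset hF hγ').antisymm (hγ'.edges_subset hF hγ))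

/-- A finite non-crossing family of crossing paths has a top member. -/
theorem NonCrossingFamily.exists_isTopPath (hF : N.IsRectangleMap L F) {Γ : Finset N.ABPath}
    (hne : Γ.Nonempty) (hcr : ∀ γ ∈ Γ, N.IsCrossing γ) (hΓ : N.NonCrossingFamily L F Γ) :
    ∃ γ ∈ Γ, N.IsTopPath L F {e | ∃ γ' ∈ Γ, e ∈ γ'.edges} γ := by
  classical
  suffices h : ∃ γ ∈ Γ, ∀ γ' ∈ Γ, F '' N.trace γ'.edges ⊆ closure (N.regionUnder L F γ) by
    obtain ⟨γ, hγ, hsub⟩ := h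
    refine ⟨γ, hγ, fun e he => ⟨γ, hγ, he⟩, hcr γ hγ, ?_⟩
    rw [image_trace_subset_iff]
    rintro e ⟨γ', hγ', he⟩
    exact image_trace_subset_iff.1 (hsub γ' hγ') e he
  induction hne using Finset.Nonempty.cons_induction with
  | singleton γ =>
    refine ⟨γ, by simp, fun γ' hγ' => ?_⟩
    rw [Finset.mem_singleton] at hγ'
    subst hγ'
    exact (hcr _ (by simp)).trace_subset_closure_under hF
  | cons γ₀ Γ hγ₀ hne ih =>
    obtain ⟨γ₁, hγ₁, hsub⟩ := ih (fun γ hγ => hcr γ (Finset.mem_cons_of_mem hγ))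
      fun γ hγ γ' hγ' => hΓ γ (Finset.mem_cons_of_mem hγ) γ' (Finset.mem_cons_of_mem hγ')
    have hne' : γ₀ ≠ γ₁ := fun h => hγ₀ (h ▸ hγ₁)
    have hcr₀ := hcr γ₀ (Finset.mem_cons_self γ₀ Γ)
    have hcr₁ := hcr γ₁ (Finset.mem_cons_of_mem hγ₁)
    rcases hΓ γ₀ (Finset.mem_cons_self γ₀ Γ) γ₁ (Finset.mem_cons_of_mem hγ₁) hne' with ht | ht
    · refine ⟨γ₀, Finset.mem_cons_self γ₀ Γ, fun γ' hγ' => ?_⟩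
      rcases Finset.mem_cons.1 hγ' with rfl | hγ'
      · exact hcr₀.trace_subset_closure_under hF
      · exact (hsub γ' hγ').trans (hcr₀.closure_under_subset hF hcr₁
          ((image_mono (trace_mono subset_union_right)).trans ht.2.2))
    · refine ⟨γ₁, Finset.mem_cons_of_mem hγ₁, fun γ' hγ' => ?_⟩
      rcases Finset.mem_cons.1 hγ' with rfl | hγ'
      · exact (image_mono (trace_mono subset_union_left)).trans ht.2.2
      · exact hsub γ' hγ'

end PlaneNetwork

/-! ### Subtraction of path flows, and the extremal density -/

namespace PlaneNetwork

open Set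

variable {V E : Type*} [Fintype V] [Fintype E] {N : PlaneNetwork V E} {L : ℝ} {F : ℂ → ℂ}

theorem rev_rev {E : Type*} (d : E × Bool) : rev (rev d) = d := by
  obtain ⟨e, b⟩ := d
  simp [rev]

theorem IsWalk.sum_sub {l : List (E × Bool)} {u v : V} (hw : N.IsWalk u l v) (g : V → ℝ) :
    (l.map fun d => g (N.tgt d) - g (N.src d)).sum = g v - g u := by
  induction l generalizing u with
  | nil =>
    obtain rfl : u = v := hw
    simp
  | cons d l ih =>
    obtain ⟨rfl, hw⟩ := hw
    rw [List.map_cons, List.sum_cons, ih hw]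
    ring

theorem pathFlow_of_mem (N : PlaneNetwork V E) {γ : N.ABPath} {d : E × Bool}
    (hd : d ∈ γ.darts) : N.pathFlow γ d = 1 := if_pos hd

theorem pathFlow_of_notMem (N : PlaneNetwork V E) {γ : N.ABPath} {d : E × Bool}
    (hd : d.1 ∉ γ.edges) : N.pathFlow γ d = 0 := by
  have hd' : (rev d).1 ∉ γ.edges := hd
  rw [pathFlow, if_neg fun h => hd (ABPath.mem_edges h),
    if_neg fun h => hd' (ABPath.mem_edges h)]

theorem pathFlow_rev (N : PlaneNetwork V E) (γ : N.ABPath) (d : E × Bool) :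
    N.pathFlow γ (rev d) = -N.pathFlow γ d := by
  by_cases h1 : d ∈ γ.darts
  · simp [pathFlow, rev_rev, h1, γ.rev_notMem h1]
  · by_cases h2 : rev d ∈ γ.darts <;> simp [pathFlow, rev_rev, h1, h2]

open Classical in
theorem pathFlow_eq_sub (N : PlaneNetwork V E) (γ : N.ABPath) (d : E × Bool) :
    N.pathFlow γ d = (if d ∈ γ.darts then 1 else 0) - if rev d ∈ γ.darts then 1 else 0 := by
  rw [pathFlow]
  by_cases h1 : d ∈ γ.darts
  · simp [h1, γ.rev_notMem h1]
  · by_cases h2 : rev d ∈ γ.darts <;> simp [h1, h2]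

/-- Kirchhoff's law for the unit flow along a path. -/
theorem sum_pathFlow_eq_zero (γ : N.ABPath) {v : V} (hA : v ∉ N.A) (hB : v ∉ N.B)
    (s : Finset (E × Bool)) (hs : ∀ d, d ∈ s ↔ N.src d = v) : ∑ d ∈ s, N.pathFlow γ d = 0 := by
  classical
  have h1 : ∑ d ∈ s, (if d ∈ γ.darts then (1 : ℝ) else 0) =
      (γ.darts.map fun d => if N.src d = v then (1 : ℝ) else 0).sum := by
    rw [← List.sum_toFinset _ γ.nodup_darts, Finset.sum_ite, Finset.sum_ite]
    simp only [Finset.sum_const_zero, add_zero, Finset.sum_const]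
    congr 2
    ext d
    simp [hs, and_comm]
  have h2 : ∑ d ∈ s, (if rev d ∈ γ.darts then (1 : ℝ) else 0) =
      (γ.darts.map fun d => if N.tgt d = v then (1 : ℝ) else 0).sum := by
    rw [← List.sum_toFinset _ γ.nodup_darts, Finset.sum_ite, Finset.sum_ite]
    simp only [Finset.sum_const_zero, add_zero, Finset.sum_const]
    congr 1
    refine Finset.card_nbij' rev rev ?_ ?_ (fun d _ => rev_rev d) fun d _ => rev_rev d
    · intro d hd
      simpa [hs, tgt_rev, and_comm] using hd
    · intro d hd
      simpa [hs, src_rev, rev_rev, and_comm] using hd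
  -- Arrivals at `v` minus departures from `v` telescope along the path, neither end of which is
  -- `v`.
  have h3 := γ.isWalk.sum_sub fun u => if u = v then (1 : ℝ) else 0
  have hne₁ : N.src (γ.darts.head γ.ne_nil) ≠ v := fun h => hA (h ▸ γ.start_mem)
  have hne₂ : N.tgt (γ.darts.getLast γ.ne_nil) ≠ v := fun h => hB (h ▸ γ.end_mem)
  rw [if_neg hne₁, if_neg hne₂, sub_zero] at h3
  simp only [pathFlow_eq_sub]
  have h4 : ∀ l : List (E × Bool), (l.map fun d => if N.src d = v then (1 : ℝ) else 0).sum -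
      (l.map fun d => if N.tgt d = v then (1 : ℝ) else 0).sum =
      -(l.map fun d => (if N.tgt d = v then (1 : ℝ) else 0) -
        if N.src d = v then (1 : ℝ) else 0).sum := by
    intro l
    induction l with
    | nil => simp
    | cons d l ih =>
      simp only [List.map_cons, List.sum_cons]
      linarith
  rw [Finset.sum_sub_distrib, h1, h2, h4, h3, neg_zero]

theorem IsIncreasingFlow.notMem_rev {h : V → ℝ} {θ : E × Bool → ℝ} (hθ : N.IsIncreasingFlow h θ)
    {γ : N.ABPath} (hγ : ∀ d ∈ γ.darts, 0 < θ d) {d : E × Bool} (hd : 0 ≤ θ d) :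
    PlaneNetwork.rev d ∉ γ.darts := fun hr => by
  have := hγ _ hr
  rw [hθ.rev] at this
  linarith

theorem IsIncreasingFlow.mem_darts_iff {h : V → ℝ} {θ : E × Bool → ℝ}
    (hθ : N.IsIncreasingFlow h θ) {γ : N.ABPath} (hγ : ∀ d ∈ γ.darts, 0 < θ d) {d : E × Bool}
    (hd : 0 ≤ θ d) : d ∈ γ.darts ↔ d.1 ∈ γ.edges := by
  refine ⟨ABPath.mem_edges, ?_⟩
  rintro ⟨b, hb, he⟩
  rcases eq_or_eq_rev he with rfl | rfl
  · exact hb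
  · exact absurd hb (hθ.notMem_rev hγ hd)

theorem IsIncreasingFlow.abs_eq {h : V → ℝ} {θ : E × Bool → ℝ} (hθ : N.IsIncreasingFlow h θ)
    (d : E × Bool) : |θ d| = |θ (d.1, true)| := by
  obtain ⟨e, b⟩ := d
  cases b
  · have := hθ.rev (e, true)
    simp only [PlaneNetwork.rev, Bool.not_true] at this
    rw [this, abs_neg]
  · rfl

theorem IsIncreasingFlow.exists_nonneg {h : V → ℝ} {θ : E × Bool → ℝ}
    (hθ : N.IsIncreasingFlow h θ) (e : E) : ∃ d : E × Bool, d.1 = e ∧ 0 ≤ θ d := by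
  rcases le_total 0 (θ (e, true)) with h0 | h0
  · exact ⟨_, rfl, h0⟩
  · exact ⟨PlaneNetwork.rev (e, true), rfl, by rw [hθ.rev]; linarith⟩

theorem IsIncreasingFlow.pathFlow_eq {h : V → ℝ} {θ : E × Bool → ℝ}
    (hθ : N.IsIncreasingFlow h θ) {γ : N.ABPath} (hγ : ∀ d ∈ γ.darts, 0 < θ d) {d : E × Bool}
    (hd : 0 ≤ θ d) [Decidable (d.1 ∈ γ.edges)] :
    N.pathFlow γ d = if d.1 ∈ γ.edges then 1 else 0 := by
  split_ifs with he
  · exact N.pathFlow_of_mem ((hθ.mem_darts_iff hγ hd).2 he)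
  · exact N.pathFlow_of_notMem he

/-- Subtracting no more than the flow on any edge of the path reverses no edge. -/
theorem IsIncreasingFlow.pos_of_sub_pathFlow_pos {h : V → ℝ} {θ : E × Bool → ℝ}
    (hθ : N.IsIncreasingFlow h θ) {γ : N.ABPath} (hγ : ∀ d ∈ γ.darts, 0 < θ d) {c : ℝ}
    (hcθ : ∀ d ∈ γ.darts, c ≤ θ d) {d : E × Bool} (hd : 0 < θ d - c * N.pathFlow γ d) :
    0 < θ d := by
  by_contra hneg
  by_cases hm : PlaneNetwork.rev d ∈ γ.darts
  · have h1 : N.pathFlow γ d = -1 := by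
      rw [← N.pathFlow_of_mem hm, pathFlow_rev, neg_neg]
    have h2 := hcθ _ hm
    rw [hθ.rev] at h2
    rw [h1] at hd
    linarith
  · have hd' : d ∉ γ.darts := fun h => hneg (hγ d h)
    simp only [pathFlow, hd', hm, if_false, mul_zero, sub_zero] at hd
    exact hneg hd

/-- Subtracting a path flow along positive edges from a flow. -/
theorem IsIncreasingFlow.sub_pathFlow {h : V → ℝ} {θ : E × Bool → ℝ}
    (hθ : N.IsIncreasingFlow h θ) {γ : N.ABPath} (hγ : ∀ d ∈ γ.darts, 0 < θ d) {c : ℝ}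
    (hcθ : ∀ d ∈ γ.darts, c ≤ θ d) :
    N.IsIncreasingFlow h (fun d => θ d - c * N.pathFlow γ d) where
  rev d := by
    simp only [hθ.rev, pathFlow_rev]
    ring
  lt d hd := hθ.lt d (hθ.pos_of_sub_pathFlow_pos hγ hcθ hd)
  sum_eq_zero v hA hB s hs := by
    rw [Finset.sum_sub_distrib, hθ.sum_eq_zero v hA hB s hs, ← Finset.mul_sum,
      sum_pathFlow_eq_zero γ hA hB s hs, mul_zero, sub_zero]

-- In the direction in which `θ` is nonnegative, no absolute value is needed on either side. This
-- identifies the update rule of the algorithm with the subtraction of a path flow.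
open Classical in
theorem IsIncreasingFlow.abs_sub_pathFlow {h : V → ℝ} {θ : E × Bool → ℝ}
    (hθ : N.IsIncreasingFlow h θ) {γ : N.ABPath} (hγ : ∀ d ∈ γ.darts, 0 < θ d) {c : ℝ}
    (hcθ : ∀ d ∈ γ.darts, c ≤ θ d) (e : E) :
    |θ (e, true) - c * N.pathFlow γ (e, true)| =
      if e ∈ γ.edges then |θ (e, true)| - c else |θ (e, true)| := by
  obtain ⟨d, rfl, hd⟩ := hθ.exists_nonneg e
  rw [← (hθ.sub_pathFlow hγ hcθ).abs_eq d, ← hθ.abs_eq d, hθ.pathFlow_eq hγ hd,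
    abs_of_nonneg hd]
  split_ifs with he
  · rw [mul_one, abs_of_nonneg]
    exact sub_nonneg.2 (hcθ d ((hθ.mem_darts_iff hγ hd).2 he))
  · rw [mul_zero, sub_zero, abs_of_nonneg hd]

/-- The paths of a decomposition run in the direction of the flow. -/
theorem IsPathFlowDecomposition.pos_of_mem {f : E × Bool → ℝ} {Γ : Finset N.ABPath}
    {a : N.ABPath → ℝ} (hf : N.IsPathFlowDecomposition f Γ a) {γ : N.ABPath} (hγ : γ ∈ Γ)
    {d : E × Bool} (hd : d ∈ γ.darts) : 0 < f d := by
  rw [hf.2.2 d]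
  refine Finset.sum_pos' (fun γ' hγ' => mul_nonneg (hf.1 γ' hγ').le ?_) ⟨γ, hγ, ?_⟩
  · have hr := hf.2.1 γ hγ γ' hγ' d hd
    rw [pathFlow]
    split_ifs <;> norm_num
  · rw [N.pathFlow_of_mem hd, mul_one]
    exact hf.1 γ hγ

open Classical in
/-- The absolute value of a flow that is decomposed into paths in its direction. -/
theorem IsIncreasingFlow.abs_eq_sum {h : V → ℝ} {θ : E × Bool → ℝ}
    (hθ : N.IsIncreasingFlow h θ) {Γ : Finset N.ABPath} {a : N.ABPath → ℝ}
    (hΓ : ∀ γ ∈ Γ, ∀ d ∈ γ.darts, 0 < θ d) (hsum : ∀ d, θ d = ∑ γ ∈ Γ, a γ * N.pathFlow γ d)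
    (e : E) : |θ (e, true)| = ∑ γ ∈ Γ, if e ∈ γ.edges then a γ else 0 := by
  obtain ⟨d, rfl, hd⟩ := hθ.exists_nonneg e
  rw [← hθ.abs_eq d, abs_of_nonneg hd, hsum d]
  refine Finset.sum_congr rfl fun γ hγ => ?_
  rw [hθ.pathFlow_eq (hΓ γ hγ) hd]
  split_ifs <;> simp

/-- The current flow of the unit voltage. -/
theorem IsUnitVoltage.isIncreasingFlow {h : V → ℝ} (hh : N.IsUnitVoltage h) :
    N.IsIncreasingFlow h (N.currentFlow h) where
  rev d := by
    have : (rev d).1 = d.1 := rfl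
    simp only [currentFlow, src_rev, tgt_rev, this]
    ring
  lt d hd := by
    have := pos_of_mul_pos_right hd (N.weight_pos d.1).le
    linarith
  sum_eq_zero v hA hB s hs := by
    classical
    have hv := hh.2.2 v hA hB
    have hs' : s = Finset.univ.filter fun d => N.src d = v := by
      ext d
      simp [hs]
    rw [HarmonicAt, Finset.mul_sum] at hv
    have : ∀ d ∈ s, N.currentFlow h d = h (N.tgt d) * N.weight d.1 - h v * N.weight d.1 := by
      intro d hd
      rw [currentFlow, (hs d).1 hd]
      ring
    rw [Finset.sum_congr rfl this, Finset.sum_sub_distrib, hs', sub_eq_zero]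
    convert hv.symm

theorem IsUnitVoltage.isBoundaryPotential {h : V → ℝ} (hh : N.IsUnitVoltage h) :
    N.IsBoundaryPotential h := ⟨hh.1, hh.2.1⟩

/-! ### The extremal density -/

theorem pathLength_eq_sum_darts (N : PlaneNetwork V E) (ρ : E → ℝ) (γ : N.ABPath) :
    N.pathLength ρ γ = (γ.darts.map fun d => ρ d.1).sum := by
  classical
  rw [pathLength, ← List.sum_toFinset _ γ.nodup_darts, ← Finset.sum_filter]
  symm
  refine Finset.sum_nbij Prod.fst (fun d hd => ?_) (fun d hd b hb he => ?_) (fun e he => ?_)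
    fun d _ => rfl
  · simpa using ABPath.mem_edges (List.mem_toFinset.1 hd)
  · by_contra hne
    exact γ.fst_ne_of_ne (List.mem_toFinset.1 hb) (List.mem_toFinset.1 hd) hne he
  · obtain ⟨d, hd, rfl⟩ := (Finset.mem_filter.1 he).2
    exact ⟨d, List.mem_toFinset.2 hd, rfl⟩

theorem IsBoundaryPotential.sum_darts {h : V → ℝ} (hh : N.IsBoundaryPotential h)
    (γ : N.ABPath) : (γ.darts.map fun d => h (N.tgt d) - h (N.src d)).sum = 1 := by
  rw [γ.isWalk.sum_sub h, hh.1 _ γ.start_mem, hh.2 _ γ.end_mem, sub_zero]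

/-- The gradient of a function on the vertices. -/
def gradient (N : PlaneNetwork V E) (h : V → ℝ) (e : E) : ℝ := |h (N.head e) - h (N.tail e)|

theorem gradient_fst (N : PlaneNetwork V E) (h : V → ℝ) (d : E × Bool) :
    N.gradient h d.1 = |h (N.tgt d) - h (N.src d)| := by
  obtain ⟨e, b⟩ := d
  cases b
  · exact abs_sub_comm _ _
  · rfl

theorem IsBoundaryPotential.admissible_gradient {h : V → ℝ} (hh : N.IsBoundaryPotential h) :
    N.Admissible (N.gradient h) := by
  refine ⟨fun e => abs_nonneg _, fun γ => ?_⟩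
  rw [pathLength_eq_sum_darts, ← hh.sum_darts γ]
  exact List.sum_le_sum fun d _ => by
    rw [gradient_fst]
    exact le_abs_self _

theorem abs_currentFlow (N : PlaneNetwork V E) (h : V → ℝ) (e : E) :
    |N.currentFlow h (e, true)| = N.weight e * N.gradient h e := by
  rw [currentFlow, abs_mul, abs_of_pos (N.weight_pos e)]
  rfl

/-- The extremal density is the gradient of the unit voltage. -/
theorem IsExtremalDensity.weight_mul {h : V → ℝ} (hh : N.IsUnitVoltage h) {Γ : Finset N.ABPath}
    {a : N.ABPath → ℝ} (hf : N.IsPathFlowDecomposition (N.currentFlow h) Γ a) {ρ : E → ℝ}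
    (hρ : N.IsExtremalDensity ρ) (e : E) : N.weight e * ρ e = |N.currentFlow h (e, true)| := by
  classical
  have hθ := hh.isIncreasingFlow
  have hb := hh.isBoundaryPotential
  set g := N.gradient h with hg
  -- Since `σ g = |f|` is the superposition of the paths, its pairing with a density is the weighted
  -- sum of path lengths. All paths of `Γ` have length one for `g` and at least one for `ρ`.
  have hpair : ∀ ρ : E → ℝ, ∑ e, N.weight e * g e * ρ e = ∑ γ ∈ Γ, a γ * N.pathLength ρ γ := by
    intro ρ
    have h1 : ∀ e, N.weight e * g e * ρ e = ∑ γ ∈ Γ, a γ * if e ∈ γ.edges then ρ e else 0 := by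
      intro e
      rw [← abs_currentFlow, hθ.abs_eq_sum (fun γ hγ d hd => hf.pos_of_mem hγ hd) hf.2.2,
        Finset.sum_mul]
      refine Finset.sum_congr rfl fun γ _ => ?_
      split_ifs <;> simp
    rw [Finset.sum_congr rfl fun e _ => h1 e, Finset.sum_comm]
    simp only [pathLength, Finset.mul_sum]
  have hlen : ∀ γ ∈ Γ, N.pathLength g γ = 1 := by
    intro γ hγ
    rw [pathLength_eq_sum_darts, ← hb.sum_darts γ]
    congr 1
    refine List.map_congr_left fun d hd => ?_
    rw [hg, gradient_fst, abs_of_pos (sub_pos.2 (hθ.lt d (hf.pos_of_mem hγ hd)))]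
  have h1 : ∑ e, N.weight e * g e * g e = ∑ γ ∈ Γ, a γ := by
    rw [hpair]
    exact Finset.sum_congr rfl fun γ hγ => by rw [hlen γ hγ, mul_one]
  have h2 : ∑ γ ∈ Γ, a γ ≤ ∑ e, N.weight e * g e * ρ e := by
    rw [hpair]
    exact Finset.sum_le_sum fun γ hγ => le_mul_of_one_le_right (hf.1 γ hγ).le (hρ.1.2 γ)
  have h3 : ∑ e, N.weight e * ρ e ^ 2 ≤ ∑ e, N.weight e * g e * g e := by
    rw [← hρ.2]
    refine csInf_le ⟨0, ?_⟩ ⟨g, hb.admissible_gradient, Finset.sum_congr rfl fun e _ => by ring⟩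
    rintro x ⟨ρ', -, rfl⟩
    exact Finset.sum_nonneg fun e _ => mul_nonneg (N.weight_pos e).le (sq_nonneg _)
  -- With `S = ∑ a γ`, the expansion is at most `S - 2 * S + S`.
  have h4 : ∑ e, N.weight e * (ρ e - g e) ^ 2 ≤ 0 := by
    have : ∑ e, N.weight e * (ρ e - g e) ^ 2 = ∑ e, N.weight e * ρ e ^ 2 -
        2 * ∑ e, N.weight e * g e * ρ e + ∑ e, N.weight e * g e * g e := by
      rw [Finset.mul_sum, ← Finset.sum_sub_distrib, ← Finset.sum_add_distrib]
      exact Finset.sum_congr rfl fun e _ => by ring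
    rw [this]
    linarith
  have hnn : ∀ e ∈ Finset.univ, 0 ≤ N.weight e * (ρ e - g e) ^ 2 := fun e _ =>
    mul_nonneg (N.weight_pos e).le (sq_nonneg _)
  have h5 := (Finset.sum_eq_zero_iff_of_nonneg hnn).1
    (le_antisymm h4 (Finset.sum_nonneg hnn)) e (Finset.mem_univ e)
  rw [mul_eq_zero, or_iff_right (N.weight_pos e).ne', sq_eq_zero_iff, sub_eq_zero] at h5
  rw [abs_currentFlow, h5]

end PlaneNetwork

/-! ### The algorithm as repeated subtraction of path flows -/

namespace PlaneNetwork

open Set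

variable {V E : Type*} [Fintype V] [Fintype E] {N : PlaneNetwork V E} {L : ℝ} {F : ℂ → ℂ}

/-! ### Runs of the algorithm -/

theorem setOf_abs_ne_zero {E : Type*} (θ : E × Bool → ℝ) :
    {e | |θ (e, true)| ≠ 0} = {e | θ (e, true) ≠ 0} := by
  simp only [ne_eq, abs_eq_zero]

/-- One iteration of the algorithm for the absolute value of a flow. -/
theorem IsIncreasingFlow.of_isLeast {h : V → ℝ} {θ : E × Bool → ℝ} (hθ : N.IsIncreasingFlow h θ)
    {γ : N.ABPath} (hγ : ∀ d ∈ γ.darts, 0 < θ d) {m : ℝ}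
    (hm : IsLeast ((fun e => |θ (e, true)|) '' γ.edges) m) :
    0 < m ∧ (∀ d ∈ γ.darts, m ≤ θ d) ∧ ∃ d ∈ γ.darts, θ d = m := by
  have habs : ∀ d ∈ γ.darts, |θ (d.1, true)| = θ d := fun d hd => by
    rw [← hθ.abs_eq d, abs_of_pos (hγ d hd)]
  obtain ⟨⟨_, ⟨d, hd, rfl⟩, hdm⟩, hle⟩ := hm
  have hdm' : θ d = m := (habs d hd).symm.trans hdm
  refine ⟨hdm' ▸ hγ d hd, fun b hb => ?_, d, hd, hdm'⟩
  rw [← habs b hb]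
  exact hle ⟨b.1, ABPath.mem_edges hb, rfl⟩

/-- Induction over a run that starts with the absolute value of a flow. -/
theorem AlgorithmRun.flow_induction (hF : N.IsRectangleMap L F) {h : V → ℝ}
    (hh : N.IsBoundaryPotential h) {P : (E × Bool → ℝ) → List (N.ABPath × ℝ) → Prop}
    (hdone : P 0 [])
    (hstep : ∀ (θ : E × Bool → ℝ) (γ : N.ABPath) (m : ℝ) (l : List (N.ABPath × ℝ)),
      N.IsIncreasingFlow h θ → N.IsTopPath L F {e | θ (e, true) ≠ 0} γ →
      (∀ d ∈ γ.darts, 0 < θ d) → 0 < m → (∀ d ∈ γ.darts, m ≤ θ d) → (∃ d ∈ γ.darts, θ d = m) →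
      P (fun d => θ d - m * N.pathFlow γ d) l → P θ ((γ, m) :: l))
    {θ : E × Bool → ℝ} (hθ : N.IsIncreasingFlow h θ) {r : E → ℝ}
    (hr : r = fun e => |θ (e, true)|) {l : List (N.ABPath × ℝ)} (hl : N.AlgorithmRun L F r l) :
    P θ l := by
  induction hl generalizing θ with
  | done r hno =>
    subst hr
    rw [setOf_abs_ne_zero] at hno
    -- A nonzero flow has a top path in its support, so the run stops only when the flow is
    -- exhausted.
    have h0 : θ = 0 := by
      funext d
      by_contra hd
      obtain ⟨γ, hγ, -⟩ := hθ.exists_isTopPath hF hh ((hθ.ne_zero_iff d).1 hd)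
      exact hno ⟨γ, hγ⟩
    exact h0 ▸ hdone
  | step r γ m l hγ hm _ ih =>
    subst hr
    rw [setOf_abs_ne_zero] at hγ
    have hpos : ∀ d ∈ γ.darts, 0 < θ d := fun d hd => hγ.pos_of_mem hF hh hθ hd
    obtain ⟨hm0, hmle, hmeq⟩ := hθ.of_isLeast hpos hm
    refine hstep θ γ m l hθ hγ hpos hm0 hmle hmeq (ih (hθ.sub_pathFlow hpos hmle) ?_)
    funext e
    exact (hθ.abs_sub_pathFlow hpos hmle e).symm

theorem IsIncreasingFlow.edges_subset {h : V → ℝ} {θ : E × Bool → ℝ}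
    (hθ : N.IsIncreasingFlow h θ) {γ : N.ABPath} (hγ : ∀ d ∈ γ.darts, 0 < θ d) :
    γ.edges ⊆ {e | θ (e, true) ≠ 0} := by
  rintro _ ⟨d, hd, rfl⟩
  exact (hθ.ne_zero_iff d).1 (hγ d hd).ne'

/-- The paths of a run have positive weights and run in the direction of the flow, the flow is the
sum of their flows, and each of them is above the later ones. -/
theorem AlgorithmRun.spec (hF : N.IsRectangleMap L F) {h : V → ℝ}
    (hh : N.IsBoundaryPotential h) {θ : E × Bool → ℝ} (hθ : N.IsIncreasingFlow h θ)
    {l : List (N.ABPath × ℝ)} (hl : N.AlgorithmRun L F (fun e => |θ (e, true)|) l) :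
    (∀ p ∈ l, 0 < p.2 ∧ ∀ d ∈ p.1.darts, 0 < θ d) ∧
    (∀ d, θ d = (l.map fun p => p.2 * N.pathFlow p.1 d).sum) ∧
    l.Pairwise fun p q => p.1 ≠ q.1 ∧ N.IsTopPath L F (p.1.edges ∪ q.1.edges) p.1 := by
  refine AlgorithmRun.flow_induction hF hh (P := fun θ l =>
    (∀ p ∈ l, 0 < p.2 ∧ ∀ d ∈ p.1.darts, 0 < θ d) ∧
    (∀ d, θ d = (l.map fun p => p.2 * N.pathFlow p.1 d).sum) ∧
    l.Pairwise fun p q => p.1 ≠ q.1 ∧ N.IsTopPath L F (p.1.edges ∪ q.1.edges) p.1)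
    (by simp) ?_ hθ rfl hl
  rintro θ γ m l hθ hγ hpos hm hmle ⟨b, hb, hbm⟩ ⟨h1, h2, h3⟩
  have h1' : ∀ p ∈ l, ∀ d ∈ p.1.darts, 0 < θ d := fun p hp d hd =>
    hθ.pos_of_sub_pathFlow_pos hpos hmle ((h1 p hp).2 d hd)
  refine ⟨?_, fun d => ?_, List.pairwise_cons.2 ⟨fun p hp => ⟨?_, ?_⟩, h3⟩⟩
  · rintro p (_ | ⟨_, hp⟩)
    · exact ⟨hm, hpos⟩
    · exact ⟨(h1 p hp).1, h1' p hp⟩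
  · rw [List.map_cons, List.sum_cons, ← h2]
    ring
  -- The remaining flow vanishes on the minimizing edge `b`, whereas later paths have positive
  -- remaining flow on all their edges.
  · rintro rfl
    have := (h1 p hp).2 b hb
    simp [N.pathFlow_of_mem hb, hbm] at this
  · exact hγ.mono (union_subset hγ.1 (hθ.edges_subset (h1' p hp))) subset_union_left

/-- A non-crossing decomposition of a flow consists of the paths of a run. -/
theorem AlgorithmRun.unique (hF : N.IsRectangleMap L F) {h : V → ℝ}
    (hh : N.IsBoundaryPotential h) {θ : E × Bool → ℝ} (hθ : N.IsIncreasingFlow h θ)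
    {l : List (N.ABPath × ℝ)} (hl : N.AlgorithmRun L F (fun e => |θ (e, true)|) l)
    {Γ : Finset N.ABPath} {a : N.ABPath → ℝ} (ha : ∀ γ ∈ Γ, 0 < a γ)
    (hΓ : ∀ γ ∈ Γ, ∀ d ∈ γ.darts, 0 < θ d) (hsum : ∀ d, θ d = ∑ γ ∈ Γ, a γ * N.pathFlow γ d)
    (hnc : N.NonCrossingFamily L F Γ) :
    (∀ γ, γ ∈ Γ ↔ ∃ w, (γ, w) ∈ l) ∧ ∀ p ∈ l, a p.1 = p.2 := by
  classical
  refine AlgorithmRun.flow_induction hF hh (P := fun θ l => ∀ Γ : Finset N.ABPath,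
    (∀ γ ∈ Γ, 0 < a γ) → (∀ γ ∈ Γ, ∀ d ∈ γ.darts, 0 < θ d) →
    (∀ d, θ d = ∑ γ ∈ Γ, a γ * N.pathFlow γ d) → N.NonCrossingFamily L F Γ →
    (∀ γ, γ ∈ Γ ↔ ∃ w, (γ, w) ∈ l) ∧ ∀ p ∈ l, a p.1 = p.2) ?_ ?_ hθ rfl hl Γ ha hΓ hsum hnc
  · intro Γ _ hΓ _ _
    have : Γ = ∅ := Finset.eq_empty_of_forall_notMem fun γ hγ =>
      lt_irrefl _ (hΓ γ hγ _ (List.head_mem γ.ne_nil))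
    simp [this]
  intro θ γ m l hθ hγ hpos hm hmle hmeq ih Γ ha hΓ hsum hnc
  have hinc : ∀ γ : N.ABPath, (∀ d ∈ γ.darts, 0 < θ d) → γ.Increasing h :=
    fun γ hγ d hd => hθ.lt d (hγ d hd)
  have habs := hθ.abs_eq_sum hΓ hsum
  -- Any subfamily that covers the support has `γ` as its top member. This is used for `Γ` itself
  -- and, to determine the coefficient, for `Γ.erase γ`.
  have htop : ∀ Γ' ⊆ Γ, (∀ e, θ (e, true) ≠ 0 → ∃ γ' ∈ Γ', e ∈ γ'.edges) → γ ∈ Γ' := by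
    intro Γ' hsub hcov
    have hset : {e | ∃ γ' ∈ Γ', e ∈ γ'.edges} = {e | θ (e, true) ≠ 0} :=
      Subset.antisymm (fun e ⟨γ', hγ', he⟩ => hθ.edges_subset (hΓ γ' (hsub hγ')) he) hcov
    have hne : Γ'.Nonempty := by
      obtain ⟨γ', hγ', -⟩ := hcov _ (hγ.1 (ABPath.mem_edges (List.head_mem γ.ne_nil)))
      exact ⟨γ', hγ'⟩
    obtain ⟨γ', hγ', ht⟩ := NonCrossingFamily.exists_isTopPath hF hne
      (fun γ' hγ' => (hinc γ' (hΓ γ' (hsub hγ'))).isCrossing hh)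
      fun γ₁ h₁ γ₂ h₂ => hnc γ₁ (hsub h₁) γ₂ (hsub h₂)
    rw [hset] at ht
    rwa [hγ.unique hF ht (hinc γ hpos) (hinc γ' (hΓ γ' (hsub hγ')))]
  have hγΓ : γ ∈ Γ := htop Γ Subset.rfl fun e he => by
    by_contra! hno
    rw [← abs_ne_zero, habs] at he
    exact he (Finset.sum_eq_zero fun γ' hγ' => if_neg (hno γ' hγ'))
  have hdart : ∀ d ∈ γ.darts, θ d = a γ + ∑ γ' ∈ Γ.erase γ, if d.1 ∈ γ'.edges then a γ' else 0 := by
    intro d hd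
    rw [← abs_of_pos (hpos d hd), hθ.abs_eq, habs, ← Finset.add_sum_erase _ _ hγΓ,
      if_pos (ABPath.mem_edges hd)]
  have hnn : ∀ e, ∀ γ' ∈ Γ.erase γ, 0 ≤ if e ∈ γ'.edges then a γ' else 0 := fun e γ' hγ' => by
    split_ifs
    · exact (ha γ' (Finset.mem_of_mem_erase hγ')).le
    · exact le_rfl
  have haγ : a γ = m := by
    obtain ⟨b, hb, hbm⟩ := hmeq
    refine le_antisymm ?_ (not_lt.1 fun hlt => ?_)
    · rw [← hbm, hdart b hb]
      exact le_add_of_nonneg_right (Finset.sum_nonneg (hnn b.1))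
    -- If `a γ < m`, every edge of `γ` carries flow from other paths too, so the support stays
    -- covered without `γ`.
    · refine Finset.notMem_erase γ Γ (htop (Γ.erase γ) (Finset.erase_subset _ _) fun e he => ?_)
      by_contra! hno
      have hzero : (∑ γ' ∈ Γ.erase γ, if e ∈ γ'.edges then a γ' else 0) = 0 :=
        Finset.sum_eq_zero fun γ' hγ' => if_neg (hno γ' hγ')
      by_cases hem : e ∈ γ.edges
      · obtain ⟨d, hd, rfl⟩ := hem
        have := hmle d hd
        rw [hdart d hd, hzero] at this
        linarith
      · rw [← abs_ne_zero, habs, ← Finset.add_sum_erase _ _ hγΓ, if_neg hem, hzero] at he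
        exact he (add_zero 0)
  have hsum' : ∀ d, θ d - m * N.pathFlow γ d = ∑ γ' ∈ Γ.erase γ, a γ' * N.pathFlow γ' d := by
    intro d
    rw [hsum d, ← Finset.add_sum_erase _ _ hγΓ, haγ, add_sub_cancel_left]
  have hpos' : ∀ γ' ∈ Γ.erase γ, ∀ d ∈ γ'.darts, 0 < θ d - m * N.pathFlow γ d := by
    intro γ' hγ' d hd
    rw [hsum' d]
    have hd0 := hΓ γ' (Finset.mem_of_mem_erase hγ') d hd
    refine Finset.sum_pos' (fun γ₁ h₁ => ?_) ⟨γ', hγ', ?_⟩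
    · rw [hθ.pathFlow_eq (hΓ γ₁ (Finset.mem_of_mem_erase h₁)) hd0.le]
      exact mul_nonneg (ha γ₁ (Finset.mem_of_mem_erase h₁)).le (by split_ifs <;> norm_num)
    · rw [N.pathFlow_of_mem hd, mul_one]
      exact ha γ' (Finset.mem_of_mem_erase hγ')
  obtain ⟨h1, h2⟩ := ih (Γ.erase γ) (fun γ' hγ' => ha γ' (Finset.mem_of_mem_erase hγ')) hpos' hsum'
    fun γ₁ h₁ γ₂ h₂ => hnc γ₁ (Finset.mem_of_mem_erase h₁) γ₂ (Finset.mem_of_mem_erase h₂)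
  refine ⟨fun γ' => ?_, ?_⟩
  · by_cases hγ' : γ' = γ
    · subst hγ'
      simp [hγΓ]
    · simpa [hγ'] using h1 γ'
  · rintro p (_ | ⟨_, hp⟩)
    · exact haγ
    · exact h2 p hp

/-- The algorithm terminates when it starts with the absolute value of a flow. -/
theorem IsIncreasingFlow.exists_algorithmRun (hF : N.IsRectangleMap L F) {h : V → ℝ}
    (hh : N.IsBoundaryPotential h) {θ : E × Bool → ℝ} (hθ : N.IsIncreasingFlow h θ) :
    ∃ l, N.AlgorithmRun L F (fun e => |θ (e, true)|) l := by
  classical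
  induction hn : (Finset.univ.filter fun e => θ (e, true) ≠ 0).card using Nat.strong_induction_on
    generalizing θ with
  | _ n ih =>
  by_cases hex : ∃ γ, N.IsTopPath L F {e | |θ (e, true)| ≠ 0} γ
  swap
  · exact ⟨[], .done _ hex⟩
  obtain ⟨γ, hγ⟩ := hex
  have hγ' := hγ
  rw [setOf_abs_ne_zero] at hγ'
  have hpos : ∀ d ∈ γ.darts, 0 < θ d := fun d hd => hγ'.pos_of_mem hF hh hθ hd
  have hne : ((fun e => |θ (e, true)|) '' γ.edges).Nonempty :=
    ⟨_, _, ABPath.mem_edges (List.head_mem γ.ne_nil), rfl⟩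
  obtain ⟨m, hm⟩ : ∃ m, IsLeast ((fun e => |θ (e, true)|) '' γ.edges) m :=
    ⟨_, hne.csInf_mem (toFinite _), fun x hx => csInf_le (toFinite _).bddBelow hx⟩
  obtain ⟨hm0, hmle, b, hb, hbm⟩ := hθ.of_isLeast hpos hm
  have hθ' := hθ.sub_pathFlow hpos hmle
  -- The support gains no edge and loses the minimizing edge `b`.
  have hlt : (Finset.univ.filter fun e => θ (e, true) - m * N.pathFlow γ (e, true) ≠ 0).card <
      n := by
    rw [← hn]
    refine Finset.card_lt_card ⟨fun e => ?_, fun hss => ?_⟩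
    · simp only [Finset.mem_filter, Finset.mem_univ, true_and]
      intro he h0
      by_cases hem : e ∈ γ.edges
      · exact hγ'.1 hem h0
      · exact he (by rw [h0, N.pathFlow_of_notMem (d := (e, true)) hem, mul_zero, sub_zero])
    · have := hss (Finset.mem_filter.2 ⟨Finset.mem_univ b.1, hγ'.1 (ABPath.mem_edges hb)⟩)
      refine (hθ'.ne_zero_iff b).2 (Finset.mem_filter.1 this).2 ?_
      rw [N.pathFlow_of_mem hb, hbm]
      ring
  obtain ⟨l, hl⟩ := ih _ hlt hθ' rfl
  simp only [hθ.abs_sub_pathFlow hpos hmle] at hl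
  exact ⟨_, .step _ γ m l hγ hm hl⟩

/-! ### The output of the algorithm -/

/-- A list of paths with weights that represents a decomposition. -/
theorem isPathFlowDecomposition_of_list {f : E × Bool → ℝ} {l : List (N.ABPath × ℝ)}
    (hf : ∀ d, f (rev d) = -f d) (hl : ∀ p ∈ l, 0 < p.2 ∧ ∀ d ∈ p.1.darts, 0 < f d)
    (hsum : ∀ d, f d = (l.map fun p => p.2 * N.pathFlow p.1 d).sum)
    (hnd : (l.map Prod.fst).Nodup) {Γ : Finset N.ABPath} {m : N.ABPath → ℝ}
    (hΓ : ∀ γ, γ ∈ Γ ↔ ∃ w, (γ, w) ∈ l) (hm : ∀ γ w, (γ, w) ∈ l → m γ = w) :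
    N.IsPathFlowDecomposition f Γ m := by
  classical
  refine ⟨fun γ hγ => ?_, fun γ hγ γ' hγ' d hd hd' => ?_, fun d => ?_⟩
  · obtain ⟨w, hw⟩ := (hΓ γ).1 hγ
    rw [hm γ w hw]
    exact (hl _ hw).1
  · obtain ⟨w, hw⟩ := (hΓ γ).1 hγ
    obtain ⟨w', hw'⟩ := (hΓ γ').1 hγ'
    have h1 := (hl _ hw).2 d hd
    have h2 := (hl _ hw').2 _ hd'
    rw [hf] at h2
    linarith
  · have hΓ' : Γ = (l.map Prod.fst).toFinset := by
      ext γ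
      simp [hΓ]
    rw [hΓ', List.sum_toFinset _ hnd, List.map_map, hsum d]
    exact congrArg List.sum (List.map_congr_left fun p hp => by
      rw [Function.comp_apply, hm p.1 p.2 hp])

theorem exists_finset_of_list {l : List (N.ABPath × ℝ)} (hnd : (l.map Prod.fst).Nodup) :
    ∃ (Γ : Finset N.ABPath) (m : N.ABPath → ℝ), (∀ γ, γ ∈ Γ ↔ ∃ w, (γ, w) ∈ l) ∧
      ∀ γ w, (γ, w) ∈ l → m γ = w := by
  classical
  refine ⟨(l.map Prod.fst).toFinset, fun γ => if hγ : ∃ w, (γ, w) ∈ l then hγ.choose else 0,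
    fun γ => by simp, fun γ w hw => ?_⟩
  have hex : ∃ w, (γ, w) ∈ l := ⟨w, hw⟩
  simp only [dif_pos hex]
  exact congrArg Prod.snd (List.inj_on_of_nodup_map hnd hex.choose_spec hw rfl)

theorem nonCrossingFamily_of_list {l : List (N.ABPath × ℝ)} {Γ : Finset N.ABPath}
    (hl : l.Pairwise fun p q => p.1 ≠ q.1 ∧ N.IsTopPath L F (p.1.edges ∪ q.1.edges) p.1)
    (hΓ : ∀ γ, γ ∈ Γ ↔ ∃ w, (γ, w) ∈ l) : N.NonCrossingFamily L F Γ := by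
  intro γ hγ γ' hγ' hne
  obtain ⟨w, hw⟩ := (hΓ γ).1 hγ
  obtain ⟨w', hw'⟩ := (hΓ γ').1 hγ'
  have hsymm : ∀ γ γ' : N.ABPath, N.NonCrossing L F γ γ' → N.NonCrossing L F γ' γ :=
    fun γ γ' h => by
      rw [NonCrossing, union_comm]
      exact h.symm
  have hpw : l.Pairwise fun p q => N.NonCrossing L F p.1 q.1 := hl.imp fun h => Or.inl h.2
  have : Std.Symm fun p q : N.ABPath × ℝ => N.NonCrossing L F p.1 q.1 :=
    ⟨fun p q => hsymm p.1 q.1⟩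
  exact hpw.forall hw hw' fun h => hne (congrArg Prod.fst h)

end PlaneNetwork

theorem mainTheorem5 {V E : Type*} [Fintype V] [Fintype E] (N : PlaneNetwork V E)
    (L : ℝ) (F : ℂ → ℂ) (hF : N.IsRectangleMap L F)
    (h : V → ℝ) (hh : N.IsUnitVoltage h)
    (ρ : E → ℝ) (hρ : N.IsExtremalDensity ρ) :
    (∃ Γ m, N.IsAlgorithmOutput L F ρ Γ m) ∧
    ∀ Γ m, N.IsAlgorithmOutput L F ρ Γ m →
      N.NonCrossingFamily L F Γ ∧
      N.IsPathFlowDecomposition (N.currentFlow h) Γ m ∧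
      ∀ Γ' a, N.IsPathFlowDecomposition (N.currentFlow h) Γ' a → N.NonCrossingFamily L F Γ' →
        Γ' = Γ ∧ ∀ γ ∈ Γ, a γ = m γ := by
  have hθ := hh.isIncreasingFlow
  have hb := hh.isBoundaryPotential
  obtain ⟨l₀, hl₀⟩ := hθ.exists_algorithmRun hF hb
  obtain ⟨hpos₀, hsum₀, hpw₀⟩ := hl₀.spec hF hb hθ
  have hnd₀ : (l₀.map Prod.fst).Nodup := List.pairwise_map.2 (hpw₀.imp And.left)
  obtain ⟨Γ₀, m₀, hΓ₀, hm₀⟩ := PlaneNetwork.exists_finset_of_list hnd₀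
  -- A run on `|f|` exists independently of `ρ`. The decomposition that it yields is what identifies
  -- `σρ` with `|f|`.
  have hr : (fun e => N.weight e * ρ e) = fun e => |N.currentFlow h (e, true)| :=
    funext (hρ.weight_mul hh
      (PlaneNetwork.isPathFlowDecomposition_of_list hθ.rev hpos₀ hsum₀ hnd₀ hΓ₀ hm₀))
  refine ⟨⟨Γ₀, m₀, l₀, hr ▸ hl₀, hΓ₀, hm₀⟩, ?_⟩
  rintro Γ m ⟨l, hl, hΓ, hm⟩
  rw [hr] at hl
  obtain ⟨hpos, hsum, hpw⟩ := hl.spec hF hb hθ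
  have hnd : (l.map Prod.fst).Nodup := List.pairwise_map.2 (hpw.imp And.left)
  refine ⟨PlaneNetwork.nonCrossingFamily_of_list hpw hΓ,
    PlaneNetwork.isPathFlowDecomposition_of_list hθ.rev hpos hsum hnd hΓ hm, ?_⟩
  intro Γ' a hf hnc
  obtain ⟨hmem, hval⟩ := hl.unique hF hb hθ hf.1 (fun γ hγ d hd => hf.pos_of_mem hγ hd) hf.2.2 hnc
  refine ⟨Finset.ext fun γ => (hmem γ).trans (hΓ γ).symm, fun γ hγ => ?_⟩
  obtain ⟨w, hw⟩ := (hΓ γ).1 hγ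
  rw [hm γ w hw, hval _ hw]
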